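/- Setting. Fix $k\ge 1$, symmetric matrices $Q\in[0,1]^{k\times k}$ and $W\in\mathbb{R}_{\ge 0}^{k\times k}$, and put $B=Q\odot W$ (entrywise product). Let $\{\mathcal I_i\}_{i=1}^k$ be a partition of $[n]$ into $k$ non-empty blocks, and write $(j)$ for the index of the block containing $j$. In the weighted stochastic block model, each unordered pair $\{i,j\}$ (possibly $i=j$) is, independently of the others, an edge with probability $Q_{(i),(j)}$; then $A_{ij}=A_{ji}=W_{(i),(j)}$ if $\{i,j\}$ is an edge and $A_{ij}=A_{ji}=0$ otherwise. Let $L=\mathrm{diag}(A\mathbb 1)-A$. Given rational functions $g_1,\dots,g_n$ (node dynamics) and $f$ (network coupling), let $G=\mathrm{diag}(g_1,\dots,g_n)$ and let $T_{yu}=(I+GfL)^{-1}G$, a matrix of rational functions of $s$. For a rational transfer matrix $T$ let $\|T(s)\|$ be the spectral norm ($\infty$ at a pole) and $\|T\|_{\mathcal H_\infty}=\sup_{\mathrm{Re}\,s>0}\|T(s)\|$. For $\eta>0$ let $(-j\eta,+j\eta)=\{j\omega:-\eta<\omega<\eta\}$ with $j=\sqrt{-1}$. Reduction algorithm. A clustering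 algorithm (possibly randomized) applied to $L$ returns a partition $\{\hat{\mathcal I}_i\}_{i=1}^k$ of $[n]$ into non-empty blocks. Let $\Lambda_k=\mathrm{diag}(\lambda_1(L),\dots,\lambda_k(L))$ hold the $k$ smallest eigenvalues of $L$ in increasing order, and let $V_k\in\mathbb R^{n\times k}$ have corresponding orthonormal eigenvectors as columns, the first being $\mathbb 1_n/\sqrt n$. Let $P\in\{0,1\}^{n\times k}$ be the matrix whose columns are the indicator vectors of the $\hat{\mathcal I}_i$, let $S$ be a minimizer of $\|V_k-PS\|_F^2$ subject to $Se_1=\mathbb 1_k/\sqrt n$ and $S^T\mathrm{diag}(|\hat{\mathcal I}_i|)S=I_k$, and put $L_k=(S^{-1})^T\Lambda_kS^{-1}$, $\hat g_i=\bigl(\sum_{j\in\hat{\mathcal I}_i}g_j^{-1}\bigr)^{-1}$, $\hat G=\mathrm{diag}(\hat g_1,\dots,\hat g_k)$. The algorithm returns $\hat T_k=P(I_k+\hat GL_kf)^{-1}\hat GP^T$. Assumption 1. (a) There is $\gamma>0$ such that $\mathrm{Re}\,g_i(s)\ge\frac1\gamma|g_i(s)|^2$ for all $i$ and all $\mathrm{Re}\,s>0$;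 and $f$ is positive real: $\mathrm{Re}\,f(s)>0$ for all $\mathrm{Re}\,s>0$, and $f(s)$ is real for real $s$ (not a pole of $f$). (b) For every $\eta>0$ there is $M(\eta)$ with $\sup_{s\in(-j\eta,+j\eta)}|g_i^{-1}(s)|\le M(\eta)$ for all $i$, and $F_l(\eta):=\inf_{s\in(-j\eta,+j\eta)}|f(s)|>0$ (where $|f|=\infty$ at poles). (c) $\max_i|\mathcal I_i|/\min_i|\mathcal I_i|\le\rho$ for some $\rho\ge1$. (d) $\min_iB_{ii}-2\rho\max_i\sum_{j\ne i}B_{ij}\ge\Delta$ for some $\Delta>0$. Assumption 2. For every $\delta>0$ there is $\tilde N(\delta)$ such that, when $n>\tilde N(\delta)$, the clustering algorithm returns the true partition $\{\mathcal I_i\}_{i=1}^k$ (up to the numbering of the blocks) with probability at least $1-\delta$. Theorem. Under Assumptions 1 and 2, the algorithm returns a $\hat T_k$ (for every outcome of the sampling, and every $\hat T_k$ that it can return has the following properties): 1. $\|T_{yu}\|_{\mathcal H_\infty}\le\gamma$ and $\|\hat T_k\|_{\mathcal H_\infty}\le\gamma$. 2. For all $\eta>0$, $0<\delta<1$ and $\epsilon>0$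 there is $N$, depending only on $\delta,\epsilon,\tilde N(\delta/2),\gamma,M(\eta),F_l(\eta),\rho,Q,W$, such that whenever $n\ge N$, with probability at least $1-\delta$, $$\sup_{s\in(-j\eta,+j\eta)}\|T_{yu}(s)-\hat T_k(s)\|\le\epsilon .$$ -/

import Mathlib

open Matrix MeasureTheory ProbabilityTheory
open scoped ENNReal

noncomputable section

/-! Rational transfer functions, their values, and norms -/

/-- `s` is a pole of the rational function `r` (`num` and `denom` are coprime). -/
def IsPole (r : RatFunc ℂ) (s : ℂ) : Prop :=
  r.denom.eval s = 0

/-- The value `r(s)`, meaningful when `s` is not a pole of `r`. -/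
def valueAt (r : RatFunc ℂ) (s : ℂ) : ℂ :=
  r.eval (RingHom.id ℂ) s

open scoped Classical in
/-- The magnitude `|r(s)|`, with value `∞` at a pole. -/
def magnitudeAt (r : RatFunc ℂ) (s : ℂ) : ℝ≥0∞ :=
  if IsPole r s then ⊤ else ‖valueAt r s‖ₑ

/-- A transfer matrix: a matrix of rational functions. -/
abbrev TransferMatrix (n : ℕ) : Type := Matrix (Fin n) (Fin n) (RatFunc ℂ)

open scoped Matrix.Norms.L2Operator in
/-- The spectral norm (`ℓ²`-operator norm) of a complex matrix. -/
def spectralNorm2 {n : ℕ} (A : Matrix (Fin n) (Fin n) ℂ) : ℝ≥0∞ :=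
  ‖A‖ₑ

open scoped Classical in
/-- The spectral norm `‖T(s)‖`, with value `∞` when `s` is a pole of some entry of `T`. -/
def normAt {n : ℕ} (T : TransferMatrix n) (s : ℂ) : ℝ≥0∞ :=
  if ∃ i j, IsPole (T i j) s then ⊤ else spectralNorm2 (T.map fun r => valueAt r s)

/-- `sup_{s ∈ D} ‖T(s)‖`. -/
def supNormOn {n : ℕ} (D : Set ℂ) (T : TransferMatrix n) : ℝ≥0∞ :=
  ⨆ s ∈ D, normAt T s

/-- The `H∞` norm `sup_{Re s > 0} ‖T(s)‖`; it is `∞` if `T` has a pole in the open right half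
plane. -/
def hInfNorm {n : ℕ} (T : TransferMatrix n) : ℝ≥0∞ :=
  supNormOn {s : ℂ | 0 < s.re} T

/-- The segment `(-jη, +jη)` of the imaginary axis. -/
def imagSegment (η : ℝ) : Set ℂ :=
  {s : ℂ | s.re = 0 ∧ -η < s.im ∧ s.im < η}

/-- Output strict passivity with index `γ`: `Re g(s) ≥ |g(s)|² / γ` on the open right half plane. -/
def OutputStrictlyPassive (γ : ℝ) (g : RatFunc ℂ) : Prop :=
  ∀ s : ℂ, 0 < s.re →
    ¬ IsPole g s ∧ 1 / γ * ‖valueAt g s‖ ^ 2 ≤ (valueAt g s).re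

/-- Positive realness: `Re f(s) > 0` on the open right half plane, and `f` is real on the real
axis. -/
def PositiveReal (f : RatFunc ℂ) : Prop :=
  (∀ s : ℂ, 0 < s.re → ¬ IsPole f s ∧ 0 < (valueAt f s).re) ∧
    ∀ s : ℂ, s.im = 0 → ¬ IsPole f s → (valueAt f s).im = 0

/-- `F_l(η) = inf_{s ∈ (-jη, +jη)} |f(s)|`. -/
def couplingInf (f : RatFunc ℂ) (η : ℝ) : ℝ≥0∞ :=
  ⨅ s ∈ imagSegment η, magnitudeAt f s

/-! Partitions and the weighted stochastic block model -/

/-- A `k`-way partition of the `n` nodes: `b j` is the block containing node `j`, and no block is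
empty. -/
abbrev Labeling (n k : ℕ) : Type := {b : Fin n → Fin k // Function.Surjective b}

instance (n k : ℕ) : MeasurableSpace (Labeling n k) := ⊤

/-- The size of block `i`. -/
def blockSize {n k : ℕ} (b : Labeling n k) (i : Fin k) : ℕ :=
  (Finset.univ.filter fun j : Fin n => b.1 j = i).card

/-- Two labelings describe the same partition: they agree up to renaming the blocks. -/
def SamePartition {n k : ℕ} (b c : Labeling n k) : Prop :=
  ∃ σ : Equiv.Perm (Fin k), ∀ j, c.1 j = σ (b.1 j)

/-- The `n × k` indicator matrix `P` of the blocks, over any coefficients. -/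
def indicatorMatrix {n k : ℕ} (R : Type*) [Zero R] [One R] (b : Labeling n k) :
    Matrix (Fin n) (Fin k) R :=
  Matrix.of fun j i => if b.1 j = i then 1 else 0

/-- Admissible edge probabilities `Q` and edge weights `W`. -/
structure IsBlockParameters {k : ℕ} (Q W : Matrix (Fin k) (Fin k) ℝ) : Prop where
  prob_mem : ∀ i j, Q i j ∈ Set.Icc (0 : ℝ) 1
  prob_symm : Q.IsSymm
  weight_nonneg : ∀ i j, 0 ≤ W i j
  weight_symm : W.IsSymm

/-- `X ω e` tells whether the unordered pair of nodes `e` (loops included) is an edge. The pairs are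
independent, and `{i, j}` is an edge with probability `Q` of the blocks of `i` and `j`. -/
structure IsEdgeSample {n k : ℕ} {Ω : Type*} [MeasurableSpace Ω] (P : Measure Ω)
    (Q : Matrix (Fin k) (Fin k) ℝ) (b : Labeling n k) (X : Ω → Sym2 (Fin n) → Bool) : Prop where
  measurable : ∀ e, Measurable fun ω => X ω e
  indep : iIndepFun (fun e ω => X ω e) P
  law : ∀ i j, P {ω | X ω s(i, j) = true} = ENNReal.ofReal (Q (b.1 i) (b.1 j))

/-- The weighted adjacency matrix: an edge `{i, j}` has weight `W` of the blocks of `i` and `j`. -/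
def adjacency {n k : ℕ} (W : Matrix (Fin k) (Fin k) ℝ) (b : Labeling n k)
    (x : Sym2 (Fin n) → Bool) : Matrix (Fin n) (Fin n) ℝ :=
  Matrix.of fun i j => if x s(i, j) = true then W (b.1 i) (b.1 j) else 0

/-- The graph Laplacian `L = D_A - A`, `D_A = diag (A 𝟙)`. -/
def graphLaplacian {n : ℕ} (A : Matrix (Fin n) (Fin n) ℝ) : Matrix (Fin n) (Fin n) ℝ :=
  Matrix.diagonal (fun i => ∑ j, A i j) - A

/-- The Laplacian of the sampled network. -/
def sampledLaplacian {n k : ℕ} (W : Matrix (Fin k) (Fin k) ℝ) (b : Labeling n k)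
    (x : Sym2 (Fin n) → Bool) : Matrix (Fin n) (Fin n) ℝ :=
  graphLaplacian (adjacency W b x)

/-! The network and the reduced model -/

/-- A real matrix, seen as a matrix of constant rational functions. -/
def constMatrix {m n : ℕ} (A : Matrix (Fin m) (Fin n) ℝ) : Matrix (Fin m) (Fin n) (RatFunc ℂ) :=
  A.map fun x => RatFunc.C (x : ℂ)

/-- Closed loop of nodal dynamics `G = diag g` with feedback `f L`: `(I + G f L)⁻¹ G`. -/
def closedLoop {n : ℕ} (g : Fin n → RatFunc ℂ) (L : Matrix (Fin n) (Fin n) ℝ) (f : RatFunc ℂ) :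
    TransferMatrix n :=
  (1 + Matrix.diagonal g * (f • constMatrix L))⁻¹ * Matrix.diagonal g

/-- The `i`-th smallest eigenvalue of a symmetric matrix, with multiplicity and counted from `0`
(`eigenvalues₀` lists the eigenvalues in decreasing order). -/
def ascEigenvalue {n : ℕ} {A : Matrix (Fin n) (Fin n) ℝ} (hA : A.IsHermitian) (i : Fin n) : ℝ :=
  hA.eigenvalues₀ (Fin.cast (Fintype.card_fin n).symm i.rev)

/-- `lam` lists the `k` smallest eigenvalues of the Laplacian `L` in increasing order, and the
columns of `V` are corresponding orthonormal eigenvectors, the first of which is `𝟙 / √n`. -/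
structure IsSpectralEmbedding {n k : ℕ} [NeZero k] (L : Matrix (Fin n) (Fin n) ℝ)
    (V : Matrix (Fin n) (Fin k) ℝ) (lam : Fin k → ℝ) : Prop where
  smallest : ∃ (hL : L.IsHermitian) (hk : k ≤ n), ∀ i, lam i = ascEigenvalue hL (Fin.castLE hk i)
  eigen : L * V = V * Matrix.diagonal lam
  orthonormal : Vᵀ * V = 1
  first : ∀ j, V j 0 = 1 / √(n : ℝ)

/-- Squared Frobenius norm. -/
def frobeniusSq {m n : ℕ} (A : Matrix (Fin m) (Fin n) ℝ) : ℝ :=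
  ∑ i, ∑ j, A i j ^ 2

/-- The constraints `S e₁ = 𝟙 / √n` and `Sᵀ diag(|I_i|) S = I` of the refinement problem. -/
def IsFeasible {n k : ℕ} [NeZero k] (c : Labeling n k) (S : Matrix (Fin k) (Fin k) ℝ) : Prop :=
  (∀ i, S i 0 = 1 / √(n : ℝ)) ∧ Sᵀ * Matrix.diagonal (fun i => (blockSize c i : ℝ)) * S = 1

/-- `S` minimizes `‖V - P S‖_F²` under the constraints. -/
def IsRefinement {n k : ℕ} [NeZero k] (V : Matrix (Fin n) (Fin k) ℝ) (c : Labeling n k)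
    (S : Matrix (Fin k) (Fin k) ℝ) : Prop :=
  IsFeasible c S ∧ ∀ S', IsFeasible c S' →
    frobeniusSq (V - indicatorMatrix ℝ c * S) ≤ frobeniusSq (V - indicatorMatrix ℝ c * S')

/-- Aggregate dynamics of block `i`: `(∑_{j ∈ I_i} g_j⁻¹)⁻¹`. -/
def aggregate {n k : ℕ} (g : Fin n → RatFunc ℂ) (c : Labeling n k) (i : Fin k) : RatFunc ℂ :=
  (∑ j ∈ Finset.univ.filter (fun j : Fin n => c.1 j = i), (g j)⁻¹)⁻¹

/-- The reduced Laplacian `L_k = (S⁻¹)ᵀ Λ_k S⁻¹`. -/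
def reducedLaplacian {k : ℕ} (S : Matrix (Fin k) (Fin k) ℝ) (lam : Fin k → ℝ) :
    Matrix (Fin k) (Fin k) ℝ :=
  (S⁻¹)ᵀ * Matrix.diagonal lam * S⁻¹

/-- `T` can be returned by the reduction algorithm run on `(diag g, L, f)` when its clustering step
returns the partition `c`: `T = P (I + Ĝ L_k f)⁻¹ Ĝ Pᵀ` for some choice of the spectral embedding and
of the solution of the refinement problem. -/
def IsReducedModel {n k : ℕ} [NeZero k] (g : Fin n → RatFunc ℂ) (L : Matrix (Fin n) (Fin n) ℝ)
    (f : RatFunc ℂ) (c : Labeling n k) (T : TransferMatrix n) : Prop :=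
  ∃ (V : Matrix (Fin n) (Fin k) ℝ) (lam : Fin k → ℝ) (S : Matrix (Fin k) (Fin k) ℝ),
    IsSpectralEmbedding L V lam ∧ IsRefinement V c S ∧
      T = indicatorMatrix (RatFunc ℂ) c * closedLoop (aggregate g c) (reducedLaplacian S lam) f *
        (indicatorMatrix (RatFunc ℂ) c)ᵀ

/-! The two standing assumptions -/

/-- Assumptions on the nodal dynamics `g`, the coupling `f` and the block model. -/
structure NetworkAssumption {n k : ℕ} (Q W : Matrix (Fin k) (Fin k) ℝ) (γ ρ : ℝ)
    (b : Labeling n k) (g : Fin n → RatFunc ℂ) (f : RatFunc ℂ) (M : ℝ → ℝ) : Prop where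
  gain_pos : 0 < γ
  passive : ∀ i, OutputStrictlyPassive γ (g i)
  positiveReal : PositiveReal f
  /-- `sup_{s ∈ (-jη, +jη)} |g_i⁻¹(s)| ≤ M(η)`, where `|g_i⁻¹(s)| = |g_i(s)|⁻¹` is `∞` at zeros and `0`
  at poles of `g_i`; so no `g_i` vanishes identically. -/
  inverse_le : ∀ η : ℝ, 0 < η → ∀ i,
    (⨆ s ∈ imagSegment η, (magnitudeAt (g i) s)⁻¹) ≤ ENNReal.ofReal (M η)
  coupling_pos : ∀ η : ℝ, 0 < η → 0 < couplingInf f η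
  one_le_ratio : 1 ≤ ρ
  /-- `n_max / n_min ≤ ρ` -/
  balanced : ∀ i j, (blockSize b i : ℝ) / (blockSize b j : ℝ) ≤ ρ
  /-- `min_i B_ii - 2ρ max_l ∑_{j ≠ l} B_lj ≥ Δ > 0` with `B = Q ⊙ W` -/
  dominant : ∃ Δ : ℝ, 0 < Δ ∧ ∀ i l,
    Δ ≤ (Q ⊙ W) i i - 2 * ρ * ∑ j ∈ Finset.univ.erase l, (Q ⊙ W) l j

/-- Consistency with threshold function `Nt` of a clustering algorithm whose answer on the run `ω` is
`c ω`: once the network has more than `Nt δ` nodes, the true partition is returned with probability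
at least `1 - δ`. The answer may depend on the sampled Laplacian and on internal randomness. -/
def ConsistentClustering {n k : ℕ} {Ω : Type*} [MeasurableSpace Ω] (P : Measure Ω)
    (b : Labeling n k) (c : Ω → Labeling n k) (Nt : ℝ → ℕ) : Prop :=
  ∀ δ : ℝ, 0 < δ → Nt δ < n → ENNReal.ofReal (1 - δ) ≤ P {ω | SamePartition b (c ω)}

end

/-!
At a point `s` of the closed right half plane both closed loops are compressions of the same matrix
`H + f(s) L`, where `H = diag (1 / g(s))`. Passivity says `Re H ≥ 1 / γ`, and `L` is positive
semidefinite, so `Re ⟨x, (H + f(s) L) x⟩ ≥ ‖x‖² / γ` and `T_yu(s) = (H + f(s) L)⁻¹` has norm at most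
`γ`. If `S` is feasible, then `U = P S` has orthonormal columns and
`T̂(s) = U (Uᴴ H U + f(s) Λ)⁻¹ Uᴴ`, which obeys the same bound for the same reason
(`reducedModel_eq_compression`). Poles and zeros are finite in number. It is enough to bound transfer
matrices at all but finitely many points of a set without isolated points, because a rational function
that stays bounded near a point has no pole there (`normAt_le_of_eventually`).

The error is small when two things hold (`norm_sub_closedLoop_le`): `V` is close to `U`, and `L` is
large on the orthogonal complement of the columns of `V`, where `f(s) L` then suppresses the response.
Both follow from perturbation theory. The expected Laplacian maps the vectors constant on the blocks
to themselves, and by diagonal dominance its spectrum there lies below its spectrum on the vectors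
with vanishing block sums, with a gap of order `n` (`exists_hasBlockGap`). If `L` is within `o(n)` of
it, then the lowest `k` eigenvectors of `L` are within `o(1)` of the block vectors
(`HasBlockGap.residual_le`). The polar factor of the projected embedding keeps the first column
`𝟙 / √n` exactly, so it gives a feasible point of the refinement problem with small residual, and the
minimizer `S` can only do better (`IsRefinement.frobeniusSq_le`).

The distance of `L` from its mean only has to be `o(n)`, so moments suffice: the noise `Z` satisfies
`‖Z‖⁴ ≤ ‖Z²‖_F²`, and the mean of the right side is of order `n³`, since a product of four entries has
mean zero when one of them occurs once. Hoeffding's inequality controls the degrees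
(`measure_not_opNormLe_sampledLaplacian_le`).

The algorithm always returns something: the feasible set is compact and nonempty, and a reflection in
the kernel of `L` moves the first vector of an eigenbasis to `𝟙 / √n`.
-/

/-! ### Values of rational functions and of transfer matrices -/

section RationalEvaluation

open Filter Topology

lemma valueAt_eq_div (r : RatFunc ℂ) (s : ℂ) :
    valueAt r s = r.num.eval s / r.denom.eval s := by
  simp [valueAt, RatFunc.eval, Polynomial.eval₂_id]

lemma eventually_not_isPole (r : RatFunc ℂ) : ∀ᶠ s in cofinite, ¬ IsPole r s := by
  have h := Polynomial.finite_setOfPred_isRoot (RatFunc.denom_ne_zero r)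
  simpa [Filter.eventually_cofinite, IsPole, Polynomial.IsRoot] using h

lemma continuousAt_valueAt {r : RatFunc ℂ} {s : ℂ} (h : ¬ IsPole r s) :
    ContinuousAt (fun z => valueAt r z) s := by
  simp only [valueAt_eq_div]
  exact (r.num.continuous.continuousAt).div (r.denom.continuous.continuousAt) h

lemma eventually_valueAt_ne_zero {r : RatFunc ℂ} (hr : r ≠ 0) :
    ∀ᶠ s in cofinite, valueAt r s ≠ 0 := by
  have h := Polynomial.finite_setOfPred_isRoot (RatFunc.num_ne_zero hr)
  have h' : ∀ᶠ s in cofinite, r.num.eval s ≠ 0 := by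
    simpa [Filter.eventually_cofinite, Polynomial.IsRoot] using h
  filter_upwards [h', eventually_not_isPole r] with s h1 h2
  rw [valueAt_eq_div]
  exact div_ne_zero h1 h2

lemma valueAt_add_of_not_isPole {r t : RatFunc ℂ} {s : ℂ} (hr : ¬ IsPole r s)
    (ht : ¬ IsPole t s) : valueAt (r + t) s = valueAt r s + valueAt t s :=
  RatFunc.eval_add _ _ (by simpa [IsPole, Polynomial.eval₂_id] using hr)
    (by simpa [IsPole, Polynomial.eval₂_id] using ht)

lemma valueAt_mul_of_not_isPole {r t : RatFunc ℂ} {s : ℂ} (hr : ¬ IsPole r s)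
    (ht : ¬ IsPole t s) : valueAt (r * t) s = valueAt r s * valueAt t s :=
  RatFunc.eval_mul _ _ (by simpa [IsPole, Polynomial.eval₂_id] using hr)
    (by simpa [IsPole, Polynomial.eval₂_id] using ht)

@[simp] lemma valueAt_C (c s : ℂ) : valueAt (RatFunc.C c) s = c := by simp [valueAt]

@[simp] lemma valueAt_zero (s : ℂ) : valueAt 0 s = 0 := by simp [valueAt]

@[simp] lemma valueAt_one (s : ℂ) : valueAt 1 s = 1 := by simp [valueAt]

lemma eventually_valueAt_add (r t : RatFunc ℂ) :
    ∀ᶠ s in cofinite, valueAt (r + t) s = valueAt r s + valueAt t s := by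
  filter_upwards [eventually_not_isPole r, eventually_not_isPole t] with s h1 h2
  exact valueAt_add_of_not_isPole h1 h2

lemma eventually_valueAt_mul (r t : RatFunc ℂ) :
    ∀ᶠ s in cofinite, valueAt (r * t) s = valueAt r s * valueAt t s := by
  filter_upwards [eventually_not_isPole r, eventually_not_isPole t] with s h1 h2
  exact valueAt_mul_of_not_isPole h1 h2

lemma eventually_valueAt_sub (r t : RatFunc ℂ) :
    ∀ᶠ s in cofinite, valueAt (r - t) s = valueAt r s - valueAt t s := by
  filter_upwards [eventually_valueAt_add (r - t) t] with s h
  rw [sub_add_cancel] at h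
  rw [h]; ring

lemma eventually_valueAt_inv (r : RatFunc ℂ) :
    ∀ᶠ s in cofinite, valueAt r⁻¹ s = (valueAt r s)⁻¹ := by
  rcases eq_or_ne r 0 with rfl | hr
  · simp
  · filter_upwards [eventually_valueAt_mul r⁻¹ r] with s h
    rw [inv_mul_cancel₀ hr, valueAt_one] at h
    exact eq_inv_of_mul_eq_one_left h.symm

lemma eventually_valueAt_sum {ι : Type*} (I : Finset ι) (r : ι → RatFunc ℂ) :
    ∀ᶠ s in cofinite, valueAt (∑ i ∈ I, r i) s = ∑ i ∈ I, valueAt (r i) s := by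
  classical
  induction I using Finset.induction_on with
  | empty => simp
  | insert a I ha ih =>
    filter_upwards [ih, eventually_valueAt_add (r a) (∑ i ∈ I, r i)] with s h1 h2
    rw [Finset.sum_insert ha, Finset.sum_insert ha, h2, h1]

/-- The entrywise value `T(s)` of a matrix of rational functions. -/
noncomputable def evalMatrix {m n : Type*} (T : Matrix m n (RatFunc ℂ)) (s : ℂ) : Matrix m n ℂ :=
  T.map fun r => valueAt r s

@[simp] lemma evalMatrix_apply {m n : Type*} (T : Matrix m n (RatFunc ℂ)) (s : ℂ) (i : m) (j : n) :
    evalMatrix T s i j = valueAt (T i j) s := rfl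

/-- A real matrix, seen as a complex matrix. -/
noncomputable def toComplex {m n : Type*} (A : Matrix m n ℝ) : Matrix m n ℂ :=
  A.map Complex.ofRealHom

@[simp] lemma toComplex_apply {m n : Type*} (A : Matrix m n ℝ) (i : m) (j : n) :
    toComplex A i j = (A i j : ℂ) := rfl

lemma evalMatrix_constMatrix {m n : ℕ} (A : Matrix (Fin m) (Fin n) ℝ) (s : ℂ) :
    evalMatrix (constMatrix A) s = toComplex A := by
  ext i j; simp [constMatrix]

lemma evalMatrix_indicatorMatrix {n k : ℕ} (c : Labeling n k) (s : ℂ) :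
    evalMatrix (indicatorMatrix (RatFunc ℂ) c) s = toComplex (indicatorMatrix ℝ c) := by
  ext i j
  simp only [evalMatrix_apply, toComplex_apply, indicatorMatrix, Matrix.of_apply]
  split_ifs <;> simp

lemma evalMatrix_transpose {m n : Type*} (A : Matrix m n (RatFunc ℂ)) (s : ℂ) :
    evalMatrix Aᵀ s = (evalMatrix A s)ᵀ := rfl

lemma evalMatrix_one {n : Type*} [DecidableEq n] (s : ℂ) :
    evalMatrix (1 : Matrix n n (RatFunc ℂ)) s = 1 := by
  ext i j
  simp only [evalMatrix_apply, Matrix.one_apply]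
  split_ifs <;> simp

lemma evalMatrix_diagonal {n : Type*} [DecidableEq n] (g : n → RatFunc ℂ) (s : ℂ) :
    evalMatrix (Matrix.diagonal g) s = Matrix.diagonal fun i => valueAt (g i) s := by
  ext i j
  simp only [evalMatrix_apply, Matrix.diagonal_apply]
  split_ifs <;> simp

lemma eventually_evalMatrix_mul {l m n : Type*} [Finite l] [Fintype m] [Finite n]
    (A : Matrix l m (RatFunc ℂ)) (B : Matrix m n (RatFunc ℂ)) :
    ∀ᶠ s in cofinite, evalMatrix (A * B) s = evalMatrix A s * evalMatrix B s := by
  have h : ∀ᶠ s in cofinite, ∀ i j, valueAt ((A * B) i j) s = (evalMatrix A s * evalMatrix B s) i j := by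
    simp only [Filter.eventually_all]
    intro i j
    have h1 : ∀ᶠ s in cofinite, ∀ x, valueAt (A i x * B x j) s = valueAt (A i x) s * valueAt (B x j) s :=
      Filter.eventually_all.2 fun x => eventually_valueAt_mul _ _
    filter_upwards [h1, eventually_valueAt_sum Finset.univ fun x => A i x * B x j] with s h1 h2
    rw [Matrix.mul_apply, h2, Matrix.mul_apply]
    exact Finset.sum_congr rfl fun x _ => h1 x
  filter_upwards [h] with s hs
  ext i j
  exact hs i j

lemma eventually_evalMatrix_add {m n : Type*} [Finite m] [Finite n]
    (A B : Matrix m n (RatFunc ℂ)) :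
    ∀ᶠ s in cofinite, evalMatrix (A + B) s = evalMatrix A s + evalMatrix B s := by
  have h : ∀ᶠ s in cofinite, ∀ i j, valueAt (A i j + B i j) s = valueAt (A i j) s + valueAt (B i j) s :=
    Filter.eventually_all.2 fun i => Filter.eventually_all.2 fun j => eventually_valueAt_add _ _
  filter_upwards [h] with s hs
  ext i j
  exact hs i j

lemma eventually_evalMatrix_sub {m n : Type*} [Finite m] [Finite n]
    (A B : Matrix m n (RatFunc ℂ)) :
    ∀ᶠ s in cofinite, evalMatrix (A - B) s = evalMatrix A s - evalMatrix B s := by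
  have h : ∀ᶠ s in cofinite, ∀ i j, valueAt (A i j - B i j) s = valueAt (A i j) s - valueAt (B i j) s :=
    Filter.eventually_all.2 fun i => Filter.eventually_all.2 fun j => eventually_valueAt_sub _ _
  filter_upwards [h] with s hs
  ext i j
  exact hs i j

lemma eventually_evalMatrix_smul {m n : Type*} [Finite m] [Finite n]
    (f : RatFunc ℂ) (A : Matrix m n (RatFunc ℂ)) :
    ∀ᶠ s in cofinite, evalMatrix (f • A) s = valueAt f s • evalMatrix A s := by
  have h : ∀ᶠ s in cofinite, ∀ i j, valueAt (f * A i j) s = valueAt f s * valueAt (A i j) s :=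
    Filter.eventually_all.2 fun i => Filter.eventually_all.2 fun j => eventually_valueAt_mul _ _
  filter_upwards [h] with s hs
  ext i j
  exact hs i j

/-- A rational function that stays bounded by `C` along a filter converging to `s` has no pole at
`s`: its numerator is at most `C` times its denominator, and the two are coprime. -/
lemma not_isPole_of_eventually_norm_le {r : RatFunc ℂ} {s : ℂ} {l : Filter ℂ} [l.NeBot]
    (hl : l ≤ 𝓝 s) (hp : ∀ᶠ z in l, ¬ IsPole r z) {C : ℝ}
    (h : ∀ᶠ z in l, ‖valueAt r z‖ ≤ C) : ¬ IsPole r s := by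
  intro hs
  have hnum : Tendsto (fun z => ‖r.num.eval z‖) l (𝓝 ‖r.num.eval s‖) :=
    (r.num.continuous.norm.tendsto s).mono_left hl
  have hden : Tendsto (fun z => C * ‖r.denom.eval z‖) l (𝓝 (C * ‖r.denom.eval s‖)) :=
    ((r.denom.continuous.norm.tendsto s).mono_left hl).const_mul C
  have hle := le_of_tendsto_of_tendsto hnum hden (by
    filter_upwards [hp, h] with z h1 h2
    rw [valueAt_eq_div, norm_div, div_le_iff₀ (norm_pos_iff.2 h1)] at h2
    exact h2)
  have hs' : r.denom.eval s = 0 := hs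
  rw [hs', norm_zero, mul_zero] at hle
  have hnum0 : r.num.eval s = 0 := norm_le_zero_iff.1 hle
  obtain ⟨a, b, hab⟩ := RatFunc.isCoprime_num_denom r
  have := congrArg (Polynomial.eval s) hab
  simp [hnum0, hs'] at this

lemma nhdsWithin_sdiff_singleton_le_cofinite {D : Set ℂ} {s : ℂ} :
    𝓝[D \ {s}] s ≤ cofinite := by
  have h1 : 𝓝[D \ {s}] s ≤ 𝓝[≠] s := nhdsWithin_mono _ fun z hz => hz.2
  refine h1.trans ?_
  intro t ht
  have : ((tᶜ) \ {s})ᶜ ∈ 𝓝 s :=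
    (IsOpen.mem_nhds ((Set.Finite.subset (by simpa using ht) Set.sdiff_subset).isClosed.isOpen_compl)
      (by simp))
  rw [mem_nhdsWithin_iff_exists_mem_nhds_inter]
  refine ⟨_, this, ?_⟩
  rintro z ⟨h1, h2⟩
  by_contra hz
  exact h1 ⟨hz, h2⟩

lemma eventually_nhdsWithin_of_eventually_cofinite {D : Set ℂ} {s : ℂ} {p : ℂ → Prop}
    (h : ∀ᶠ z in cofinite, z ∈ D → p z) : ∀ᶠ z in 𝓝[D \ {s}] s, p z := by
  filter_upwards [nhdsWithin_sdiff_singleton_le_cofinite h, self_mem_nhdsWithin] with z h1 h2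
  exact h1 h2.1

open scoped Matrix.Norms.L2Operator in
lemma norm_entry_le_l2_opNorm {n : ℕ} (A : Matrix (Fin n) (Fin n) ℂ) (i j : Fin n) :
    ‖A i j‖ ≤ ‖A‖ := by
  have h := Matrix.l2_opNorm_mulVec A (EuclideanSpace.single j (1 : ℂ))
  rw [PiLp.norm_single, norm_one, mul_one] at h
  refine le_trans ?_ h
  refine le_trans ?_ (PiLp.norm_apply_le _ i)
  simp

open scoped Matrix.Norms.L2Operator in
/-- A bound on `‖T(z)‖` at all but finitely many points `z` of `D` extends to the accumulation points
of `D`, which in particular are not poles of `T`. -/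
lemma normAt_le_of_eventually {n : ℕ} {T : TransferMatrix n} {D : Set ℂ} {s : ℂ} {C : ℝ}
    [(𝓝[D \ {s}] s).NeBot] (h : ∀ᶠ z in cofinite, z ∈ D → ‖evalMatrix T z‖ ≤ C) :
    normAt T s ≤ ENNReal.ofReal C := by
  have hle : ∀ᶠ z in 𝓝[D \ {s}] s, ‖evalMatrix T z‖ ≤ C := eventually_nhdsWithin_of_eventually_cofinite h
  have hpole : ∀ i j, ¬ IsPole (T i j) s := fun i j =>
    not_isPole_of_eventually_norm_le (nhdsWithin_le_nhds (s := D \ {s}))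
      (nhdsWithin_sdiff_singleton_le_cofinite (eventually_not_isPole _))
      (hle.mono fun z hz => (norm_entry_le_l2_opNorm (evalMatrix T z) i j).trans hz)
  have hcont : ContinuousAt (fun z => evalMatrix T z) s := by
    refine continuousAt_pi.2 fun i => continuousAt_pi.2 fun j => ?_
    exact continuousAt_valueAt (hpole i j)
  have hfin : ‖evalMatrix T s‖ ≤ C :=
    le_of_tendsto ((hcont.norm).tendsto.mono_left nhdsWithin_le_nhds) hle
  rw [normAt, if_neg (by push Not; exact hpole), spectralNorm2, ← ofReal_norm]
  exact ENNReal.ofReal_le_ofReal hfin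

/-- The matrix `diag h + φ L`. For `h = 1 / g(s)` and `φ = f(s)` its inverse is the value at `s` of the
closed loop. -/
noncomputable def returnMatrix {n : ℕ} (h : Fin n → ℂ) (φ : ℂ) (L : Matrix (Fin n) (Fin n) ℝ) :
    Matrix (Fin n) (Fin n) ℂ :=
  Matrix.diagonal h + φ • toComplex L

/-- If `diag (1 / g(s)) + f(s) L` is injective at infinitely many `s`, then `1 + G f L` is invertible
over the rational functions, and the closed loop evaluates to the inverse of
`diag (1 / g(s)) + f(s) L` at all but finitely many `s`. -/
lemma eventually_returnMatrix_mul_closedLoop {n : ℕ} {g : Fin n → RatFunc ℂ} (hg : ∀ i, g i ≠ 0)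
    (L : Matrix (Fin n) (Fin n) ℝ) (f : RatFunc ℂ)
    (hinj : ∃ᶠ s in cofinite, ∀ x : Fin n → ℂ,
      returnMatrix (fun i => (valueAt (g i) s)⁻¹) (valueAt f s) L *ᵥ x = 0 → x = 0) :
    ∀ᶠ s in cofinite, returnMatrix (fun i => (valueAt (g i) s)⁻¹) (valueAt f s) L *
      evalMatrix (closedLoop g L f) s = 1 := by
  set N : Matrix (Fin n) (Fin n) (RatFunc ℂ) :=
    1 + Matrix.diagonal g * (f • constMatrix L) with hN
  have hg0 : ∀ᶠ s in cofinite, ∀ i, valueAt (g i) s ≠ 0 :=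
    Filter.eventually_all.2 fun i => eventually_valueAt_ne_zero (hg i)
  have hNs : ∀ᶠ s in cofinite, evalMatrix N s = Matrix.diagonal (fun i => valueAt (g i) s) *
      returnMatrix (fun i => (valueAt (g i) s)⁻¹) (valueAt f s) L := by
    filter_upwards [hg0, eventually_evalMatrix_add 1 (Matrix.diagonal g * (f • constMatrix L)),
      eventually_evalMatrix_mul (Matrix.diagonal g) (f • constMatrix L),
      eventually_evalMatrix_smul f (constMatrix L)] with s h0 h1 h2 h3
    rw [hN, h1, h2, h3, evalMatrix_constMatrix, evalMatrix_diagonal, evalMatrix_one, returnMatrix,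
      mul_add, Matrix.diagonal_mul_diagonal]
    congr 1
    simp [h0]
  have hdet : N.det ≠ 0 := by
    intro hdet
    obtain ⟨v, hv, hNv⟩ := Matrix.exists_mulVec_eq_zero_iff.2 hdet
    refine hv (funext fun i => ?_)
    by_contra hvi
    set w : Matrix (Fin n) (Fin 1) (RatFunc ℂ) := Matrix.of fun i _ => v i with hw
    have hNw : N * w = 0 := by
      ext i j
      exact congrFun hNv i
    obtain ⟨s, h1, h2, h3, h4, h5⟩ := (hinj.and_eventually (hg0.and (hNs.and
      ((eventually_evalMatrix_mul N w).and (eventually_valueAt_ne_zero hvi))))).exists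
    refine h5 (congrFun (h1 (fun i => valueAt (v i) s) ?_) i)
    rw [hNw, h3, Matrix.mul_assoc] at h4
    ext i
    have := congrFun (congrFun h4 i) 0
    rw [Matrix.diagonal_mul] at this
    have h0 : evalMatrix (0 : Matrix (Fin n) (Fin 1) (RatFunc ℂ)) s i 0 = 0 := by simp
    rw [h0] at this
    exact (mul_eq_zero.1 this.symm).resolve_left (h2 i)
  have hT : N * closedLoop g L f = Matrix.diagonal g := by
    rw [closedLoop, ← Matrix.mul_assoc, Matrix.mul_nonsing_inv _ (isUnit_iff_ne_zero.2 hdet),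
      Matrix.one_mul]
  filter_upwards [hg0, hNs, eventually_evalMatrix_mul N (closedLoop g L f)] with s h0 h1 h2
  rw [hT, h1, evalMatrix_diagonal, Matrix.mul_assoc] at h2
  ext i j
  have := congrFun (congrFun h2 i) j
  rw [Matrix.diagonal_mul, Matrix.diagonal_apply] at this
  rw [Matrix.one_apply]
  refine mul_left_cancel₀ (h0 i) (this.symm.trans ?_)
  split_ifs <;> simp

end RationalEvaluation

/-! ### Accretive matrices and the comparison of the two closed loops at a point -/

section Accretive

open scoped Matrix.Norms.L2Operator

variable {n k m : ℕ}

lemma toComplex_mul {l m n : Type*} [Fintype m] (A : Matrix l m ℝ) (B : Matrix m n ℝ) :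
    toComplex (A * B) = toComplex A * toComplex B := Matrix.map_mul

lemma toComplex_one : toComplex (1 : Matrix (Fin n) (Fin n) ℝ) = 1 := by
  simp [toComplex]

lemma toComplex_sub (A B : Matrix (Fin n) (Fin m) ℝ) :
    toComplex (A - B) = toComplex A - toComplex B := by
  ext; simp

lemma conjTranspose_toComplex (A : Matrix (Fin n) (Fin m) ℝ) :
    (toComplex A)ᴴ = toComplex Aᵀ := by
  ext; simp

lemma transpose_toComplex (A : Matrix (Fin n) (Fin m) ℝ) :
    (toComplex A)ᵀ = toComplex Aᵀ := rfl

lemma norm_toLp_sq (x : Fin n → ℂ) : ‖WithLp.toLp 2 x‖ ^ 2 = (star x ⬝ᵥ x).re := by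
  rw [EuclideanSpace.norm_sq_eq, dotProduct, Complex.re_sum]
  refine Finset.sum_congr rfl fun i _ => ?_
  simp only [Pi.star_apply, Complex.star_def, ← Complex.normSq_eq_norm_sq]
  rw [← Complex.normSq_eq_conj_mul_self, Complex.ofReal_re]

lemma re_star_dotProduct_le (x y : Fin n → ℂ) :
    (star x ⬝ᵥ y).re ≤ ‖WithLp.toLp 2 x‖ * ‖WithLp.toLp 2 y‖ := by
  have h := norm_inner_le_norm (𝕜 := ℂ) (WithLp.toLp 2 x) (WithLp.toLp 2 y)
  rw [EuclideanSpace.inner_toLp_toLp, dotProduct_comm] at h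
  exact (Complex.re_le_norm _).trans h

lemma l2_opNorm_le_of_forall {A : Matrix (Fin m) (Fin n) ℂ} {C : ℝ} (hC : 0 ≤ C)
    (h : ∀ x : Fin n → ℂ, ‖WithLp.toLp 2 (A *ᵥ x)‖ ≤ C * ‖WithLp.toLp 2 x‖) : ‖A‖ ≤ C := by
  rw [Matrix.l2_opNorm_def]
  exact ContinuousLinearMap.opNorm_le_bound _ hC fun x => h x.ofLp

lemma norm_mulVec_le (A : Matrix (Fin m) (Fin n) ℂ) (x : Fin n → ℂ) :
    ‖WithLp.toLp 2 (A *ᵥ x)‖ ≤ ‖A‖ * ‖WithLp.toLp 2 x‖ :=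
  Matrix.l2_opNorm_mulVec A (WithLp.toLp 2 x)

/-- `Re ⟨x, A x⟩ ≥ c ‖x‖²` for all `x`. -/
def IsAccretive (c : ℝ) (A : Matrix (Fin n) (Fin n) ℂ) : Prop :=
  ∀ x : Fin n → ℂ, c * ‖WithLp.toLp 2 x‖ ^ 2 ≤ (star x ⬝ᵥ A *ᵥ x).re

lemma IsAccretive.norm_le {c : ℝ} (hc : 0 < c) {A : Matrix (Fin n) (Fin n) ℂ}
    (hA : IsAccretive c A) {W R : Matrix (Fin n) (Fin m) ℂ} (h : A * W = R) :
    ‖W‖ ≤ ‖R‖ / c := by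
  refine l2_opNorm_le_of_forall (by positivity) fun x => ?_
  have h1 := hA (W *ᵥ x)
  rw [Matrix.mulVec_mulVec, h] at h1
  have h2 := h1.trans (re_star_dotProduct_le _ _)
  have h3 := norm_mulVec_le R x
  set a := ‖WithLp.toLp 2 (W *ᵥ x)‖
  rw [div_mul_eq_mul_div, le_div_iff₀ hc]
  rcases (norm_nonneg _ : 0 ≤ a).eq_or_lt with h0 | h0
  · change a * c ≤ _
    rw [show a = 0 from h0.symm, zero_mul]; positivity
  · have : a * (a * c) ≤ a * (‖R‖ * ‖WithLp.toLp 2 x‖) := by nlinarith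
    exact le_of_mul_le_mul_left this h0

lemma IsAccretive.injective {c : ℝ} (hc : 0 < c) {A : Matrix (Fin n) (Fin n) ℂ}
    (hA : IsAccretive c A) {x : Fin n → ℂ} (h : A *ᵥ x = 0) : x = 0 := by
  have h1 := hA x
  rw [h, dotProduct_zero, Complex.zero_re] at h1
  have h2 : ‖WithLp.toLp 2 x‖ ^ 2 ≤ 0 := by
    by_contra hx
    nlinarith [mul_pos hc (not_le.1 hx)]
  have h3 : ‖WithLp.toLp 2 x‖ = 0 := by nlinarith [norm_nonneg (WithLp.toLp 2 x)]
  simpa using h3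

open scoped MatrixOrder in
/-- The Hermitian form of a positive semidefinite real matrix is real and nonnegative. -/
lemma exists_star_dotProduct_toComplex_mulVec {A : Matrix (Fin n) (Fin n) ℝ} (hA : A.PosSemidef)
    (x : Fin n → ℂ) : ∃ q : ℝ, 0 ≤ q ∧ star x ⬝ᵥ toComplex A *ᵥ x = q := by
  obtain ⟨B, hB⟩ := CStarAlgebra.nonneg_iff_eq_star_mul_self.1 hA.nonneg
  have hB' : toComplex A = (toComplex B)ᴴ * toComplex B := by
    rw [hB, toComplex_mul, conjTranspose_toComplex, Matrix.star_eq_conjTranspose,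
      Matrix.conjTranspose_eq_transpose_of_trivial]
  refine ⟨∑ i, Complex.normSq ((toComplex B *ᵥ x) i),
    Finset.sum_nonneg fun i _ => Complex.normSq_nonneg _, ?_⟩
  rw [hB', ← Matrix.mulVec_mulVec, Matrix.dotProduct_mulVec, Matrix.vecMul_conjTranspose, star_star,
    dotProduct, Complex.ofReal_sum]
  refine Finset.sum_congr rfl fun i _ => ?_
  rw [Complex.normSq_eq_conj_mul_self]
  rfl

lemma IsAccretive.add_smul_toComplex {c : ℝ} {A : Matrix (Fin n) (Fin n) ℂ} (hA : IsAccretive c A)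
    {φ : ℂ} (hφ : 0 ≤ φ.re) {L : Matrix (Fin n) (Fin n) ℝ} (hL : L.PosSemidef) :
    IsAccretive c (A + φ • toComplex L) := by
  intro x
  obtain ⟨q, hq, h⟩ := exists_star_dotProduct_toComplex_mulVec hL x
  rw [Matrix.add_mulVec, dotProduct_add, Matrix.smul_mulVec, dotProduct_smul, h, Complex.add_re]
  have : (φ • (q : ℂ)).re = φ.re * q := by simp
  rw [this]
  have := hA x
  have := mul_nonneg hφ hq
  linarith

lemma isAccretive_diagonal {c : ℝ} {h : Fin n → ℂ} (hh : ∀ i, c ≤ (h i).re) :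
    IsAccretive c (Matrix.diagonal h) := by
  intro x
  rw [EuclideanSpace.norm_sq_eq, dotProduct, Complex.re_sum, Finset.mul_sum]
  refine Finset.sum_le_sum fun i _ => ?_
  rw [Matrix.mulVec_diagonal]
  have : (star x i * (h i * x i)).re = (h i).re * ‖x i‖ ^ 2 := by
    rw [← Complex.normSq_eq_norm_sq, mul_left_comm, Pi.star_apply, Complex.star_def,
      ← Complex.normSq_eq_conj_mul_self, mul_comm, Complex.re_ofReal_mul, mul_comm]
  rw [this]
  exact mul_le_mul_of_nonneg_right (hh i) (by positivity)

lemma isAccretive_returnMatrix {c : ℝ} {h : Fin n → ℂ} (hh : ∀ i, c ≤ (h i).re)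
    {φ : ℂ} (hφ : 0 ≤ φ.re) {L : Matrix (Fin n) (Fin n) ℝ} (hL : L.PosSemidef) :
    IsAccretive c (returnMatrix h φ L) :=
  (isAccretive_diagonal hh).add_smul_toComplex hφ hL

/-- Accretivity is inherited by the compression to the span of orthonormal columns. -/
lemma IsAccretive.compress {c : ℝ} {A : Matrix (Fin n) (Fin n) ℂ} (hA : IsAccretive c A)
    {U : Matrix (Fin n) (Fin k) ℂ} (hU : Uᴴ * U = 1) : IsAccretive c (Uᴴ * A * U) := by
  intro x
  have h := hA (U *ᵥ x)
  have h1 : ‖WithLp.toLp 2 (U *ᵥ x)‖ ^ 2 = ‖WithLp.toLp 2 x‖ ^ 2 := by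
    rw [norm_toLp_sq, norm_toLp_sq, Matrix.star_mulVec, ← Matrix.dotProduct_mulVec,
      Matrix.mulVec_mulVec, hU, Matrix.one_mulVec]
  rw [h1, Matrix.star_mulVec, ← Matrix.dotProduct_mulVec, Matrix.mulVec_mulVec,
    Matrix.mulVec_mulVec] at h
  simpa only [Matrix.mul_assoc] using h

lemma l2_opNorm_one_le : ‖(1 : Matrix (Fin n) (Fin n) ℂ)‖ ≤ 1 := by
  rw [← Matrix.diagonal_one, Matrix.l2_opNorm_diagonal]
  exact (pi_norm_le_iff_of_nonneg zero_le_one).2 fun i => by simp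

lemma l2_opNorm_le_one_of_orthonormal {U : Matrix (Fin n) (Fin k) ℂ} (hU : Uᴴ * U = 1) :
    ‖U‖ ≤ 1 := by
  have h := Matrix.l2_opNorm_conjTranspose_mul_self U
  rw [hU] at h
  have := l2_opNorm_one_le (n := k)
  nlinarith [norm_nonneg U]

lemma l2_opNorm_toComplex_sq_le (A : Matrix (Fin n) (Fin k) ℝ) :
    ‖toComplex A‖ ^ 2 ≤ frobeniusSq A := by
  have h0 : 0 ≤ frobeniusSq A :=
    Finset.sum_nonneg fun i _ => Finset.sum_nonneg fun j _ => sq_nonneg _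
  rw [← Real.sqrt_le_sqrt_iff h0, Real.sqrt_sq (norm_nonneg _)]
  refine l2_opNorm_le_of_forall (Real.sqrt_nonneg _) fun x => ?_
  refine abs_le_of_sq_le_sq' ?_ (by positivity) |>.2
  rw [mul_pow, Real.sq_sqrt h0, EuclideanSpace.norm_sq_eq, EuclideanSpace.norm_sq_eq, frobeniusSq,
    Finset.sum_mul]
  refine Finset.sum_le_sum fun i _ => ?_
  have h1 : ‖(toComplex A *ᵥ x) i‖ ≤ ∑ j, |A i j| * ‖x j‖ := by
    rw [Matrix.mulVec, dotProduct]
    refine (norm_sum_le _ _).trans (le_of_eq (Finset.sum_congr rfl fun j _ => ?_))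
    rw [norm_mul, toComplex_apply, Complex.norm_real, Real.norm_eq_abs]
  refine (pow_le_pow_left₀ (norm_nonneg _) h1 2).trans ?_
  refine (Finset.sum_mul_sq_le_sq_mul_sq _ _ _).trans (le_of_eq ?_)
  simp

/-- The comparison of the full closed loop `X` and of the reduced closed loop `U Y` at a point. Both
are compressions of the same return matrix, to the `k` lowest modes `V` of `L` (up to the part of `X`
outside `V`, which the large eigenvalues of `L` make small) and to the span of `U`. -/
lemma norm_sub_closedLoop_le {H L X : Matrix (Fin n) (Fin n) ℂ} {Λ : Matrix (Fin k) (Fin k) ℂ}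
    {V U : Matrix (Fin n) (Fin k) ℂ} {Y : Matrix (Fin k) (Fin n) ℂ} {φ : ℂ} {γ M F c ξ : ℝ}
    (hγ : 0 < γ) (hM : 0 ≤ M) (hF : 0 < F) (hc : 0 < c)
    (hHM : ‖H‖ ≤ M) (hφ : F ≤ ‖φ‖)
    (hV : Vᴴ * V = 1) (hU : Uᴴ * U = 1) (hLV : L * V = V * Λ) (hVL : Vᴴ * L = Λ * Vᴴ)
    (hLc : IsAccretive c (L + (c : ℂ) • (V * Vᴴ)))
    (hacc : IsAccretive (1 / γ) (H + φ • L))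
    (haccU : IsAccretive (1 / γ) (Uᴴ * H * U + φ • Λ))
    (hξ : ‖V - U‖ ≤ ξ)
    (hX : (H + φ • L) * X = 1) (hY : (Uᴴ * H * U + φ • Λ) * Y = Uᴴ) :
    ‖X - U * Y‖ ≤ 2 * (1 + M * γ) / (F * c) + ξ * γ +
      γ * (ξ + M * (ξ * γ + 2 * (1 + M * γ) / (F * c)) + ξ * (M * γ)) := by
  have hU1 := l2_opNorm_le_one_of_orthonormal hU
  have hV1 := l2_opNorm_le_one_of_orthonormal hV
  have hUc : ‖Uᴴ‖ ≤ 1 := by rwa [Matrix.l2_opNorm_conjTranspose]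
  have hVc : ‖Vᴴ‖ ≤ 1 := by rwa [Matrix.l2_opNorm_conjTranspose]
  have hξ0 : 0 ≤ ξ := (norm_nonneg _).trans hξ
  have hγ0 : (0 : ℝ) < 1 / γ := by positivity
  have mulle : ∀ {a b c : ℕ} (A : Matrix (Fin a) (Fin b) ℂ) (B : Matrix (Fin b) (Fin c) ℂ)
      {p q : ℝ}, ‖A‖ ≤ p → ‖B‖ ≤ q → ‖A * B‖ ≤ p * q := fun A B p q h1 h2 =>
    (Matrix.l2_opNorm_mul A B).trans
      (mul_le_mul h1 h2 (norm_nonneg _) ((norm_nonneg _).trans h1))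
  have hXγ : ‖X‖ ≤ γ := by
    refine (hacc.norm_le hγ0 hX).trans ?_
    rw [div_div_eq_mul_div, div_one]
    nlinarith [l2_opNorm_one_le (n := n)]
  -- the component of `X` outside the modes `V`
  set Z := X - V * (Vᴴ * X) with hZ
  set χ := 2 * (1 + M * γ) / (F * c) with hχ
  have hLX : φ • (L * X) = 1 - H * X := by
    rw [← hX, Matrix.add_mul, Matrix.smul_mul]; abel
  have hHX : ‖H * X‖ ≤ M * γ := mulle _ _ hHM hXγ
  have hLXn : ‖L * X‖ ≤ (1 + M * γ) / F := by
    rw [le_div_iff₀ hF]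
    have h1 : ‖φ‖ * ‖L * X‖ ≤ 1 + M * γ := by
      rw [← norm_smul, hLX]
      exact (norm_sub_le _ _).trans (add_le_add l2_opNorm_one_le hHX)
    nlinarith [norm_nonneg (L * X)]
  have hZn : ‖Z‖ ≤ χ := by
    have h1 : (L + (c : ℂ) • (V * Vᴴ)) * Z = L * X - V * (Vᴴ * (L * X)) := by
      have e1 : L * (V * (Vᴴ * X)) = V * (Vᴴ * (L * X)) := by
        rw [← Matrix.mul_assoc, hLV, ← Matrix.mul_assoc Vᴴ L X, hVL]
        simp only [Matrix.mul_assoc]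
      have e2 : V * Vᴴ * Z = 0 := by
        rw [hZ, Matrix.mul_sub, Matrix.mul_assoc, Matrix.mul_assoc, ← Matrix.mul_assoc Vᴴ V, hV,
          Matrix.one_mul, sub_self]
      rw [Matrix.add_mul, Matrix.smul_mul, e2, smul_zero, add_zero, hZ, Matrix.mul_sub, e1]
    refine (hLc.norm_le hc h1).trans ?_
    have h2 : ‖V * (Vᴴ * (L * X))‖ ≤ 1 * (1 * ((1 + M * γ) / F)) :=
      mulle _ _ hV1 (mulle _ _ hVc hLXn)
    have h3 : ‖L * X - V * (Vᴴ * (L * X))‖ ≤ 2 * ((1 + M * γ) / F) :=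
      (norm_sub_le _ _).trans (by linarith)
    rw [hχ, div_le_iff₀ hc]
    refine h3.trans (le_of_eq ?_)
    field_simp
  -- the difference of the coordinates of the two responses solves the reduced equation with a small
  -- right-hand side
  set W := Vᴴ * X - Y with hW
  have hVX : ‖Vᴴ * X‖ ≤ γ := by simpa using mulle _ _ hVc hXγ
  have hWeq : (Uᴴ * H * U + φ • Λ) * W =
      (V - U)ᴴ - Uᴴ * (H * ((V - U) * (Vᴴ * X) + Z)) - (V - U)ᴴ * (H * X) := by
    have e1 : φ • (Λ * (Vᴴ * X)) = Vᴴ - Vᴴ * (H * X) := by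
      rw [← Matrix.mul_assoc Λ, ← hVL, Matrix.mul_assoc, ← Matrix.mul_smul, hLX, Matrix.mul_sub,
        Matrix.mul_one]
    have e2 : (V - U) * (Vᴴ * X) + Z = X - U * (Vᴴ * X) := by
      rw [hZ, Matrix.sub_mul]; abel
    rw [hW, Matrix.mul_sub, hY, Matrix.add_mul, Matrix.smul_mul, e1, e2, Matrix.conjTranspose_sub,
      Matrix.sub_mul, Matrix.mul_sub H, Matrix.mul_sub Uᴴ]
    simp only [Matrix.mul_assoc]
    abel
  have hVU : ‖(V - U)ᴴ‖ ≤ ξ := by rwa [Matrix.l2_opNorm_conjTranspose]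
  have hWn : ‖W‖ ≤ γ * (ξ + M * (ξ * γ + χ) + ξ * (M * γ)) := by
    refine (haccU.norm_le hγ0 hWeq).trans ?_
    rw [div_div_eq_mul_div, div_one, mul_comm]
    refine mul_le_mul_of_nonneg_left ?_ hγ.le
    have b1 : ‖(V - U) * (Vᴴ * X) + Z‖ ≤ ξ * γ + χ :=
      (norm_add_le _ _).trans (add_le_add (mulle _ _ hξ hVX) hZn)
    have b2 : ‖Uᴴ * (H * ((V - U) * (Vᴴ * X) + Z))‖ ≤ 1 * (M * (ξ * γ + χ)) :=
      mulle _ _ hUc (mulle _ _ hHM b1)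
    have b3 := mulle _ _ hVU hHX
    refine (norm_sub_le _ _).trans (add_le_add ((norm_sub_le _ _).trans (add_le_add hVU ?_)) b3)
    simpa using b2
  have hfin : X - U * Y = Z + (V - U) * (Vᴴ * X) + U * W := by
    rw [hZ, hW, Matrix.sub_mul, Matrix.mul_sub]; abel
  rw [hfin]
  have b4 : ‖U * W‖ ≤ 1 * _ := mulle _ _ hU1 hWn
  rw [one_mul] at b4
  exact (norm_add_le _ _).trans (add_le_add ((norm_add_le _ _).trans
    (add_le_add hZn (mulle _ _ hξ hVX))) b4)

end Accretive

/-! ### Frobenius norm, diagonalization, and the nearest orthogonal matrix -/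

section RealMatrices

variable {n k m : ℕ}

lemma frobeniusSq_eq_trace (A : Matrix (Fin m) (Fin n) ℝ) : frobeniusSq A = (Aᵀ * A).trace := by
  rw [frobeniusSq, Matrix.trace, Finset.sum_comm]
  refine Finset.sum_congr rfl fun j _ => ?_
  rw [Matrix.diag_apply, Matrix.mul_apply]
  exact Finset.sum_congr rfl fun i _ => by rw [Matrix.transpose_apply, sq]

lemma frobeniusSq_nonneg (A : Matrix (Fin m) (Fin n) ℝ) : 0 ≤ frobeniusSq A :=
  Finset.sum_nonneg fun _ _ => Finset.sum_nonneg fun _ _ => sq_nonneg _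

lemma frobeniusSq_mul_of_orthonormal {U : Matrix (Fin m) (Fin n) ℝ} (hU : Uᵀ * U = 1)
    (A : Matrix (Fin n) (Fin k) ℝ) : frobeniusSq (U * A) = frobeniusSq A := by
  rw [frobeniusSq_eq_trace, frobeniusSq_eq_trace, Matrix.transpose_mul, Matrix.mul_assoc,
    ← Matrix.mul_assoc Uᵀ, hU, Matrix.one_mul]

lemma frobeniusSq_transpose (A : Matrix (Fin m) (Fin n) ℝ) : frobeniusSq Aᵀ = frobeniusSq A := by
  rw [frobeniusSq_eq_trace, frobeniusSq_eq_trace, Matrix.transpose_transpose, Matrix.trace_mul_comm]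

lemma dotProduct_sq_le (x y : Fin n → ℝ) : (x ⬝ᵥ y) ^ 2 ≤ (x ⬝ᵥ x) * (y ⬝ᵥ y) := by
  have := Finset.sum_mul_sq_le_sq_mul_sq Finset.univ x y
  simpa [dotProduct, sq] using this

lemma zero_le_dotProduct_self (x : Fin n → ℝ) : 0 ≤ x ⬝ᵥ x :=
  Finset.sum_nonneg fun _ _ => mul_self_nonneg _

lemma dotProduct_mulVec_self_le (A : Matrix (Fin m) (Fin n) ℝ) (x : Fin n → ℝ) :
    (A *ᵥ x) ⬝ᵥ (A *ᵥ x) ≤ frobeniusSq A * (x ⬝ᵥ x) := by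
  rw [frobeniusSq, Finset.sum_mul, dotProduct]
  refine Finset.sum_le_sum fun i _ => ?_
  have := dotProduct_sq_le (A i) x
  simpa [dotProduct, sq, Matrix.mulVec] using this

lemma frobeniusSq_mul_le (A : Matrix (Fin m) (Fin n) ℝ) (B : Matrix (Fin n) (Fin k) ℝ) :
    frobeniusSq (A * B) ≤ frobeniusSq A * frobeniusSq B := by
  have hcol : ∀ {p : ℕ} (C : Matrix (Fin p) (Fin k) ℝ),
      frobeniusSq C = ∑ j, ∑ i, C i j ^ 2 := fun C => Finset.sum_comm
  rw [hcol (A * B), hcol B, Finset.mul_sum]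
  refine Finset.sum_le_sum fun j _ => ?_
  have := dotProduct_mulVec_self_le A (fun i => B i j)
  simpa [dotProduct, sq, Matrix.mulVec, Matrix.mul_apply] using this

/-- A real symmetric matrix is diagonal in an orthonormal basis. -/
lemma exists_orthogonal_diagonalization {A : Matrix (Fin n) (Fin n) ℝ} (hA : A.IsHermitian) :
    ∃ U : Matrix (Fin n) (Fin n) ℝ, Uᵀ * U = 1 ∧ U * Uᵀ = 1 ∧
      A = U * Matrix.diagonal hA.eigenvalues * Uᵀ := by
  refine ⟨hA.eigenvectorUnitary, ?_, ?_, ?_⟩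
  · exact Unitary.coe_star_mul_self hA.eigenvectorUnitary
  · exact Unitary.coe_mul_star_self hA.eigenvectorUnitary
  · have := hA.spectral_theorem
    rwa [Unitary.conjStarAlgAut_apply] at this

/-- A matrix with nearly orthonormal columns is close to an orthogonal matrix, its polar factor
`X (XᵀX)^(-1/2)`, which agrees with it on the fixed vectors of `XᵀX`. -/
lemma exists_orthogonal_near (X : Matrix (Fin k) (Fin k) ℝ) (hX : frobeniusSq (Xᵀ * X - 1) < 1) :
    ∃ Y : Matrix (Fin k) (Fin k) ℝ, Yᵀ * Y = 1 ∧
      frobeniusSq (X - Y) ≤ frobeniusSq (Xᵀ * X - 1) ∧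
      ∀ v, (Xᵀ * X) *ᵥ v = v → Y *ᵥ v = X *ᵥ v := by
  have hG : (Xᵀ * X).IsHermitian := by
    have := Matrix.isHermitian_conjTranspose_mul_self X
    rwa [Matrix.conjTranspose_eq_transpose_of_trivial] at this
  obtain ⟨U, hU1, hU2, hUG⟩ := exists_orthogonal_diagonalization hG
  set d := hG.eigenvalues with hd
  have hfrob : ∀ e : Fin k → ℝ, frobeniusSq (U * Matrix.diagonal e * Uᵀ) = ∑ i, e i ^ 2 := by
    intro e
    rw [Matrix.mul_assoc, frobeniusSq_mul_of_orthonormal hU1, ← frobeniusSq_transpose,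
      Matrix.transpose_mul, Matrix.transpose_transpose, frobeniusSq_mul_of_orthonormal hU1,
      frobeniusSq_transpose, frobeniusSq]
    refine Finset.sum_congr rfl fun i _ => ?_
    rw [Finset.sum_eq_single i]
    · simp
    · intro j _ hj; simp [hj.symm]
    · simp
  have hconj : ∀ e e' : Fin k → ℝ, (U * Matrix.diagonal e * Uᵀ) * (U * Matrix.diagonal e' * Uᵀ) =
      U * Matrix.diagonal (fun i => e i * e' i) * Uᵀ := by
    intro e e'
    rw [← Matrix.diagonal_mul_diagonal]
    calc _ = U * Matrix.diagonal e * (Uᵀ * U) * Matrix.diagonal e' * Uᵀ := by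
            simp only [Matrix.mul_assoc]
      _ = _ := by rw [hU1, Matrix.mul_one]; simp only [Matrix.mul_assoc]
  have hone : U * Matrix.diagonal (fun _ => (1 : ℝ)) * Uᵀ = 1 := by
    rw [Matrix.diagonal_one, Matrix.mul_one, hU2]
  have hsub : ∀ e e' : Fin k → ℝ, (U * Matrix.diagonal e * Uᵀ) - (U * Matrix.diagonal e' * Uᵀ) =
      U * Matrix.diagonal (fun i => e i - e' i) * Uᵀ := by
    intro e e'
    rw [← Matrix.diagonal_sub, Matrix.mul_sub, Matrix.sub_mul]
  have hsum : frobeniusSq (Xᵀ * X - 1) = ∑ i, (d i - 1) ^ 2 := by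
    conv_lhs => rw [hUG, ← hone, hsub]
    rw [hfrob]
  have hdpos : ∀ i, 0 < d i := by
    intro i
    have h1 : (d i - 1) ^ 2 ≤ ∑ i, (d i - 1) ^ 2 :=
      Finset.single_le_sum (f := fun i => (d i - 1) ^ 2) (fun i _ => sq_nonneg _) (Finset.mem_univ i)
    rw [hsum] at hX
    nlinarith
  set R := U * Matrix.diagonal (fun i => (√(d i))⁻¹) * Uᵀ with hR
  set Q := U * Matrix.diagonal (fun i => √(d i)) * Uᵀ with hQ
  have hRQ : R * Q = 1 := by
    rw [hR, hQ, hconj, ← hone]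
    congr 3
    ext i
    exact inv_mul_cancel₀ (Real.sqrt_pos.2 (hdpos i)).ne'
  have hRt : Rᵀ = R := by
    rw [hR, Matrix.transpose_mul, Matrix.transpose_mul, Matrix.diagonal_transpose,
      Matrix.transpose_transpose, Matrix.mul_assoc]
  have hY : (X * R)ᵀ * (X * R) = 1 := by
    rw [Matrix.transpose_mul, hRt, Matrix.mul_assoc, ← Matrix.mul_assoc Xᵀ, hUG, hR, hconj, hconj,
      ← hone]
    congr 3
    ext i
    have h1 := Real.sqrt_pos.2 (hdpos i)
    have h2 := Real.mul_self_sqrt (hdpos i).le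
    field_simp
    linarith
  refine ⟨X * R, hY, ?_, ?_⟩
  · have h1 : X - X * R = X * R * (Q - 1) := by
      rw [Matrix.mul_sub, Matrix.mul_assoc X R Q, hRQ, Matrix.mul_one, Matrix.mul_one]
    rw [h1, frobeniusSq_mul_of_orthonormal hY, hsum, hQ, ← hone, hsub, hfrob]
    refine Finset.sum_le_sum fun i _ => ?_
    have h2 := Real.sqrt_nonneg (d i)
    have h3 := Real.mul_self_sqrt (hdpos i).le
    have h4 : (d i - 1) ^ 2 = (√(d i) - 1) ^ 2 * (√(d i) + 1) ^ 2 := by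
      rw [← h3, Real.sqrt_mul_self h2]; ring
    rw [h4]
    exact le_mul_of_one_le_right (sq_nonneg _) (by nlinarith)
  · intro v hv
    rw [← Matrix.mulVec_mulVec]
    congr 1
    -- `XᵀX v = v` means that `Uᵀ v` is supported on the eigenvalue `1`
    have h1 : Matrix.diagonal d *ᵥ (Uᵀ *ᵥ v) = Uᵀ *ᵥ v := by
      conv_rhs => rw [← hv, hUG]
      rw [Matrix.mulVec_mulVec, Matrix.mulVec_mulVec]
      rw [← Matrix.mul_assoc, ← Matrix.mul_assoc, hU1, Matrix.one_mul]
    have h2 : Matrix.diagonal (fun i => (√(d i))⁻¹) *ᵥ (Uᵀ *ᵥ v) = Uᵀ *ᵥ v := by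
      ext i
      have := congrFun h1 i
      rw [Matrix.mulVec_diagonal] at this ⊢
      rcases eq_or_ne ((Uᵀ *ᵥ v) i) 0 with h0 | h0
      · rw [h0, mul_zero]
      · have hd1 : d i = 1 := mul_right_cancel₀ h0 (this.trans (one_mul _).symm)
        rw [hd1]; simp
    rw [hR, ← Matrix.mulVec_mulVec, ← Matrix.mulVec_mulVec, h2, Matrix.mulVec_mulVec, hU2,
      Matrix.one_mulVec]

end RealMatrices

/-! ### Perturbation of a matrix with block structure -/

section Perturbation

variable {n k : ℕ}

lemma blockSize_pos (c : Labeling n k) (i : Fin k) : 0 < blockSize c i := by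
  obtain ⟨j, hj⟩ := c.2 i
  exact Finset.card_pos.2 ⟨j, by simp [hj]⟩

lemma le_of_labeling (c : Labeling n k) : k ≤ n := by
  simpa using Fintype.card_le_of_surjective c.1 c.2

lemma transpose_indicatorMatrix_mul_self (c : Labeling n k) :
    (indicatorMatrix ℝ c)ᵀ * indicatorMatrix ℝ c =
      Matrix.diagonal fun i => (blockSize c i : ℝ) := by
  ext i j
  simp only [Matrix.mul_apply, Matrix.transpose_apply, indicatorMatrix, Matrix.of_apply,
    Matrix.diagonal_apply, blockSize]
  split_ifs with h
  · subst h
    rw [← Finset.sum_boole]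
    exact Finset.sum_congr rfl fun x _ => by split_ifs <;> simp
  · refine Finset.sum_eq_zero fun x _ => ?_
    split_ifs with h1 h2 <;> simp
    exact h (h1.symm.trans h2)

lemma indicatorMatrix_mulVec (c : Labeling n k) (a : Fin k → ℝ) (j : Fin n) :
    (indicatorMatrix ℝ c *ᵥ a) j = a (c.1 j) := by
  simp [Matrix.mulVec, dotProduct, indicatorMatrix]

/-- `B` is block diagonal with respect to the vectors constant on the blocks of `c` and their
orthogonal complement; it is at most `μ` on the former and at least `μ + g` on the latter. -/
structure HasBlockGap (c : Labeling n k) (B : Matrix (Fin n) (Fin n) ℝ) (μ g : ℝ) : Prop where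
  symm : Bᵀ = B
  nonneg : ∀ x, 0 ≤ x ⬝ᵥ B *ᵥ x
  upper : ∀ a : Fin k → ℝ, (indicatorMatrix ℝ c *ᵥ a) ⬝ᵥ B *ᵥ (indicatorMatrix ℝ c *ᵥ a) ≤
    μ * ((indicatorMatrix ℝ c *ᵥ a) ⬝ᵥ (indicatorMatrix ℝ c *ᵥ a))
  invariant : ∀ q, (indicatorMatrix ℝ c)ᵀ *ᵥ q = 0 → (indicatorMatrix ℝ c)ᵀ *ᵥ (B *ᵥ q) = 0
  lower : ∀ q, (indicatorMatrix ℝ c)ᵀ *ᵥ q = 0 → (μ + g) * (q ⬝ᵥ q) ≤ q ⬝ᵥ B *ᵥ q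
  mean_nonneg : 0 ≤ μ

/-- `‖E x‖ ≤ τ ‖x‖` for all `x`. -/
def OpNormLe (E : Matrix (Fin n) (Fin n) ℝ) (τ : ℝ) : Prop :=
  ∀ x : Fin n → ℝ, (E *ᵥ x) ⬝ᵥ (E *ᵥ x) ≤ τ ^ 2 * (x ⬝ᵥ x)

lemma OpNormLe.abs_dotProduct_le {E : Matrix (Fin n) (Fin n) ℝ} {τ : ℝ} (hτ : 0 ≤ τ)
    (h : OpNormLe E τ) (x : Fin n → ℝ) : |x ⬝ᵥ E *ᵥ x| ≤ τ * (x ⬝ᵥ x) := by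
  have h0 := zero_le_dotProduct_self x
  refine abs_le_of_sq_le_sq ?_ (by positivity)
  refine (dotProduct_sq_le _ _).trans ?_
  rw [mul_pow, sq (x ⬝ᵥ x), mul_left_comm]
  exact mul_le_mul_of_nonneg_left (h x) h0

/-- A test space of dimension `i + 1` bounds the `i`-th smallest eigenvalue (one half of the
Courant–Fischer principle, for the test space of the vectors constant on the blocks). -/
lemma ascEigenvalue_le_of_forall {L : Matrix (Fin n) (Fin n) ℝ} (hL : L.IsHermitian)
    (c : Labeling n k) (hk : k ≤ n) (i : Fin k) {C : ℝ}
    (h : ∀ a : Fin k → ℝ, (indicatorMatrix ℝ c *ᵥ a) ⬝ᵥ L *ᵥ (indicatorMatrix ℝ c *ᵥ a) ≤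
      C * ((indicatorMatrix ℝ c *ᵥ a) ⬝ᵥ (indicatorMatrix ℝ c *ᵥ a))) :
    ascEigenvalue hL (Fin.castLE hk i) ≤ C := by
  obtain ⟨U, hU1, hU2, hUL⟩ := exists_orthogonal_diagonalization hL
  set lam := ascEigenvalue hL (Fin.castLE hk i) with hlam
  set d := hL.eigenvalues with hd
  let e : Fin n ≃ Fin (Fintype.card (Fin n)) := (Fintype.equivOfCardEq (Fintype.card_fin _)).symm
  let J := {j : Fin n // d j < lam}
  have hcard : Fintype.card J ≤ i := by
    set r : Fin (Fintype.card (Fin n)) :=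
      Fin.cast (Fintype.card_fin n).symm (Fin.castLE hk i).rev with hr
    have hinj : Fintype.card J ≤ (Finset.Ioi r).card := by
      rw [← Fintype.card_coe]
      refine Fintype.card_le_of_injective (fun j : J => ⟨e j.1, ?_⟩) ?_
      · rw [Finset.mem_Ioi]
        by_contra hlt
        exact absurd j.2 (not_lt.2 (hL.eigenvalues₀_antitone (not_lt.1 hlt)))
      · intro a b hab
        exact Subtype.ext (e.injective (by simpa using hab))
    refine hinj.trans ?_
    rw [Fin.card_Ioi, hr]
    simp [Fin.rev]
    omega
  -- fewer than `k` linear conditions: a block vector orthogonal to all eigenvectors below `lam`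
  let F : (Fin k → ℝ) →ₗ[ℝ] (J → ℝ) :=
    (LinearMap.funLeft ℝ ℝ (fun j : J => j.1)) ∘ₗ Matrix.mulVecLin (Uᵀ * indicatorMatrix ℝ c)
  have hker : LinearMap.ker F ≠ ⊥ := by
    apply LinearMap.ker_ne_bot_of_finrank_lt
    rw [Module.finrank_fintype_fun_eq_card, Module.finrank_fintype_fun_eq_card, Fintype.card_fin]
    exact hcard.trans_lt i.2
  obtain ⟨a, ha, ha0⟩ := (Submodule.ne_bot_iff _).1 hker
  set x := indicatorMatrix ℝ c *ᵥ a with hx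
  set z := Uᵀ *ᵥ x with hz
  have hzJ : ∀ j, d j < lam → z j = 0 := by
    intro j hj
    have := congrFun (LinearMap.mem_ker.1 ha) ⟨j, hj⟩
    rw [hz, hx, Matrix.mulVec_mulVec]
    exact this
  have hzz : z ⬝ᵥ z = x ⬝ᵥ x := by
    rw [hz, Matrix.dotProduct_mulVec, Matrix.vecMul_transpose, Matrix.mulVec_mulVec, hU2,
      Matrix.one_mulVec]
  have hquad : x ⬝ᵥ L *ᵥ x = ∑ j, d j * z j ^ 2 := by
    rw [hUL, ← Matrix.mulVec_mulVec, ← Matrix.mulVec_mulVec, Matrix.dotProduct_mulVec,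
      ← Matrix.mulVec_transpose, ← hz, dotProduct]
    refine Finset.sum_congr rfl fun j _ => ?_
    rw [Matrix.mulVec_diagonal]; ring
  have hlow : lam * (x ⬝ᵥ x) ≤ x ⬝ᵥ L *ᵥ x := by
    rw [hquad, ← hzz, dotProduct, Finset.mul_sum]
    refine Finset.sum_le_sum fun j _ => ?_
    rcases lt_or_ge (d j) lam with hj | hj
    · rw [hzJ j hj]; simp
    · rw [← sq]; exact mul_le_mul_of_nonneg_right hj (sq_nonneg _)
  have hxpos : 0 < x ⬝ᵥ x := by
    refine lt_of_le_of_ne (zero_le_dotProduct_self x) fun h0 => ha0 ?_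
    have hx0 : x = 0 := dotProduct_self_eq_zero.1 h0.symm
    ext l
    obtain ⟨j, rfl⟩ := c.2 l
    rw [← indicatorMatrix_mulVec c a j, ← hx, hx0]
    simp
  exact le_of_mul_le_mul_right (hlow.trans (h a)) hxpos

variable {c : Labeling n k} {L B : Matrix (Fin n) (Fin n) ℝ} {μ g τ : ℝ}

lemma quadratic_split (x : Fin n → ℝ) : x ⬝ᵥ L *ᵥ x = x ⬝ᵥ B *ᵥ x + x ⬝ᵥ (L - B) *ᵥ x := by
  rw [Matrix.sub_mulVec, dotProduct_sub]; ring

/-- The test space of block vectors shows that the `k` smallest eigenvalues of `L` are at most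
`μ + τ`. -/
lemma HasBlockGap.lam_le [NeZero k] (hB : HasBlockGap c B μ g) (hτ : 0 ≤ τ)
    (hE : OpNormLe (L - B) τ) {V : Matrix (Fin n) (Fin k) ℝ} {lam : Fin k → ℝ}
    (hV : IsSpectralEmbedding L V lam) (i : Fin k) : lam i ≤ μ + τ := by
  obtain ⟨hL, hk, h⟩ := hV.smallest
  rw [h i]
  refine ascEigenvalue_le_of_forall hL c hk i fun a => ?_
  rw [quadratic_split (B := B)]
  have h1 := hB.upper a
  have h2 := (abs_le.1 (hE.abs_dotProduct_le hτ (indicatorMatrix ℝ c *ᵥ a))).2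
  linarith

/-- The indicator matrix with normalized columns. -/
noncomputable def normalizedIndicator (c : Labeling n k) : Matrix (Fin n) (Fin k) ℝ :=
  indicatorMatrix ℝ c * Matrix.diagonal fun i => (√(blockSize c i : ℝ))⁻¹

lemma normalizedIndicator_orthonormal (c : Labeling n k) :
    (normalizedIndicator c)ᵀ * normalizedIndicator c = 1 := by
  rw [normalizedIndicator, Matrix.transpose_mul, Matrix.diagonal_transpose, Matrix.mul_assoc,
    ← Matrix.mul_assoc _ (indicatorMatrix ℝ c), transpose_indicatorMatrix_mul_self,
    Matrix.diagonal_mul_diagonal, Matrix.diagonal_mul_diagonal, ← Matrix.diagonal_one]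
  congr 1
  ext i
  have h : (0 : ℝ) < blockSize c i := by exact_mod_cast blockSize_pos c i
  have h1 := Real.sqrt_pos.2 h
  have h2 := Real.mul_self_sqrt h.le
  field_simp
  linarith

lemma transpose_indicatorMatrix_mulVec_eq_zero (c : Labeling n k) {q : Fin n → ℝ}
    {S : Matrix (Fin k) (Fin k) ℝ}
    (hS : (indicatorMatrix ℝ c * S)ᵀ * (indicatorMatrix ℝ c * S) = 1)
    (h : (indicatorMatrix ℝ c * S)ᵀ *ᵥ q = 0) : (indicatorMatrix ℝ c)ᵀ *ᵥ q = 0 := by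
  have hS' : (Sᵀ * ((indicatorMatrix ℝ c)ᵀ * indicatorMatrix ℝ c)) * S = 1 := by
    rw [← hS, Matrix.transpose_mul]; simp only [Matrix.mul_assoc]
  have hSinv := mul_eq_one_comm.1 hS'
  rw [Matrix.transpose_mul, ← Matrix.mulVec_mulVec] at h
  have hunit : IsUnit Sᵀ := by
    rw [Matrix.isUnit_iff_isUnit_det, Matrix.det_transpose, ← Matrix.isUnit_iff_isUnit_det]
    exact IsUnit.of_mul_eq_one _ hSinv
  have hS0 := congrArg (fun v => (Sᵀ)⁻¹ *ᵥ v) h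
  simp only [Matrix.mulVec_zero] at hS0
  rwa [Matrix.mulVec_mulVec, Matrix.nonsing_inv_mul _ ((Matrix.isUnit_iff_isUnit_det _).1 hunit),
    Matrix.one_mulVec] at hS0

/-- For `y = p + q` with `p` constant on the blocks and `q` with vanishing block sums, the cross
terms of the quadratic form vanish. -/
lemma HasBlockGap.dotProduct_split (hB : HasBlockGap c B μ g) (a : Fin k → ℝ) {q : Fin n → ℝ}
    (hq : (indicatorMatrix ℝ c)ᵀ *ᵥ q = 0) :
    (indicatorMatrix ℝ c *ᵥ a) ⬝ᵥ B *ᵥ q = 0 ∧ q ⬝ᵥ B *ᵥ (indicatorMatrix ℝ c *ᵥ a) = 0 := by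
  have h1 : (indicatorMatrix ℝ c *ᵥ a) ⬝ᵥ B *ᵥ q = 0 := by
    rw [dotProduct_comm, Matrix.dotProduct_mulVec, ← Matrix.mulVec_transpose, hB.invariant q hq,
      zero_dotProduct]
  refine ⟨h1, ?_⟩
  rw [Matrix.dotProduct_mulVec, ← Matrix.mulVec_transpose, hB.symm, dotProduct_comm, h1]

/-- The `sin Θ` bound: a unit eigenvector of `L` with eigenvalue at most `μ + τ` is within
`τ / (g - τ)` of its projection to the vectors constant on the blocks; the square of this is at most
`16 / 9 (τ / g)²` for `τ ≤ g / 4`. -/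
lemma HasBlockGap.residual_le (hB : HasBlockGap c B μ g) (hg : 0 < g) (hτ : 0 ≤ τ) (hτg : 4 * τ ≤ g)
    (hE : OpNormLe (L - B) τ) {v : Fin n → ℝ} {lam : ℝ} (hv : v ⬝ᵥ v = 1)
    (hLv : L *ᵥ v = lam • v) (hlam : lam ≤ μ + τ) {q : Fin n → ℝ}
    (hq : q = v - normalizedIndicator c *ᵥ ((normalizedIndicator c)ᵀ *ᵥ v)) :
    q ⬝ᵥ q ≤ 2 * (τ / g) ^ 2 := by
  set U := normalizedIndicator c with hU
  have hUU := normalizedIndicator_orthonormal c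
  have hUq : Uᵀ *ᵥ q = 0 := by
    rw [hq, Matrix.mulVec_sub, Matrix.mulVec_mulVec, hUU, Matrix.one_mulVec, sub_self]
  have hPq : (indicatorMatrix ℝ c)ᵀ *ᵥ q = 0 :=
    transpose_indicatorMatrix_mulVec_eq_zero c hUU hUq
  set a := (Matrix.diagonal fun i => (√(blockSize c i : ℝ))⁻¹) *ᵥ (Uᵀ *ᵥ v) with ha
  have hp : U *ᵥ (Uᵀ *ᵥ v) = indicatorMatrix ℝ c *ᵥ a := by
    rw [ha, Matrix.mulVec_mulVec, Matrix.mulVec_mulVec, Matrix.mulVec_mulVec]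
    rfl
  have hvq : v = indicatorMatrix ℝ c *ᵥ a + q := by rw [hq, hp]; abel
  have hpq : (indicatorMatrix ℝ c *ᵥ a) ⬝ᵥ q = 0 := by
    rw [dotProduct_comm, Matrix.dotProduct_mulVec, ← Matrix.mulVec_transpose, hPq, zero_dotProduct]
  have hqv : q ⬝ᵥ v = q ⬝ᵥ q := by
    rw [hvq, dotProduct_add, dotProduct_comm q (_ *ᵥ _), hpq, zero_add]
  have hkey : lam * (q ⬝ᵥ q) = q ⬝ᵥ B *ᵥ q + q ⬝ᵥ (L - B) *ᵥ v := by
    have h1 : q ⬝ᵥ L *ᵥ v = lam * (q ⬝ᵥ q) := by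
      rw [hLv, dotProduct_smul, hqv, smul_eq_mul]
    have h2 : q ⬝ᵥ B *ᵥ v = q ⬝ᵥ B *ᵥ q := by
      rw [hvq, Matrix.mulVec_add, dotProduct_add, (hB.dotProduct_split a hPq).2, zero_add]
    rw [Matrix.sub_mulVec, dotProduct_sub, h1, h2]; ring
  have hlow := hB.lower q hPq
  set s := q ⬝ᵥ q with hs
  have hs0 : 0 ≤ s := zero_le_dotProduct_self q
  set w := q ⬝ᵥ (L - B) *ᵥ v with hw
  have hw2 : w ^ 2 ≤ s * τ ^ 2 := by
    refine (dotProduct_sq_le _ _).trans (mul_le_mul_of_nonneg_left ?_ hs0)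
    have := hE v
    rwa [hv, mul_one] at this
  have h1 : (g - τ) * s ≤ -w := by nlinarith
  have h2 : ((g - τ) * s) ^ 2 ≤ s * τ ^ 2 := by
    refine le_trans ?_ hw2
    rw [← neg_sq w]
    exact pow_le_pow_left₀ (mul_nonneg (by linarith) hs0) h1 2
  rcases hs0.eq_or_lt with h0 | h0
  · rw [← h0]; positivity
  have h3 : (g - τ) ^ 2 * s ≤ τ ^ 2 := by
    have : s * ((g - τ) ^ 2 * s) ≤ s * τ ^ 2 := by nlinarith
    exact le_of_mul_le_mul_left this h0
  rw [div_pow, ← mul_div_assoc, le_div_iff₀ (by positivity)]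
  have h4 : (3 / 4 * g) ^ 2 ≤ (g - τ) ^ 2 := pow_le_pow_left₀ (by positivity) (by linarith) 2
  nlinarith

/-- The embedding `V` is nearly spanned by the block indicators, so the refinement problem has a
feasible point, hence every minimizer, with a small residual. -/
lemma IsRefinement.frobeniusSq_le [NeZero k] {V : Matrix (Fin n) (Fin k) ℝ} {lam : Fin k → ℝ}
    {S : Matrix (Fin k) (Fin k) ℝ} (hV : IsSpectralEmbedding L V lam) (hS : IsRefinement V c S)
    {κ : ℝ} (hκ : frobeniusSq (V - normalizedIndicator c * ((normalizedIndicator c)ᵀ * V)) ≤ κ)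
    (hκ1 : κ < 1) : frobeniusSq (V - indicatorMatrix ℝ c * S) ≤ 2 * κ := by
  have hκ0 : 0 ≤ κ := (frobeniusSq_nonneg _).trans hκ
  set U := normalizedIndicator c with hU
  have hUU : Uᵀ * U = 1 := normalizedIndicator_orthonormal c
  set Q := V - U * (Uᵀ * V) with hQ
  set X := Uᵀ * V with hX
  have hUQ : Uᵀ * Q = 0 := by
    rw [hQ, Matrix.mul_sub, ← Matrix.mul_assoc, hUU, Matrix.one_mul, sub_self]
  have hQU : Qᵀ * U = 0 := by
    have := congrArg Matrix.transpose hUQ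
    rwa [Matrix.transpose_mul, Matrix.transpose_transpose, Matrix.transpose_zero] at this
  have hVd : V = Q + U * X := by rw [hQ]; abel
  have hXX : Xᵀ * X = 1 - Qᵀ * Q := by
    have h1 := hV.orthonormal
    rw [hVd, Matrix.transpose_add, Matrix.add_mul, Matrix.mul_add, Matrix.mul_add,
      Matrix.transpose_mul, ← Matrix.mul_assoc Qᵀ U, hQU, Matrix.mul_assoc, hUQ, Matrix.mul_assoc,
      ← Matrix.mul_assoc Uᵀ U, hUU] at h1
    simp only [Matrix.zero_mul, Matrix.mul_zero, Matrix.one_mul, add_zero, zero_add] at h1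
    rw [← h1]; abel
  have hXfrob : frobeniusSq (Xᵀ * X - 1) ≤ κ * κ := by
    have h1 : Xᵀ * X - 1 = -(Qᵀ * Q) := by rw [hXX]; abel
    have h2 : frobeniusSq (-(Qᵀ * Q)) = frobeniusSq (Qᵀ * Q) := by simp [frobeniusSq]
    rw [h1, h2]
    refine (frobeniusSq_mul_le _ _).trans ?_
    rw [frobeniusSq_transpose]
    exact mul_le_mul hκ hκ (frobeniusSq_nonneg _) hκ0
  obtain ⟨Y, hY, hXY, hfix⟩ := exists_orthogonal_near X (hXfrob.trans_lt (by nlinarith))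
  set S' := (Matrix.diagonal fun i => (√(blockSize c i : ℝ))⁻¹) * Y with hS'
  have hPS' : indicatorMatrix ℝ c * S' = U * Y := by
    rw [hS', hU, normalizedIndicator, Matrix.mul_assoc]
  -- the first column of `V` is constant, so it is preserved by all the projections
  have hsize : ∀ i, (0 : ℝ) < blockSize c i := fun i => by exact_mod_cast blockSize_pos c i
  have hX0 : ∀ i, X i 0 = √(blockSize c i : ℝ) / √(n : ℝ) := by
    intro i
    have h1 : X i 0 = ∑ j, (if c.1 j = i then (1 : ℝ) else 0) *
        ((√(blockSize c i : ℝ))⁻¹ * (1 / √(n : ℝ))) := by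
      rw [hX, Matrix.mul_apply]
      refine Finset.sum_congr rfl fun j _ => ?_
      rw [hV.first, hU, normalizedIndicator, Matrix.transpose_apply, Matrix.mul_diagonal]
      simp only [indicatorMatrix, Matrix.of_apply]
      ring
    rw [h1, ← Finset.sum_mul, Finset.sum_boole, ← blockSize]
    have h2 := Real.sqrt_pos.2 (hsize i)
    have h3 := Real.mul_self_sqrt (hsize i).le
    rw [← mul_assoc]
    nth_rewrite 1 [← h3]
    rw [mul_assoc (√_), mul_inv_cancel₀ h2.ne', mul_one, mul_one_div]
  have hQ0 : ∀ j, Q j 0 = 0 := by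
    intro j
    have h2 := Real.sqrt_pos.2 (hsize (c.1 j))
    have h4 : (U * X) j 0 = (√(blockSize c (c.1 j) : ℝ))⁻¹ * X (c.1 j) 0 := by
      rw [hU, normalizedIndicator, Matrix.mul_assoc, Matrix.mul_apply,
        Finset.sum_eq_single (c.1 j)]
      · simp [indicatorMatrix]
      · intro i _ hi; simp [indicatorMatrix, hi.symm]
      · simp
    rw [hQ, Matrix.sub_apply, h4, hX0, hV.first]
    field_simp
    simp
  have hcol : Y *ᵥ Pi.single 0 1 = X *ᵥ Pi.single 0 1 := by
    refine hfix _ ?_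
    rw [hXX, Matrix.sub_mulVec, Matrix.one_mulVec, ← Matrix.mulVec_mulVec]
    have : Q *ᵥ Pi.single 0 1 = 0 := by
      ext j; simp [hQ0]
    rw [this, Matrix.mulVec_zero, sub_zero]
  have hfeas : IsFeasible c S' := by
    refine ⟨fun i => ?_, ?_⟩
    · have h1 : Y i 0 = X i 0 := by simpa using congrFun hcol i
      have h2 := Real.sqrt_pos.2 (hsize i)
      rw [hS', Matrix.diagonal_mul, h1, hX0]
      field_simp
    · have h1 : S'ᵀ * ((indicatorMatrix ℝ c)ᵀ * indicatorMatrix ℝ c) * S' =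
          (indicatorMatrix ℝ c * S')ᵀ * (indicatorMatrix ℝ c * S') := by
        rw [Matrix.transpose_mul (indicatorMatrix ℝ c)]; simp only [Matrix.mul_assoc]
      rw [← transpose_indicatorMatrix_mul_self, h1, hPS', Matrix.transpose_mul, Matrix.mul_assoc,
        ← Matrix.mul_assoc Uᵀ, hUU, Matrix.one_mul, hY]
  refine (hS.2 S' hfeas).trans ?_
  have h5 : V - indicatorMatrix ℝ c * S' = Q + U * (X - Y) := by
    rw [hPS', Matrix.mul_sub, hQ]; abel
  have h6 : frobeniusSq (Q + U * (X - Y)) = frobeniusSq Q + frobeniusSq (X - Y) := by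
    rw [← frobeniusSq_mul_of_orthonormal hUU (X - Y)]
    simp only [frobeniusSq_eq_trace]
    rw [Matrix.transpose_add, Matrix.add_mul, Matrix.mul_add, Matrix.mul_add,
      ← Matrix.mul_assoc Qᵀ U, hQU, Matrix.transpose_mul, Matrix.mul_assoc _ Uᵀ Q, hUQ]
    simp
  rw [h5, h6]
  nlinarith [hXY.trans hXfrob]

lemma HasBlockGap.frobeniusSq_le [NeZero k] (hB : HasBlockGap c B μ g) (hg : 0 < g) (hτ : 0 ≤ τ)
    (hτg : 4 * τ ≤ g) (hE : OpNormLe (L - B) τ) {V : Matrix (Fin n) (Fin k) ℝ} {lam : Fin k → ℝ}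
    {S : Matrix (Fin k) (Fin k) ℝ} (hV : IsSpectralEmbedding L V lam) (hS : IsRefinement V c S)
    (hκ1 : 2 * k * (τ / g) ^ 2 < 1) :
    frobeniusSq (V - indicatorMatrix ℝ c * S) ≤ 4 * k * (τ / g) ^ 2 := by
  refine (hS.frobeniusSq_le hV (κ := 2 * k * (τ / g) ^ 2) ?_ hκ1).trans (le_of_eq (by ring))
  set U := normalizedIndicator c with hU
  have hcol : ∀ i, ∑ j, (V - U * (Uᵀ * V)) j i ^ 2 ≤ 2 * (τ / g) ^ 2 := by
    intro i
    have h1 : (fun j => V j i) ⬝ᵥ (fun j => V j i) = 1 := by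
      have := congrFun (congrFun hV.orthonormal i) i
      simpa [Matrix.mul_apply, dotProduct] using this
    have h2 : L *ᵥ (fun j => V j i) = lam i • (fun j => V j i) := by
      ext j
      have := congrFun (congrFun hV.eigen j) i
      rw [Matrix.mul_diagonal] at this
      simpa [Matrix.mul_apply, Matrix.mulVec, dotProduct, mul_comm] using this
    refine le_trans (le_of_eq ?_) (hB.residual_le hg hτ hτg hE h1 h2 (hB.lam_le hτ hE hV i) rfl)
    rw [dotProduct]
    refine Finset.sum_congr rfl fun j _ => ?_
    rw [sq]
    have h3 : (V - U * (Uᵀ * V)) j i =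
        ((fun j => V j i) - U *ᵥ (Uᵀ *ᵥ fun j => V j i)) j := by
      rw [Matrix.mulVec_mulVec, ← Matrix.mul_assoc]
      rfl
    rw [h3]
  rw [frobeniusSq, Finset.sum_comm]
  refine (Finset.sum_le_sum fun i _ => hcol i).trans (le_of_eq ?_)
  simp; ring

/-- Off the embedding, `L` is bounded below by a quarter of the gap. -/
lemma HasBlockGap.posSemidef [NeZero k] (hB : HasBlockGap c B μ g) (hg : 0 < g) (hτ : 0 ≤ τ)
    (hτg : 4 * τ ≤ g) (hE : OpNormLe (L - B) τ) {V : Matrix (Fin n) (Fin k) ℝ} {lam : Fin k → ℝ}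
    {S : Matrix (Fin k) (Fin k) ℝ} (hV : IsSpectralEmbedding L V lam) (hlam : ∀ i, 0 ≤ lam i)
    (hS : IsFeasible c S) (hVS : frobeniusSq (V - indicatorMatrix ℝ c * S) ≤ 1 / 2) :
    (L + (g / 4) • (V * Vᵀ) - (g / 4) • (1 : Matrix (Fin n) (Fin n) ℝ)).PosSemidef := by
  obtain ⟨hL, -, -⟩ := hV.smallest
  have hLt : Lᵀ = L := by
    have := hL.eq
    rwa [Matrix.conjTranspose_eq_transpose_of_trivial] at this
  set U := indicatorMatrix ℝ c * S with hU
  have hUU : Uᵀ * U = 1 := by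
    rw [hU, Matrix.transpose_mul, Matrix.mul_assoc, ← Matrix.mul_assoc _ _ S,
      transpose_indicatorMatrix_mul_self, ← Matrix.mul_assoc, hS.2]
  have hy : ∀ y, Vᵀ *ᵥ y = 0 → g / 4 * (y ⬝ᵥ y) ≤ y ⬝ᵥ L *ᵥ y := by
    intro y hy
    set z := Uᵀ *ᵥ y with hz
    have hzle : z ⬝ᵥ z ≤ 1 / 2 * (y ⬝ᵥ y) := by
      have h1 : z = (U - V)ᵀ *ᵥ y := by
        rw [Matrix.transpose_sub, Matrix.sub_mulVec, hy, sub_zero]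
      rw [h1]
      refine (dotProduct_mulVec_self_le _ _).trans
        (mul_le_mul_of_nonneg_right ?_ (zero_le_dotProduct_self y))
      rw [frobeniusSq_transpose]
      refine le_trans (le_of_eq ?_) hVS
      rw [frobeniusSq, frobeniusSq]
      refine Finset.sum_congr rfl fun i _ => Finset.sum_congr rfl fun j _ => ?_
      simp only [Matrix.sub_apply]; ring
    set q := y - U *ᵥ z with hq
    have hUq : Uᵀ *ᵥ q = 0 := by
      rw [hq, Matrix.mulVec_sub, Matrix.mulVec_mulVec, hUU, Matrix.one_mulVec, ← hz, sub_self]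
    have hPq := transpose_indicatorMatrix_mulVec_eq_zero c hUU hUq
    have hUz : U *ᵥ z = indicatorMatrix ℝ c *ᵥ (S *ᵥ z) := by
      rw [Matrix.mulVec_mulVec z]
    have hyd : y = U *ᵥ z + q := by rw [hq]; abel
    have hUzz : (U *ᵥ z) ⬝ᵥ (U *ᵥ z) = z ⬝ᵥ z := by
      rw [Matrix.dotProduct_mulVec, ← Matrix.mulVec_transpose, Matrix.mulVec_mulVec, hUU,
        Matrix.one_mulVec]
    have hpq : (U *ᵥ z) ⬝ᵥ q = 0 := by
      rw [dotProduct_comm, Matrix.dotProduct_mulVec, ← Matrix.mulVec_transpose, hUq,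
        zero_dotProduct]
    have hyy : y ⬝ᵥ y = z ⬝ᵥ z + q ⬝ᵥ q := by
      conv_lhs => rw [hyd]
      rw [add_dotProduct, dotProduct_add, dotProduct_add, hUzz, hpq, dotProduct_comm q, hpq]; ring
    have hByy : q ⬝ᵥ B *ᵥ q ≤ y ⬝ᵥ B *ᵥ y := by
      have h1 := hB.dotProduct_split (S *ᵥ z) hPq
      rw [← hUz] at h1
      have h2 : y ⬝ᵥ B *ᵥ y = (U *ᵥ z) ⬝ᵥ B *ᵥ (U *ᵥ z) + q ⬝ᵥ B *ᵥ q := by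
        conv_lhs => rw [hyd]
        rw [Matrix.mulVec_add, add_dotProduct, dotProduct_add, dotProduct_add, h1.1, h1.2]; ring
      have := hB.nonneg (U *ᵥ z)
      linarith
    have h3 := hB.lower q hPq
    have h4 := (abs_le.1 (hE.abs_dotProduct_le hτ y)).1
    rw [quadratic_split (B := B)]
    have h5 := zero_le_dotProduct_self q
    have h6 := mul_nonneg hB.mean_nonneg h5
    have h7 : g * (1 / 2 * (y ⬝ᵥ y)) ≤ g * (q ⬝ᵥ q) :=
      mul_le_mul_of_nonneg_left (by linarith) hg.le
    have h8 : 4 * τ * (y ⬝ᵥ y) ≤ g * (y ⬝ᵥ y) :=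
      mul_le_mul_of_nonneg_right hτg (zero_le_dotProduct_self y)
    linarith
  refine Matrix.PosSemidef.of_dotProduct_mulVec_nonneg ?_ fun x => ?_
  · rw [Matrix.IsHermitian, Matrix.conjTranspose_eq_transpose_of_trivial]
    simp [Matrix.transpose_mul, hLt]
  rw [star_trivial]
  set a := Vᵀ *ᵥ x with ha
  set y := x - V *ᵥ a with hydef
  have hVy : Vᵀ *ᵥ y = 0 := by
    rw [hydef, Matrix.mulVec_sub, Matrix.mulVec_mulVec, hV.orthonormal, Matrix.one_mulVec, ← ha,
      sub_self]
  have hxd : x = V *ᵥ a + y := by rw [hydef]; abel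
  have hLVa : L *ᵥ (V *ᵥ a) = V *ᵥ (Matrix.diagonal lam *ᵥ a) := by
    rw [Matrix.mulVec_mulVec a, Matrix.mulVec_mulVec a, hV.eigen]
  have hVdot : ∀ b, (V *ᵥ b) ⬝ᵥ y = 0 := fun b => by
    rw [dotProduct_comm, Matrix.dotProduct_mulVec, ← Matrix.mulVec_transpose, hVy, zero_dotProduct]
  have hVV : ∀ b d : Fin k → ℝ, (V *ᵥ b) ⬝ᵥ (V *ᵥ d) = b ⬝ᵥ d := fun b d => by
    rw [Matrix.dotProduct_mulVec, ← Matrix.mulVec_transpose, Matrix.mulVec_mulVec, hV.orthonormal,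
      Matrix.one_mulVec]
  have hcross : (V *ᵥ a) ⬝ᵥ L *ᵥ y = 0 := by
    rw [Matrix.dotProduct_mulVec, ← Matrix.mulVec_transpose, hLt, hLVa, hVdot]
  have hLx : x ⬝ᵥ L *ᵥ x = a ⬝ᵥ Matrix.diagonal lam *ᵥ a + y ⬝ᵥ L *ᵥ y := by
    conv_lhs => rw [hxd]
    rw [Matrix.mulVec_add, add_dotProduct, dotProduct_add, dotProduct_add, hcross, hLVa, hVV,
      dotProduct_comm y, hVdot]
    ring
  have hdiag : 0 ≤ a ⬝ᵥ Matrix.diagonal lam *ᵥ a := by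
    rw [dotProduct]
    refine Finset.sum_nonneg fun i _ => ?_
    rw [Matrix.mulVec_diagonal, mul_left_comm]
    exact mul_nonneg (hlam i) (mul_self_nonneg _)
  have hxx : x ⬝ᵥ x = a ⬝ᵥ a + y ⬝ᵥ y := by
    conv_lhs => rw [hxd]
    rw [add_dotProduct, dotProduct_add, dotProduct_add, hVV, hVdot, dotProduct_comm y, hVdot]; ring
  have hVVx : x ⬝ᵥ (V * Vᵀ) *ᵥ x = a ⬝ᵥ a := by
    rw [← Matrix.mulVec_mulVec, Matrix.dotProduct_mulVec, ← Matrix.mulVec_transpose]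
  have := hy y hVy
  rw [Matrix.sub_mulVec, Matrix.add_mulVec, dotProduct_sub, dotProduct_add, Matrix.smul_mulVec,
    Matrix.smul_mulVec, dotProduct_smul, dotProduct_smul, hVVx, Matrix.one_mulVec, hLx, hxx,
    smul_eq_mul, smul_eq_mul]
  linarith

end Perturbation

/-! ### Laplacians, and the gap of the expected Laplacian -/

section Laplacian

variable {n k : ℕ}

lemma graphLaplacian_mulVec (A : Matrix (Fin n) (Fin n) ℝ) (x : Fin n → ℝ) (i : Fin n) :
    (graphLaplacian A *ᵥ x) i = (∑ j, A i j) * x i - ∑ j, A i j * x j := by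
  rw [graphLaplacian, Matrix.sub_mulVec, Pi.sub_apply, Matrix.mulVec_diagonal]
  rfl

lemma graphLaplacian_transpose {A : Matrix (Fin n) (Fin n) ℝ} (hA : Aᵀ = A) :
    (graphLaplacian A)ᵀ = graphLaplacian A := by
  rw [graphLaplacian, Matrix.transpose_sub, Matrix.diagonal_transpose, hA]

lemma graphLaplacian_mulVec_const (A : Matrix (Fin n) (Fin n) ℝ) (r : ℝ) :
    graphLaplacian A *ᵥ (fun _ => r) = 0 := by
  ext i
  rw [graphLaplacian_mulVec, Finset.sum_mul, sub_self, Pi.zero_apply]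

lemma dotProduct_graphLaplacian_mulVec {A : Matrix (Fin n) (Fin n) ℝ} (hA : Aᵀ = A)
    (x : Fin n → ℝ) :
    x ⬝ᵥ graphLaplacian A *ᵥ x = 1 / 2 * ∑ i, ∑ j, A i j * (x i - x j) ^ 2 := by
  have hsymm : ∀ i j, A j i = A i j := fun i j => congrFun (congrFun hA i) j
  have h1 : x ⬝ᵥ graphLaplacian A *ᵥ x = ∑ i, ∑ j, A i j * (x i ^ 2 - x i * x j) := by
    rw [dotProduct]
    refine Finset.sum_congr rfl fun i _ => ?_
    rw [graphLaplacian_mulVec, Finset.sum_mul, ← Finset.sum_sub_distrib, Finset.mul_sum]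
    exact Finset.sum_congr rfl fun j _ => by ring
  have h2 : x ⬝ᵥ graphLaplacian A *ᵥ x = ∑ i, ∑ j, A i j * (x j ^ 2 - x i * x j) := by
    rw [h1, Finset.sum_comm]
    exact Finset.sum_congr rfl fun i _ => Finset.sum_congr rfl fun j _ => by rw [hsymm]; ring
  have h3 : ∑ i, ∑ j, A i j * (x i - x j) ^ 2 =
      ∑ i, ∑ j, A i j * (x i ^ 2 - x i * x j) + ∑ i, ∑ j, A i j * (x j ^ 2 - x i * x j) := by
    rw [← Finset.sum_add_distrib]
    refine Finset.sum_congr rfl fun i _ => ?_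
    rw [← Finset.sum_add_distrib]
    exact Finset.sum_congr rfl fun j _ => by ring
  rw [h3, ← h1, ← h2]; ring

lemma graphLaplacian_posSemidef {A : Matrix (Fin n) (Fin n) ℝ} (hA : Aᵀ = A)
    (h0 : ∀ i j, 0 ≤ A i j) : (graphLaplacian A).PosSemidef := by
  refine Matrix.PosSemidef.of_dotProduct_mulVec_nonneg ?_ fun x => ?_
  · rw [Matrix.IsHermitian, Matrix.conjTranspose_eq_transpose_of_trivial, graphLaplacian_transpose hA]
  · rw [star_trivial, dotProduct_graphLaplacian_mulVec hA]
    exact mul_nonneg (by norm_num) (Finset.sum_nonneg fun i _ => Finset.sum_nonneg fun j _ =>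
      mul_nonneg (h0 i j) (sq_nonneg _))

lemma adjacency_transpose {W : Matrix (Fin k) (Fin k) ℝ} (hW : W.IsSymm) (b : Labeling n k)
    (x : Sym2 (Fin n) → Bool) : (adjacency W b x)ᵀ = adjacency W b x := by
  ext i j
  simp only [Matrix.transpose_apply, adjacency, Matrix.of_apply, Sym2.eq_swap (a := j) (b := i),
    hW.apply]

lemma sampledLaplacian_posSemidef {W : Matrix (Fin k) (Fin k) ℝ} (hW : W.IsSymm)
    (hW0 : ∀ i j, 0 ≤ W i j) (b : Labeling n k) (x : Sym2 (Fin n) → Bool) :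
    (sampledLaplacian W b x).PosSemidef := by
  refine graphLaplacian_posSemidef (adjacency_transpose hW b x) fun i j => ?_
  simp only [adjacency, Matrix.of_apply]
  split_ifs
  · exact hW0 _ _
  · exact le_rfl

/-- A matrix whose entries depend only on the blocks of the row and of the column. -/
def blockMatrix (b : Labeling n k) (C : Matrix (Fin k) (Fin k) ℝ) : Matrix (Fin n) (Fin n) ℝ :=
  Matrix.of fun i j => C (b.1 i) (b.1 j)

lemma sum_comp_labeling (b : Labeling n k) (F : Fin k → ℝ) :
    ∑ j, F (b.1 j) = ∑ l, blockSize b l * F l := by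
  rw [← Finset.sum_fiberwise Finset.univ b.1]
  refine Finset.sum_congr rfl fun l _ => ?_
  rw [Finset.sum_congr rfl fun j hj => by rw [(Finset.mem_filter.1 hj).2], Finset.sum_const,
    nsmul_eq_mul]
  rfl

lemma sum_blockSize (b : Labeling n k) : ∑ l, (blockSize b l : ℝ) = n := by
  have := sum_comp_labeling b fun _ => (1 : ℝ)
  simpa using this.symm

lemma sum_filter_eq_zero_of_samePartition {b c : Labeling n k} (hbc : SamePartition b c)
    {q : Fin n → ℝ} (hq : (indicatorMatrix ℝ c)ᵀ *ᵥ q = 0) (i : Fin k) :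
    ∑ j ∈ Finset.univ.filter (fun j => b.1 j = i), q j = 0 := by
  obtain ⟨σ, hσ⟩ := hbc
  have := congrFun hq (σ i)
  rw [Matrix.mulVec, dotProduct] at this
  rw [Finset.sum_filter]
  refine Eq.trans (Finset.sum_congr rfl fun j _ => ?_) this
  simp [indicatorMatrix, hσ]

lemma hasBlockGap_blockMatrix {b c : Labeling n k} (hbc : SamePartition b c)
    {C : Matrix (Fin k) (Fin k) ℝ} (hC : C.IsSymm) (hC0 : ∀ i j, 0 ≤ C i j) {μ g : ℝ} (hμ : 0 ≤ μ)
    (hout : ∀ i, 2 * ∑ l ∈ Finset.univ.erase i, blockSize b l * C i l ≤ μ)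
    (hdeg : ∀ i, μ + g ≤ ∑ l, blockSize b l * C i l) :
    HasBlockGap c (graphLaplacian (blockMatrix b C)) μ g := by
  have hsymm : (blockMatrix b C)ᵀ = blockMatrix b C := by
    ext i j; simp [blockMatrix, hC.apply]
  have hpsd := graphLaplacian_posSemidef hsymm fun i j => by simp [blockMatrix, hC0]
  have hrow : ∀ i, ∑ j, blockMatrix b C i j = ∑ l, blockSize b l * C (b.1 i) l := fun i =>
    sum_comp_labeling b (C (b.1 i))
  -- on vectors with vanishing block sums the Laplacian acts as the diagonal matrix of the degrees
  have hact : ∀ q, (indicatorMatrix ℝ c)ᵀ *ᵥ q = 0 → ∀ i,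
      (graphLaplacian (blockMatrix b C) *ᵥ q) i = (∑ l, blockSize b l * C (b.1 i) l) * q i := by
    intro q hq i
    have h0 : ∑ j, blockMatrix b C i j * q j = 0 := by
      rw [← Finset.sum_fiberwise Finset.univ b.1]
      refine Finset.sum_eq_zero fun l _ => ?_
      have h1 : ∑ j ∈ Finset.univ.filter (fun j => b.1 j = l), blockMatrix b C i j * q j =
          C (b.1 i) l * ∑ j ∈ Finset.univ.filter (fun j => b.1 j = l), q j := by
        rw [Finset.mul_sum]
        exact Finset.sum_congr rfl fun j hj => by
          rw [blockMatrix, Matrix.of_apply, (Finset.mem_filter.1 hj).2]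
      rw [h1, sum_filter_eq_zero_of_samePartition hbc hq, mul_zero]
    rw [graphLaplacian_mulVec, h0, sub_zero, hrow]
  refine ⟨graphLaplacian_transpose hsymm, fun x => by simpa using hpsd.dotProduct_mulVec_nonneg x,
    fun a => ?_, fun q hq => ?_, fun q hq => ?_, hμ⟩
  · obtain ⟨σ, hσ⟩ := hbc
    set x := indicatorMatrix ℝ c *ᵥ a with hx
    have hxb : ∀ i j, b.1 i = b.1 j → x i = x j := fun i j h => by
      rw [hx, indicatorMatrix_mulVec, indicatorMatrix_mulVec, hσ, hσ, h]
    let N : Fin n → Fin n → ℝ := fun i j => if b.1 j = b.1 i then 0 else C (b.1 i) (b.1 j)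
    have hN : ∀ i, ∑ j, N i j = ∑ l ∈ Finset.univ.erase (b.1 i), blockSize b l * C (b.1 i) l := by
      intro i
      refine (sum_comp_labeling b fun l => if l = b.1 i then 0 else C (b.1 i) l).trans ?_
      rw [← Finset.sum_erase_add _ _ (Finset.mem_univ (b.1 i)), if_pos rfl, mul_zero, add_zero]
      exact Finset.sum_congr rfl fun l hl => by rw [if_neg (Finset.ne_of_mem_erase hl)]
    have hNs : ∀ i j, N i j = N j i := fun i j => by
      simp only [N, hC.apply (b.1 i) (b.1 j), eq_comm (a := b.1 j)]
    have hN0 : ∀ i j, 0 ≤ N i j := fun i j => by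
      simp only [N]; split_ifs; exacts [le_rfl, hC0 _ _]
    have hterm : ∀ i j, blockMatrix b C i j * (x i - x j) ^ 2 ≤
        2 * (N i j * x i ^ 2) + 2 * (N j i * x j ^ 2) := by
      intro i j
      rcases eq_or_ne (b.1 j) (b.1 i) with h | h
      · rw [hxb j i h, sub_self]
        have := mul_nonneg (hN0 i j) (sq_nonneg (x i))
        have := mul_nonneg (hN0 j i) (sq_nonneg (x i))
        nlinarith
      · rw [← hNs i j]
        simp only [N, if_neg h, blockMatrix, Matrix.of_apply]
        nlinarith [mul_nonneg (hC0 (b.1 i) (b.1 j)) (sq_nonneg (x i + x j))]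
    rw [dotProduct_graphLaplacian_mulVec hsymm]
    have h1 : ∑ i, ∑ j, 2 * (N i j * x i ^ 2) ≤ μ * (x ⬝ᵥ x) := by
      rw [dotProduct, Finset.mul_sum]
      refine Finset.sum_le_sum fun i _ => ?_
      rw [← Finset.mul_sum, ← Finset.sum_mul, hN, ← mul_assoc, ← sq]
      exact mul_le_mul_of_nonneg_right (hout _) (sq_nonneg _)
    have h2 : ∑ i, ∑ j, blockMatrix b C i j * (x i - x j) ^ 2 ≤
        ∑ i, ∑ j, 2 * (N i j * x i ^ 2) + ∑ i, ∑ j, 2 * (N j i * x j ^ 2) := by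
      rw [← Finset.sum_add_distrib]
      refine Finset.sum_le_sum fun i _ => ?_
      rw [← Finset.sum_add_distrib]
      exact Finset.sum_le_sum fun j _ => hterm i j
    rw [Finset.sum_comm (f := fun i j => 2 * (N j i * x j ^ 2))] at h2
    linarith
  · ext i
    have ⟨σ, hσ⟩ := hbc
    obtain ⟨l, rfl⟩ := σ.surjective i
    rw [Matrix.mulVec, dotProduct, Pi.zero_apply]
    have h1 : ∀ j, (indicatorMatrix ℝ c)ᵀ (σ l) j *
        (graphLaplacian (blockMatrix b C) *ᵥ q) j =
        if b.1 j = l then (∑ m, blockSize b m * C l m) * q j else 0 := by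
      intro j
      rw [hact q hq j, Matrix.transpose_apply, indicatorMatrix, Matrix.of_apply, hσ j]
      simp only [σ.apply_eq_iff_eq]
      split_ifs with h
      · rw [h, one_mul]
      · rw [zero_mul]
    rw [Finset.sum_congr rfl fun j _ => h1 j, ← Finset.sum_filter, ← Finset.mul_sum,
      sum_filter_eq_zero_of_samePartition hbc hq, mul_zero]
  · rw [dotProduct, dotProduct, Finset.mul_sum]
    refine Finset.sum_le_sum fun i _ => ?_
    rw [hact q hq i, mul_left_comm (q i)]
    exact mul_le_mul_of_nonneg_right (hdeg _) (mul_self_nonneg _)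

/-- Diagonal dominance and balance give the expected Laplacian a gap proportional to `n`. -/
lemma exists_hasBlockGap [NeZero k] {b c : Labeling n k} (hbc : SamePartition b c)
    {C : Matrix (Fin k) (Fin k) ℝ} (hC : C.IsSymm) (hC0 : ∀ i j, 0 ≤ C i j) {ρ Δ : ℝ} (hρ : 1 ≤ ρ)
    (hbal : ∀ i j, (blockSize b i : ℝ) / (blockSize b j : ℝ) ≤ ρ) (hΔ : 0 < Δ)
    (hdom : ∀ i l, Δ ≤ C i i - 2 * ρ * ∑ j ∈ Finset.univ.erase l, C l j) :
    ∃ μ, HasBlockGap c (graphLaplacian (blockMatrix b C)) μ (Δ / (k * ρ) * n) := by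
  obtain ⟨i₀, hi₀⟩ := Finite.exists_min fun i => blockSize b i
  obtain ⟨l₀, hl₀⟩ := Finite.exists_max fun l => ∑ j ∈ Finset.univ.erase l, C l j
  set m : ℝ := (blockSize b i₀ : ℝ) with hm
  set R : ℝ := ∑ j ∈ Finset.univ.erase l₀, C l₀ j with hR
  have hm0 : 0 < m := Nat.cast_pos.2 (blockSize_pos b i₀)
  have hR0 : 0 ≤ R := Finset.sum_nonneg fun j _ => hC0 _ _
  have hρ0 : 0 < ρ := by linarith
  have hk0 : (0 : ℝ) < k := by exact_mod_cast Nat.pos_of_ne_zero (NeZero.ne k)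
  have hle : ∀ i, (blockSize b i : ℝ) ≤ ρ * m := fun i => (div_le_iff₀ hm0).1 (hbal i i₀)
  have hn : (n : ℝ) ≤ k * (ρ * m) := by
    rw [← sum_blockSize b]
    refine (Finset.sum_le_sum fun i _ => hle i).trans (le_of_eq ?_)
    simp
  have hg : Δ / (k * ρ) * n ≤ m * Δ := by
    rw [div_mul_eq_mul_div, div_le_iff₀ (by positivity)]
    nlinarith
  refine ⟨2 * (ρ * m) * R, hasBlockGap_blockMatrix hbc hC hC0 (by positivity) (fun i => ?_)
    fun i => ?_⟩
  · rw [mul_assoc]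
    refine mul_le_mul_of_nonneg_left ?_ (by norm_num)
    calc ∑ l ∈ Finset.univ.erase i, blockSize b l * C i l
        ≤ ∑ l ∈ Finset.univ.erase i, (ρ * m) * C i l :=
          Finset.sum_le_sum fun l _ => mul_le_mul_of_nonneg_right (hle l) (hC0 _ _)
      _ ≤ (ρ * m) * R := by
          rw [← Finset.mul_sum]
          exact mul_le_mul_of_nonneg_left (hl₀ i) (by positivity)
  · have h1 : (blockSize b i : ℝ) * C i i ≤ ∑ l, blockSize b l * C i l :=
      Finset.single_le_sum (f := fun l => (blockSize b l : ℝ) * C i l)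
        (fun l _ => mul_nonneg (Nat.cast_nonneg _) (hC0 _ _)) (Finset.mem_univ i)
    have h2 : m ≤ blockSize b i := Nat.cast_le.2 (hi₀ i)
    have h3 := mul_le_mul_of_nonneg_right h2 (hC0 i i)
    have h4 := mul_le_mul_of_nonneg_left (hdom i l₀) hm0.le
    rw [← hR] at h4
    linarith

end Laplacian

/-! ### Concentration of the sampled Laplacian -/

section Concentration

variable {n k : ℕ} {Ω : Type*}

/-- The symmetric random matrix with entries `Z s(i, j)`. -/
def noiseMatrix (Z : Sym2 (Fin n) → Ω → ℝ) (ω : Ω) : Matrix (Fin n) (Fin n) ℝ :=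
  Matrix.of fun i j => Z s(i, j) ω

lemma noiseMatrix_transpose (Z : Sym2 (Fin n) → Ω → ℝ) (ω : Ω) :
    (noiseMatrix Z ω)ᵀ = noiseMatrix Z ω := by
  ext i j
  simp only [Matrix.transpose_apply, noiseMatrix, Matrix.of_apply, Sym2.eq_swap (a := j) (b := i)]

lemma noiseMatrix_mul_self_apply_sq (Z : Sym2 (Fin n) → Ω → ℝ) (i l : Fin n) (ω : Ω) :
    (noiseMatrix Z ω * noiseMatrix Z ω) i l ^ 2 = ∑ j, ∑ m,
      Z s(i, j) ω * (Z s(j, l) ω * (Z s(i, m) ω * Z s(m, l) ω)) := by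
  rw [Matrix.mul_apply, sq, Finset.sum_mul_sum]
  refine Finset.sum_congr rfl fun j _ => Finset.sum_congr rfl fun m _ => ?_
  simp only [noiseMatrix, Matrix.of_apply]; ring

/-- `‖A‖⁴ ≤ ‖A²‖_F²` for symmetric `A`. -/
lemma opNormLe_of_frobeniusSq_mul_self_le {A : Matrix (Fin n) (Fin n) ℝ} (hA : Aᵀ = A) {t : ℝ}
    (h : frobeniusSq (A * A) ≤ t ^ 4) : OpNormLe A t := by
  intro x
  have h1 : (A *ᵥ x) ⬝ᵥ (A *ᵥ x) = x ⬝ᵥ (A * A) *ᵥ x := by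
    rw [Matrix.dotProduct_mulVec, ← Matrix.mulVec_transpose, hA, Matrix.mulVec_mulVec,
      dotProduct_comm]
  have hx := zero_le_dotProduct_self x
  refine le_of_sq_le_sq ?_ (by positivity)
  rw [h1]
  calc _ ≤ _ := dotProduct_sq_le _ _
    _ ≤ (x ⬝ᵥ x) * (t ^ 4 * (x ⬝ᵥ x)) := mul_le_mul_of_nonneg_left
        ((dotProduct_mulVec_self_le _ _).trans (mul_le_mul_of_nonneg_right h hx)) hx
    _ = _ := by ring

variable [MeasurableSpace Ω] {P : Measure Ω}

/-- Independent centered noise on the unordered pairs of nodes, bounded by `w`. -/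
structure IsCenteredNoise (P : Measure Ω) (w : ℝ) (Z : Sym2 (Fin n) → Ω → ℝ) : Prop where
  measurable : ∀ e, Measurable (Z e)
  indep : iIndepFun Z P
  mean : ∀ e, ∫ ω, Z e ω ∂P = 0
  bound : ∀ e ω, |Z e ω| ≤ w

namespace IsCenteredNoise

variable {w : ℝ} {Z : Sym2 (Fin n) → Ω → ℝ}

lemma abs_prod_le (hZ : IsCenteredNoise P w Z) (e₀ e₁ e₂ e₃ : Sym2 (Fin n)) (ω : Ω) :
    |Z e₀ ω * (Z e₁ ω * (Z e₂ ω * Z e₃ ω))| ≤ w ^ 4 := by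
  have hw : 0 ≤ w := (abs_nonneg _).trans (hZ.bound e₀ ω)
  rw [abs_mul, abs_mul, abs_mul, show w ^ 4 = w * (w * (w * w)) by ring]
  gcongr <;> exact hZ.bound _ _

lemma integrable_prod [IsProbabilityMeasure P] (hZ : IsCenteredNoise P w Z)
    (e₀ e₁ e₂ e₃ : Sym2 (Fin n)) :
    Integrable (fun ω => Z e₀ ω * (Z e₁ ω * (Z e₂ ω * Z e₃ ω))) P := by
  refine Integrable.of_bound (C := w ^ 4) ?_ (ae_of_all _ fun ω => hZ.abs_prod_le e₀ e₁ e₂ e₃ ω)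
  exact ((hZ.measurable e₀).mul ((hZ.measurable e₁).mul
    ((hZ.measurable e₂).mul (hZ.measurable e₃)))).aestronglyMeasurable

lemma integral_prod_le [IsProbabilityMeasure P] (hZ : IsCenteredNoise P w Z)
    (e₀ e₁ e₂ e₃ : Sym2 (Fin n)) :
    ∫ ω, Z e₀ ω * (Z e₁ ω * (Z e₂ ω * Z e₃ ω)) ∂P ≤ w ^ 4 := by
  have h := integral_mono (hZ.integrable_prod e₀ e₁ e₂ e₃) (integrable_const (w ^ 4))
    fun ω => (le_abs_self _).trans (hZ.abs_prod_le e₀ e₁ e₂ e₃ ω)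
  simpa using h

/-- A product in which one of the variables occurs only once has mean zero. -/
lemma integral_prod_eq_zero (hZ : IsCenteredNoise P w Z) {e₀ e₁ e₂ e₃ : Sym2 (Fin n)}
    (h₁ : e₀ ≠ e₁) (h₂ : e₀ ≠ e₂) (h₃ : e₀ ≠ e₃) :
    ∫ ω, Z e₀ ω * (Z e₁ ω * (Z e₂ ω * Z e₃ ω)) ∂P = 0 := by
  classical
  have hind := hZ.indep.indepFun_finset {e₀} {e₁, e₂, e₃} (by simp [h₁, h₂, h₃]) hZ.measurable
  have h1 : Measurable fun v : (({e₀} : Finset (Sym2 (Fin n))) → ℝ) => v ⟨e₀, by simp⟩ :=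
    measurable_pi_apply _
  have h2 : Measurable fun v : (({e₁, e₂, e₃} : Finset (Sym2 (Fin n))) → ℝ) =>
      v ⟨e₁, by simp⟩ * (v ⟨e₂, by simp⟩ * v ⟨e₃, by simp⟩) := by fun_prop
  have := (hind.comp h1 h2).integral_fun_mul_eq_mul_integral
    (hZ.measurable e₀).aestronglyMeasurable
    (((hZ.measurable e₁).mul ((hZ.measurable e₂).mul
      (hZ.measurable e₃))).aestronglyMeasurable)
  refine this.trans ?_
  change (∫ ω, Z e₀ ω ∂P) * _ = 0
  rw [hZ.mean, zero_mul]

lemma integrable_sq_entry [IsProbabilityMeasure P] (hZ : IsCenteredNoise P w Z) (i l : Fin n) :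
    Integrable (fun ω => (noiseMatrix Z ω * noiseMatrix Z ω) i l ^ 2) P := by
  simp only [noiseMatrix_mul_self_apply_sq]
  exact integrable_finsetSum _ fun j _ => integrable_finsetSum _ fun m _ =>
    hZ.integrable_prod _ _ _ _

/-- The mean square of an off-diagonal entry of `Z²` is of order `n`, not `n²`: in the sum over
pairs of paths `i - j - l` and `i - m - l`, only the pairs with `j = m` and the pair with `m = i`,
`j = l` use no edge exactly once. -/
lemma integral_sq_entry_le [IsProbabilityMeasure P] (hZ : IsCenteredNoise P w Z) (i l : Fin n) :
    ∫ ω, (noiseMatrix Z ω * noiseMatrix Z ω) i l ^ 2 ∂P ≤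
      w ^ 4 * (2 * n + if i = l then (n : ℝ) ^ 2 else 0) := by
  simp only [noiseMatrix_mul_self_apply_sq]
  have hw4 : 0 ≤ w ^ 4 := by positivity
  have hn : (1 : ℝ) ≤ n := by exact_mod_cast Fin.pos i
  rw [integral_finsetSum _ fun j _ => integrable_finsetSum _ fun m _ => hZ.integrable_prod _ _ _ _]
  have hterm : ∀ j m, ∫ ω, Z s(i, j) ω * (Z s(j, l) ω * (Z s(i, m) ω * Z s(m, l) ω)) ∂P ≤
      w ^ 4 * ((if j = m then 1 else 0) + ((if m = i then (if j = l then 1 else 0) else 0) +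
        if i = l then 1 else 0)) := by
    intro j m
    by_cases hgood : i ≠ l ∧ j ≠ m ∧ ¬ (m = i ∧ j = l)
    · obtain ⟨hil, hjm, hmi⟩ := hgood
      rw [hZ.integral_prod_eq_zero]
      · positivity
      · simp only [ne_eq, Sym2.eq_iff]; grind
      · simp only [ne_eq, Sym2.eq_iff]; grind
      · simp only [ne_eq, Sym2.eq_iff]; grind
    · refine (hZ.integral_prod_le _ _ _ _).trans (le_mul_of_one_le_right hw4 ?_)
      split_ifs <;> first | (norm_num; done) | (exfalso; tauto)
  calc _ ≤ ∑ j, ∑ m, w ^ 4 * ((if j = m then (1 : ℝ) else 0) +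
        ((if m = i then (if j = l then 1 else 0) else 0) + if i = l then 1 else 0)) := by
        refine Finset.sum_le_sum fun j _ => ?_
        rw [integral_finsetSum _ fun m _ => hZ.integrable_prod _ _ _ _]
        exact Finset.sum_le_sum fun m _ => hterm j m
    _ = w ^ 4 * (n + (1 + if i = l then (n : ℝ) ^ 2 else 0)) := by
        simp only [← Finset.mul_sum, Finset.sum_add_distrib, Finset.sum_ite_eq, Finset.mem_univ,
          Finset.sum_ite_eq', if_true, Finset.sum_const, Finset.card_univ, Fintype.card_fin,
          nsmul_eq_mul, mul_one]
        split_ifs <;> simp [sq]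
    _ ≤ _ := by
        refine mul_le_mul_of_nonneg_left ?_ hw4
        linarith

lemma integrable_frobeniusSq [IsProbabilityMeasure P] (hZ : IsCenteredNoise P w Z) :
    Integrable (fun ω => frobeniusSq (noiseMatrix Z ω * noiseMatrix Z ω)) P :=
  integrable_finsetSum _ fun i _ => integrable_finsetSum _ fun l _ => hZ.integrable_sq_entry i l

lemma integral_frobeniusSq_le [IsProbabilityMeasure P] (hZ : IsCenteredNoise P w Z) :
    ∫ ω, frobeniusSq (noiseMatrix Z ω * noiseMatrix Z ω) ∂P ≤ 3 * w ^ 4 * n ^ 3 := by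
  simp only [frobeniusSq]
  rw [integral_finsetSum _ fun i _ => integrable_finsetSum _ fun l _ => hZ.integrable_sq_entry i l]
  calc _ ≤ ∑ i : Fin n, ∑ l : Fin n, w ^ 4 * (2 * n + if i = l then (n : ℝ) ^ 2 else 0) := by
        refine Finset.sum_le_sum fun i _ => ?_
        rw [integral_finsetSum _ fun l _ => hZ.integrable_sq_entry i l]
        exact Finset.sum_le_sum fun l _ => hZ.integral_sq_entry_le i l
    _ = _ := by
        simp only [← Finset.mul_sum, Finset.sum_add_distrib, Finset.sum_ite_eq, Finset.mem_univ,
          if_true, Finset.sum_const, Finset.card_univ, Fintype.card_fin, nsmul_eq_mul]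
        ring

/-- Markov's inequality for `‖Z²‖_F²`. -/
lemma measure_frobeniusSq_ge_le [IsProbabilityMeasure P] (hZ : IsCenteredNoise P w Z) {τ : ℝ}
    (hτ : 0 < τ) (hn : 0 < n) :
    P.real {ω | (τ * n) ^ 4 ≤ frobeniusSq (noiseMatrix Z ω * noiseMatrix Z ω)} ≤
      3 * w ^ 4 / (τ ^ 4 * n) := by
  have hn' : (0 : ℝ) < n := by exact_mod_cast hn
  have h := (mul_meas_ge_le_integral_of_nonneg (ae_of_all _ fun ω => frobeniusSq_nonneg _)
    hZ.integrable_frobeniusSq ((τ * n) ^ 4)).trans hZ.integral_frobeniusSq_le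
  rw [le_div_iff₀ (by positivity)]
  have h3 : (0 : ℝ) < n ^ 3 := by positivity
  refine le_of_mul_le_mul_right ?_ h3
  refine le_trans (le_of_eq ?_) h
  ring

/-- Hoeffding's inequality for the noise in one degree, with `exp (-y) ≤ 2 / y²`. -/
lemma measure_rowSum_ge_le [IsProbabilityMeasure P] (hZ : IsCenteredNoise P w Z) (hw : 0 < w)
    {τ : ℝ} (hτ : 0 < τ) (i : Fin n) :
    P.real {ω | τ * n ≤ |∑ j, Z s(i, j) ω|} ≤ 16 * w ^ 4 / (τ ^ 4 * n ^ 2) := by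
  have hn' : (0 : ℝ) < n := by exact_mod_cast Fin.pos i
  have hinj : Function.Injective fun j : Fin n => s(i, j) := fun j m h => by
    rcases Sym2.eq_iff.1 h with h | h
    · exact h.2
    · exact h.2.trans h.1
  have hind := hZ.indep.precomp hinj
  have hsub : ∀ j, HasSubgaussianMGF (fun ω => Z s(i, j) ω) ((‖w - -w‖₊ / 2) ^ 2) P := fun j =>
    hasSubgaussianMGF_of_mem_Icc_of_integral_eq_zero (hZ.measurable _).aemeasurable
      (ae_of_all _ fun ω => ⟨(abs_le.1 (hZ.bound _ ω)).1, (abs_le.1 (hZ.bound _ ω)).2⟩) (hZ.mean _)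
  have hc : (((‖w - -w‖₊ / 2) ^ 2 : NNReal) : ℝ) = w ^ 2 := by
    push_cast
    rw [sub_neg_eq_add, Real.norm_eq_abs, abs_of_pos (by linarith)]
    ring
  have hexp : Real.exp (-(τ * n) ^ 2 / (2 * (n * w ^ 2))) ≤ 8 * w ^ 4 / (τ ^ 4 * n ^ 2) := by
    set y := (τ * n) ^ 2 / (2 * (n * w ^ 2)) with hy
    have hy0 : 0 < y := by positivity
    have h1 := Real.quadratic_le_exp_of_nonneg hy0.le
    rw [neg_div, ← hy, Real.exp_neg, inv_le_comm₀ (Real.exp_pos _) (by positivity)]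
    refine le_trans (le_of_eq ?_) (le_trans (by linarith : y ^ 2 / 2 ≤ _) h1)
    rw [hy]; field_simp; ring
  have h1 := HasSubgaussianMGF.measure_sum_ge_le_of_iIndepFun hind (s := Finset.univ)
    (fun j _ => hsub j) (by positivity : 0 ≤ τ * (n : ℝ))
  have h2 := HasSubgaussianMGF.measure_sum_ge_le_of_iIndepFun
    (hind.comp (fun _ x => -x) fun _ => measurable_neg) (s := Finset.univ)
    (fun j _ => (hsub j).neg) (by positivity : 0 ≤ τ * (n : ℝ))
  simp only [Finset.sum_const, Finset.card_univ, Fintype.card_fin, nsmul_eq_mul, NNReal.coe_mul,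
    NNReal.coe_natCast, hc] at h1 h2
  have hsubset : {ω | τ * n ≤ |∑ j, Z s(i, j) ω|} ⊆
      {ω | τ * n ≤ ∑ j, Z s(i, j) ω} ∪
        {ω | τ * n ≤ ∑ j, ((fun x => -x) ∘ fun ω => Z s(i, j) ω) ω} := by
    intro ω hω
    rcases le_abs.1 (show τ * n ≤ |∑ j, Z s(i, j) ω| from hω) with h | h
    · exact Or.inl h
    · right
      simpa using h
  refine (measureReal_mono hsubset).trans ((measureReal_union_le _ _).trans ?_)
  refine (add_le_add (h1.trans hexp) (h2.trans hexp)).trans (le_of_eq ?_)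
  ring

/-- With high probability the Laplacian of the noise is small compared to `n`. -/
lemma measure_not_opNormLe_le [IsProbabilityMeasure P] (hZ : IsCenteredNoise P w Z) (hw : 0 < w)
    {τ : ℝ} (hτ : 0 < τ) (hn : 0 < n) :
    P.real {ω | ¬ OpNormLe (graphLaplacian (noiseMatrix Z ω)) (2 * (τ * n))} ≤
      19 * w ^ 4 / (τ ^ 4 * n) := by
  have hn' : (0 : ℝ) < n := by exact_mod_cast hn
  have hsubset : {ω | ¬ OpNormLe (graphLaplacian (noiseMatrix Z ω)) (2 * (τ * n))} ⊆
      {ω | (τ * n) ^ 4 ≤ frobeniusSq (noiseMatrix Z ω * noiseMatrix Z ω)} ∪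
        ⋃ i, {ω | τ * n ≤ |∑ j, Z s(i, j) ω|} := by
    intro ω hω
    by_contra hcon
    simp only [Set.mem_union, Set.mem_ofPred_eq, Set.mem_iUnion, not_or, not_le, not_exists] at hcon
    refine hω fun x => ?_
    have h1 := opNormLe_of_frobeniusSq_mul_self_le (noiseMatrix_transpose Z ω) hcon.1.le x
    set u := noiseMatrix Z ω *ᵥ x with hu
    have h2 : ∀ i, (∑ j, noiseMatrix Z ω i j) ^ 2 ≤ (τ * n) ^ 2 := fun i =>
      sq_le_sq' (abs_le.1 (hcon.2 i).le).1 (abs_le.1 (hcon.2 i).le).2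
    have h3 : ∑ i, ((∑ j, noiseMatrix Z ω i j) * x i) ^ 2 ≤ (τ * n) ^ 2 * (x ⬝ᵥ x) := by
      rw [dotProduct, Finset.mul_sum]
      refine Finset.sum_le_sum fun i _ => ?_
      rw [mul_pow, ← sq]
      exact mul_le_mul_of_nonneg_right (h2 i) (sq_nonneg _)
    have h4 : (graphLaplacian (noiseMatrix Z ω) *ᵥ x) ⬝ᵥ (graphLaplacian (noiseMatrix Z ω) *ᵥ x) ≤
        2 * ∑ i, ((∑ j, noiseMatrix Z ω i j) * x i) ^ 2 + 2 * (u ⬝ᵥ u) := by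
      rw [dotProduct, dotProduct, Finset.mul_sum, Finset.mul_sum, ← Finset.sum_add_distrib]
      refine Finset.sum_le_sum fun i _ => ?_
      rw [graphLaplacian_mulVec]
      change (_ - u i) * (_ - u i) ≤ _
      nlinarith [sq_nonneg ((∑ j, noiseMatrix Z ω i j) * x i + u i)]
    nlinarith
  refine (measureReal_mono hsubset).trans ((measureReal_union_le _ _).trans ?_)
  have hU : P.real (⋃ i, {ω | τ * n ≤ |∑ j, Z s(i, j) ω|}) ≤ 16 * w ^ 4 / (τ ^ 4 * n) := by
    refine (measureReal_iUnion_fintype_le _).trans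
      ((Finset.sum_le_sum fun i _ => hZ.measure_rowSum_ge_le hw hτ i).trans (le_of_eq ?_))
    rw [Finset.sum_const, Finset.card_univ, Fintype.card_fin, nsmul_eq_mul]
    field_simp
  refine (add_le_add (hZ.measure_frobeniusSq_ge_le hτ hn) hU).trans (le_of_eq ?_)
  ring

end IsCenteredNoise

/-- The weight of an unordered pair of nodes. -/
def edgeWeight {W : Matrix (Fin k) (Fin k) ℝ} (hW : W.IsSymm) (b : Labeling n k) :
    Sym2 (Fin n) → ℝ :=
  Sym2.lift ⟨fun i j => W (b.1 i) (b.1 j), fun i j => (hW.apply (b.1 i) (b.1 j)).symm⟩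

/-- The centered weighted edge indicators. -/
noncomputable def edgeNoise {W : Matrix (Fin k) (Fin k) ℝ} (hW : W.IsSymm) (b : Labeling n k)
    (P : Measure Ω) (X : Ω → Sym2 (Fin n) → Bool) (e : Sym2 (Fin n)) (ω : Ω) : ℝ :=
  edgeWeight hW b e * ((if X ω e = true then 1 else 0) - P.real {ω | X ω e = true})

lemma isCenteredNoise_edgeNoise [IsProbabilityMeasure P] {Q W : Matrix (Fin k) (Fin k) ℝ}
    (hW : W.IsSymm) {w : ℝ} (hw : ∀ i j, |W i j| ≤ w) {b : Labeling n k}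
    {X : Ω → Sym2 (Fin n) → Bool} (hX : IsEdgeSample P Q b X) :
    IsCenteredNoise P w (edgeNoise hW b P X) := by
  have hmeas : ∀ e, Measurable fun x : Bool =>
      edgeWeight hW b e * ((if x = true then (1 : ℝ) else 0) - P.real {ω | X ω e = true}) :=
    fun e => measurable_of_finite _
  refine ⟨fun e => (hmeas e).comp (hX.measurable e), hX.indep.comp _ hmeas, fun e => ?_,
    fun e ω => ?_⟩
  · have hset : MeasurableSet {ω | X ω e = true} :=
      (hX.measurable e) (measurableSet_singleton true)
    have h1 : (fun ω => if X ω e = true then (1 : ℝ) else 0) =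
        Set.indicator {ω | X ω e = true} fun _ => (1 : ℝ) := by
      ext ω; simp [Set.indicator_apply]
    simp only [edgeNoise]
    rw [integral_const_mul, integral_sub, h1, integral_indicator_const _ hset]
    · simp
    · rw [h1]; exact (integrable_const _).indicator hset
    · exact integrable_const _
  · have h1 : |edgeWeight hW b e| ≤ w := by
      induction e using Sym2.ind with
      | _ i j => exact hw _ _
    have h2 : |(if X ω e = true then (1 : ℝ) else 0) - P.real {ω | X ω e = true}| ≤ 1 := by
      have h3 : 0 ≤ P.real {ω | X ω e = true} := measureReal_nonneg
      have h4 : P.real {ω | X ω e = true} ≤ 1 := measureReal_le_one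
      rw [abs_le]
      split_ifs <;> constructor <;> linarith
    rw [edgeNoise, abs_mul]
    have := mul_le_mul h1 h2 (abs_nonneg _) ((abs_nonneg _).trans h1)
    rwa [mul_one] at this

lemma noiseMatrix_edgeNoise [IsProbabilityMeasure P] {Q W : Matrix (Fin k) (Fin k) ℝ}
    (hQW : IsBlockParameters Q W) {b : Labeling n k}
    {X : Ω → Sym2 (Fin n) → Bool} (hX : IsEdgeSample P Q b X) (ω : Ω) :
    noiseMatrix (edgeNoise hQW.weight_symm b P X) ω =
      adjacency W b (X ω) - blockMatrix b (Q ⊙ W) := by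
  ext i j
  have h : P.real {ω | X ω s(i, j) = true} = Q (b.1 i) (b.1 j) := by
    rw [measureReal_def, hX.law, ENNReal.toReal_ofReal (hQW.prob_mem _ _).1]
  simp only [noiseMatrix, edgeNoise, Matrix.of_apply, h, edgeWeight, Sym2.lift_mk, adjacency,
    blockMatrix, Matrix.sub_apply, Matrix.hadamard_apply]
  split_ifs <;> ring

lemma graphLaplacian_sub (A B : Matrix (Fin n) (Fin n) ℝ) :
    graphLaplacian (A - B) = graphLaplacian A - graphLaplacian B := by
  simp only [graphLaplacian, Matrix.sub_apply, Finset.sum_sub_distrib, ← Matrix.diagonal_sub]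
  abel

/-- The sampled Laplacian is within `t n` of the expected one, up to probability `O(1 / n)`. -/
lemma measure_not_opNormLe_sampledLaplacian_le [IsProbabilityMeasure P]
    {Q W : Matrix (Fin k) (Fin k) ℝ} (hQW : IsBlockParameters Q W) {w : ℝ} (hw0 : 0 < w)
    (hw : ∀ i j, |W i j| ≤ w) {b : Labeling n k} {X : Ω → Sym2 (Fin n) → Bool}
    (hX : IsEdgeSample P Q b X) {t : ℝ} (ht : 0 < t) (hn : 0 < n) :
    P.real {ω | ¬ OpNormLe (sampledLaplacian W b (X ω) - graphLaplacian (blockMatrix b (Q ⊙ W)))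
      (t * n)} ≤ 304 * w ^ 4 / (t ^ 4 * n) := by
  have h := (isCenteredNoise_edgeNoise hQW.weight_symm hw hX).measure_not_opNormLe_le hw0
    (half_pos ht) hn
  simp only [noiseMatrix_edgeNoise hQW hX, graphLaplacian_sub] at h
  rw [show 2 * (t / 2 * n) = t * n by ring] at h
  refine h.trans (le_of_eq ?_)
  have hn' : (n : ℝ) ≠ 0 := by exact_mod_cast hn.ne'
  field_simp
  norm_num

end Concentration

/-! ### Existence of the spectral embedding and of the refinement -/

section Existence

variable {n k : ℕ}

/-- The Householder reflection exchanging two unit vectors `u` and `v`. It acts trivially on a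
symmetric matrix whose kernel contains both. -/
lemma exists_householder {u v : Fin n → ℝ} (hu : u ⬝ᵥ u = 1) (hv : v ⬝ᵥ v = 1) :
    ∃ R : Matrix (Fin n) (Fin n) ℝ, Rᵀ * R = 1 ∧ R *ᵥ u = v ∧
      ∀ L : Matrix (Fin n) (Fin n) ℝ, Lᵀ = L → L *ᵥ u = 0 → L *ᵥ v = 0 → R * L = L ∧ L * R = L := by
  set w := v - u with hw
  -- the formula is also right for `u = v`, where `r = 2 / 0 = 0` and `R = 1`
  set r := 2 / (w ⬝ᵥ w) with hr
  set R : Matrix (Fin n) (Fin n) ℝ := 1 - r • Matrix.vecMulVec w w with hR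
  have hRt : Rᵀ = R := by
    rw [hR, Matrix.transpose_sub, Matrix.transpose_one, Matrix.transpose_smul,
      Matrix.transpose_vecMulVec]
  have hww : Matrix.vecMulVec w w * Matrix.vecMulVec w w = (w ⬝ᵥ w) • Matrix.vecMulVec w w := by
    rw [Matrix.vecMulVec_mul_vecMulVec, Matrix.vecMulVec_smul]
  have hrr : r * (r * (w ⬝ᵥ w)) = 2 * r := by
    rcases eq_or_ne (w ⬝ᵥ w) 0 with h | h
    · rw [hr, h]; simp
    · rw [hr]; field_simp
  refine ⟨R, ?_, ?_, fun L hL hLu hLv => ?_⟩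
  · rw [hRt, hR]
    simp only [Matrix.sub_mul, Matrix.mul_sub, Matrix.smul_mul, Matrix.mul_smul, hww,
      Matrix.one_mul, Matrix.mul_one, smul_sub, smul_smul, hrr]
    rw [two_mul, add_smul]
    abel
  · rw [hR, Matrix.sub_mulVec, Matrix.one_mulVec, Matrix.smul_mulVec, Matrix.vecMulVec_mulVec]
    rcases eq_or_ne (w ⬝ᵥ w) 0 with h | h
    · have hw0 : w = 0 := dotProduct_self_eq_zero.1 h
      rw [hr, h, div_zero, zero_smul, sub_zero]
      exact (sub_eq_zero.1 hw0).symm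
    · have h1 : w ⬝ᵥ w = -2 * (w ⬝ᵥ u) := by
        rw [hw]
        simp only [sub_dotProduct, dotProduct_sub, hu, hv, dotProduct_comm u v]
        ring
      have h2 : r * (w ⬝ᵥ u) = -1 := by
        have h3 : w ⬝ᵥ u ≠ 0 := fun h0 => h (by rw [h1, h0, mul_zero])
        rw [hr, h1]; field_simp
      ext i
      have h4 := congrFun hw i
      simp only [Pi.sub_apply, Pi.smul_apply, MulOpposite.smul_eq_mul_unop, MulOpposite.unop_op,
        smul_eq_mul] at h4 ⊢
      linear_combination (-w i) * h2 + h4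
  · have hLw : L *ᵥ w = 0 := by rw [hw, Matrix.mulVec_sub, hLu, hLv, sub_zero]
    have hwL : w ᵥ* L = 0 := by rw [← Matrix.mulVec_transpose, hL, hLw]
    constructor
    · rw [hR, Matrix.sub_mul, Matrix.one_mul, Matrix.smul_mul, Matrix.vecMulVec_mul, hwL]
      simp
    · rw [hR, Matrix.mul_sub, Matrix.mul_one, Matrix.mul_smul, Matrix.mul_vecMulVec, hLw]
      simp

/-- A spectral embedding is obtained from any orthonormal eigenbasis by a reflection in the kernel of
the Laplacian, which moves the first eigenvector to `𝟙 / √n`. -/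
lemma exists_isSpectralEmbedding [NeZero k] (hk : k ≤ n) {L : Matrix (Fin n) (Fin n) ℝ}
    (hL : L.PosSemidef) (hL1 : ∀ r : ℝ, L *ᵥ (fun _ => r) = 0) :
    ∃ (V : Matrix (Fin n) (Fin k) ℝ) (lam : Fin k → ℝ), IsSpectralEmbedding L V lam := by
  have hn : 0 < n := (Nat.pos_of_ne_zero (NeZero.ne k)).trans_le hk
  obtain ⟨U, hU1, hU2, hUL⟩ := exists_orthogonal_diagonalization hL.isHermitian
  set d := hL.isHermitian.eigenvalues with hd
  have hLt : Lᵀ = L := by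
    have := hL.isHermitian.eq
    rwa [Matrix.conjTranspose_eq_transpose_of_trivial] at this
  have hLU : L * U = U * Matrix.diagonal d := by
    conv_lhs => rw [hUL]
    rw [Matrix.mul_assoc, hU1, Matrix.mul_one]
  let e : Fin n ≃ Fin (Fintype.card (Fin n)) := (Fintype.equivOfCardEq (Fintype.card_fin _)).symm
  let idx : Fin k → Fin n := fun i =>
    e.symm (Fin.cast (Fintype.card_fin n).symm (Fin.castLE hk i).rev)
  have hidx : Function.Injective idx := fun i j h => by
    have := e.symm.injective h
    simpa using this
  have hlam : ∀ i, d (idx i) = ascEigenvalue hL.isHermitian (Fin.castLE hk i) := fun i => by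
    change hL.isHermitian.eigenvalues₀ (e (e.symm _)) = _
    rw [Equiv.apply_symm_apply]
    rfl
  -- the smallest eigenvalue is `0`
  have hd0 : d (idx 0) = 0 := by
    have hdet : L.det = 0 := by
      refine Matrix.exists_mulVec_eq_zero_iff.1 ⟨fun _ => 1, ?_, hL1 1⟩
      exact fun h => one_ne_zero (congrFun h ⟨0, hn⟩)
    rw [hL.isHermitian.det_eq_prod_eigenvalues] at hdet
    obtain ⟨j, -, hj⟩ := Finset.prod_eq_zero_iff.1 hdet
    have hj' : d j = 0 := by simpa using hj
    refine le_antisymm ?_ (hL.eigenvalues_nonneg _)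
    rw [← hj']
    refine hL.isHermitian.eigenvalues₀_antitone ?_
    change e j ≤ e (e.symm _)
    rw [Equiv.apply_symm_apply, Fin.le_def]
    have := (e j).2
    simp [Fin.rev] at this ⊢
    omega
  set u : Fin n → ℝ := fun a => U a (idx 0) with hu
  have huu : u ⬝ᵥ u = 1 := by
    have := congrFun (congrFun hU1 (idx 0)) (idx 0)
    simpa [Matrix.mul_apply, dotProduct] using this
  have hLu : L *ᵥ u = 0 := by
    ext a
    have := congrFun (congrFun hLU a) (idx 0)
    rw [Matrix.mul_diagonal, hd0, mul_zero] at this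
    exact this
  set v : Fin n → ℝ := fun _ => 1 / √(n : ℝ) with hv
  have hvv : v ⬝ᵥ v = 1 := by
    have h1 : (0 : ℝ) < n := by exact_mod_cast hn
    rw [hv, dotProduct, Finset.sum_const, Finset.card_univ, Fintype.card_fin, nsmul_eq_mul,
      div_mul_div_comm, Real.mul_self_sqrt h1.le]
    field_simp
  obtain ⟨R, hR1, hRu, hRL⟩ := exists_householder huu hvv
  obtain ⟨hRL1, hRL2⟩ := hRL L hLt hLu (hL1 _)
  set Uk : Matrix (Fin n) (Fin k) ℝ := U.submatrix id idx with hUk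
  have hLUk : L * Uk = Uk * Matrix.diagonal fun i => d (idx i) := by
    ext a i
    have := congrFun (congrFun hLU a) (idx i)
    rw [Matrix.mul_diagonal] at this ⊢
    exact this
  refine ⟨R * Uk, fun i => d (idx i), ⟨hL.isHermitian, hk, hlam⟩, ?_, ?_, fun j => ?_⟩
  · rw [← Matrix.mul_assoc, hRL2, Matrix.mul_assoc R, ← hLUk, ← Matrix.mul_assoc, hRL1]
  · rw [Matrix.transpose_mul, Matrix.mul_assoc, ← Matrix.mul_assoc Rᵀ, hR1, Matrix.one_mul]
    ext i j
    have := congrFun (congrFun hU1 (idx i)) (idx j)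
    rw [Matrix.one_apply] at this ⊢
    simp only [hidx.eq_iff] at this
    exact this
  · exact congrFun hRu j

lemma exists_isFeasible [NeZero k] (c : Labeling n k) : ∃ S, IsFeasible c S := by
  have hn : (0 : ℝ) < n := by
    exact_mod_cast (Nat.pos_of_ne_zero (NeZero.ne k)).trans_le (le_of_labeling c)
  have hsize : ∀ i, (0 : ℝ) < blockSize c i := fun i => by exact_mod_cast blockSize_pos c i
  set u : Fin k → ℝ := Pi.single 0 1
  set v : Fin k → ℝ := fun i => √(blockSize c i : ℝ) / √(n : ℝ) with hv
  have hvv : v ⬝ᵥ v = 1 := by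
    have h1 : ∀ i, v i * v i = blockSize c i / n := fun i => by
      rw [hv, div_mul_div_comm, Real.mul_self_sqrt (hsize i).le, Real.mul_self_sqrt hn.le]
    rw [dotProduct, Finset.sum_congr rfl fun i _ => h1 i, ← Finset.sum_div, sum_blockSize,
      div_self hn.ne']
  obtain ⟨R, hR, hRu, -⟩ := exists_householder (u := u) (v := v) (by simp [u]) hvv
  refine ⟨(Matrix.diagonal fun i => (√(blockSize c i : ℝ))⁻¹) * R, fun i => ?_, ?_⟩
  · have h1 : R i 0 = v i := by simpa [u] using congrFun hRu i
    have h2 := Real.sqrt_pos.2 (hsize i)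
    rw [Matrix.diagonal_mul, h1, hv]
    field_simp
  · rw [Matrix.transpose_mul, Matrix.diagonal_transpose]
    have h1 : (Matrix.diagonal fun i => (√(blockSize c i : ℝ))⁻¹) *
        (Matrix.diagonal fun i => (blockSize c i : ℝ)) *
        (Matrix.diagonal fun i => (√(blockSize c i : ℝ))⁻¹) = 1 := by
      rw [Matrix.diagonal_mul_diagonal, Matrix.diagonal_mul_diagonal, ← Matrix.diagonal_one]
      congr 1
      ext i
      have h2 := Real.sqrt_pos.2 (hsize i)
      have h3 := Real.mul_self_sqrt (hsize i).le
      field_simp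
      linarith
    calc _ = Rᵀ * ((Matrix.diagonal fun i => (√(blockSize c i : ℝ))⁻¹) *
        (Matrix.diagonal fun i => (blockSize c i : ℝ)) *
        (Matrix.diagonal fun i => (√(blockSize c i : ℝ))⁻¹)) * R := by
          simp only [Matrix.mul_assoc]
      _ = 1 := by rw [h1, Matrix.mul_one, hR]

/-- The feasible set of the refinement problem is compact, so a minimizer exists. -/
lemma exists_isRefinement [NeZero k] (V : Matrix (Fin n) (Fin k) ℝ) (c : Labeling n k) :
    ∃ S, IsRefinement V c S := by
  set K : Set (Matrix (Fin k) (Fin k) ℝ) := {S | IsFeasible c S} with hK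
  have hclosed : IsClosed K := by
    have h1 : IsClosed {S : Matrix (Fin k) (Fin k) ℝ | ∀ i, S i 0 = 1 / √(n : ℝ)} := by
      simp only [Set.ofPred_forall]
      exact isClosed_iInter fun i => isClosed_eq (by fun_prop) continuous_const
    have h2 : IsClosed {S : Matrix (Fin k) (Fin k) ℝ |
        Sᵀ * Matrix.diagonal (fun i => (blockSize c i : ℝ)) * S = 1} :=
      isClosed_eq (by fun_prop) continuous_const
    exact h1.inter h2
  have hsub : K ⊆ Set.pi Set.univ fun _ => Set.pi Set.univ fun _ => Set.Icc (-1) 1 := by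
    intro S hS i _ j _
    have h1 := congrFun (congrFun hS.2 j) j
    rw [Matrix.mul_apply, Matrix.one_apply_eq] at h1
    simp only [Matrix.mul_diagonal, Matrix.transpose_apply] at h1
    have h2 : S i j * blockSize c i * S i j ≤ 1 := by
      rw [← h1]
      refine Finset.single_le_sum (f := fun i => S i j * blockSize c i * S i j) (fun l _ => ?_)
        (Finset.mem_univ i)
      rw [mul_right_comm]
      exact mul_nonneg (mul_self_nonneg _) (Nat.cast_nonneg _)
    have h3 : (1 : ℝ) ≤ blockSize c i := by exact_mod_cast blockSize_pos c i
    have h4 : S i j ^ 2 ≤ 1 := by nlinarith [sq_nonneg (S i j)]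
    exact abs_le.1 (abs_le_one_iff_mul_self_le_one.2 (by nlinarith))
  have hcomp : IsCompact K :=
    (isCompact_univ_pi fun _ => isCompact_univ_pi fun _ => isCompact_Icc).of_isClosed_subset
      hclosed hsub
  obtain ⟨S, hS, hmin⟩ := hcomp.exists_isMinOn (exists_isFeasible c)
    (f := fun S => frobeniusSq (V - indicatorMatrix ℝ c * S))
    (by
      refine Continuous.continuousOn ?_
      simp only [frobeniusSq]
      fun_prop)
  exact ⟨S, hS, fun S' hS' => hmin hS'⟩

end Existence

/-! ### Passivity of the two closed loops -/

section Passivity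

open Filter Topology
open scoped Matrix.Norms.L2Operator

variable {n k : ℕ}

lemma nhdsWithin_sdiff_singleton_neBot {D : Set ℂ} (hD : Convex ℝ D) (hnt : D.Nontrivial) {s : ℂ}
    (hs : s ∈ D) : (𝓝[D \ {s}] s).NeBot :=
  accPt_principal_iff_nhdsWithin.1 (hD.isPreconnected.preperfect_of_nontrivial hnt s hs)

lemma convex_imagSegment (η : ℝ) : Convex ℝ (imagSegment η) := by
  have h : imagSegment η = {s : ℂ | s.re = 0} ∩ ({s : ℂ | -η < s.im} ∩ {s : ℂ | s.im < η}) := rfl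
  rw [h]
  exact (convex_hyperplane Complex.reLm.isLinear _).inter
    ((convex_halfSpace_gt Complex.imLm.isLinear _).inter
      (convex_halfSpace_lt Complex.imLm.isLinear _))

lemma imagSegment_nontrivial {η : ℝ} (hη : 0 < η) : (imagSegment η).Nontrivial := by
  refine ⟨0, ⟨by simp, by simpa using hη, by simpa using hη⟩, ((η / 2 : ℝ) : ℂ) * Complex.I,
    ⟨by simp, ?_, ?_⟩, ?_⟩
  · simp; linarith
  · simp; linarith
  · intro h
    have := congrArg Complex.im h
    simp at this
    linarith

lemma frequently_cofinite_re_nonneg : ∃ᶠ s : ℂ in cofinite, 0 ≤ s.re := by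
  rw [Filter.frequently_cofinite_iff_infinite]
  exact Set.infinite_of_injective_forall_mem (f := fun m : ℕ => (m : ℂ)) Nat.cast_injective
    fun m => by simp

/-- An inequality between continuous functions on the open right half plane extends to its
closure. -/
lemma le_of_forall_re_pos {u v : ℂ → ℝ} {s : ℂ} (hs : 0 ≤ s.re) (hu : ContinuousAt u s)
    (hv : ContinuousAt v s) (h : ∀ z : ℂ, 0 < z.re → u z ≤ v z) : u s ≤ v s := by
  set H : Set ℂ := {z : ℂ | 0 < z.re} with hH
  have hcl : s ∈ closure H := by
    rw [hH, Complex.closure_setOfPred_lt_re]; exact hs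
  have : (𝓝[H] s).NeBot := mem_closure_iff_nhdsWithin_neBot.1 hcl
  have h1 : Tendsto u (𝓝[H] s) (𝓝 (u s)) := hu.tendsto.mono_left nhdsWithin_le_nhds
  have h2 : Tendsto v (𝓝[H] s) (𝓝 (v s)) := hv.tendsto.mono_left nhdsWithin_le_nhds
  refine le_of_tendsto_of_tendsto h1 h2 ?_
  filter_upwards [self_mem_nhdsWithin] with z hz
  exact h z hz

lemma one_div_le_inv_re {γ : ℝ} {z : ℂ} (hz : z ≠ 0) (h : 1 / γ * ‖z‖ ^ 2 ≤ z.re) :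
    1 / γ ≤ (z⁻¹).re := by
  have h1 : 0 < Complex.normSq z := Complex.normSq_pos.2 hz
  rw [Complex.inv_re, le_div_iff₀ h1, Complex.normSq_eq_norm_sq]
  exact h

/-- Passivity of the dynamics and positive realness of the coupling extend to the closed right half
plane, up to finitely many points. -/
lemma eventually_passive {γ : ℝ} {g : Fin n → RatFunc ℂ} {f : RatFunc ℂ} (hg0 : ∀ i, g i ≠ 0)
    (hg : ∀ i, OutputStrictlyPassive γ (g i)) (hf : PositiveReal f) :
    ∀ᶠ s in cofinite, 0 ≤ s.re →
      (∀ i, 1 / γ ≤ ((valueAt (g i) s)⁻¹).re) ∧ 0 ≤ (valueAt f s).re := by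
  have h1 : ∀ᶠ s in cofinite, ∀ i, ¬ IsPole (g i) s :=
    Filter.eventually_all.2 fun i => eventually_not_isPole _
  have h2 : ∀ᶠ s in cofinite, ∀ i, valueAt (g i) s ≠ 0 :=
    Filter.eventually_all.2 fun i => eventually_valueAt_ne_zero (hg0 i)
  filter_upwards [h1, h2, eventually_not_isPole f] with s h1 h2 h3 hs
  refine ⟨fun i => one_div_le_inv_re (h2 i) ?_, ?_⟩
  · have hc := continuousAt_valueAt (h1 i)
    exact le_of_forall_re_pos (u := fun z => 1 / γ * ‖valueAt (g i) z‖ ^ 2)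
      (v := fun z => (valueAt (g i) z).re) hs (continuousAt_const.mul (hc.norm.pow 2))
      (Complex.continuous_re.continuousAt.comp hc) fun z hz => (hg i z hz).2
  · have hc := continuousAt_valueAt h3
    exact le_of_forall_re_pos (u := fun _ => 0) (v := fun z => (valueAt f z).re) hs continuousAt_const
      (Complex.continuous_re.continuousAt.comp hc) fun z hz => (hf.1 z hz).2.le

lemma eventually_returnMatrix_mul_closedLoop_of_accretive {γ : ℝ} (hγ : 0 < γ)
    {g : Fin n → RatFunc ℂ} {f : RatFunc ℂ} (hg0 : ∀ i, g i ≠ 0)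
    (hpass : ∀ᶠ s in cofinite, 0 ≤ s.re →
      (∀ i, 1 / γ ≤ ((valueAt (g i) s)⁻¹).re) ∧ 0 ≤ (valueAt f s).re)
    {L : Matrix (Fin n) (Fin n) ℝ} (hL : L.PosSemidef) :
    ∀ᶠ s in cofinite, returnMatrix (fun i => (valueAt (g i) s)⁻¹) (valueAt f s) L *
      evalMatrix (closedLoop g L f) s = 1 := by
  refine eventually_returnMatrix_mul_closedLoop hg0 L f
    ((frequently_cofinite_re_nonneg.and_eventually hpass).mono ?_)
  rintro s ⟨hs, h⟩ x hx
  exact (isAccretive_returnMatrix (h hs).1 (h hs).2 hL).injective (one_div_pos.2 hγ) hx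

/-- The aggregate of a block is passive, because its inverse is the sum of the inverses. -/
lemma eventually_aggregate {γ : ℝ} (hγ : 0 < γ) {g : Fin n → RatFunc ℂ} {f : RatFunc ℂ}
    (hpass : ∀ᶠ s in cofinite, 0 ≤ s.re →
      (∀ i, 1 / γ ≤ ((valueAt (g i) s)⁻¹).re) ∧ 0 ≤ (valueAt f s).re) (c : Labeling n k) :
    (∀ i, aggregate g c i ≠ 0) ∧
    (∀ᶠ s in cofinite, ∀ i, (valueAt (aggregate g c i) s)⁻¹ =
      ∑ j ∈ Finset.univ.filter (fun j => c.1 j = i), (valueAt (g j) s)⁻¹) ∧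
    ∀ᶠ s in cofinite, 0 ≤ s.re →
      (∀ i, 1 / γ ≤ ((valueAt (aggregate g c i) s)⁻¹).re) ∧ 0 ≤ (valueAt f s).re := by
  have hsum : ∀ᶠ s in cofinite, ∀ i,
      valueAt (∑ j ∈ Finset.univ.filter (fun j => c.1 j = i), (g j)⁻¹) s =
      ∑ j ∈ Finset.univ.filter (fun j => c.1 j = i), (valueAt (g j) s)⁻¹ := by
    have h1 : ∀ᶠ s in cofinite, ∀ j, valueAt (g j)⁻¹ s = (valueAt (g j) s)⁻¹ :=
      Filter.eventually_all.2 fun j => eventually_valueAt_inv _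
    have h2 : ∀ᶠ s in cofinite, ∀ i,
        valueAt (∑ j ∈ Finset.univ.filter (fun j => c.1 j = i), (g j)⁻¹) s =
        ∑ j ∈ Finset.univ.filter (fun j => c.1 j = i), valueAt (g j)⁻¹ s :=
      Filter.eventually_all.2 fun i => eventually_valueAt_sum _ _
    filter_upwards [h1, h2] with s h1 h2 i
    rw [h2]
    exact Finset.sum_congr rfl fun j _ => h1 j
  have hre : ∀ (s : ℂ) (i : Fin k), (∀ j, 1 / γ ≤ ((valueAt (g j) s)⁻¹).re) →
      1 / γ ≤ (∑ j ∈ Finset.univ.filter (fun j => c.1 j = i), (valueAt (g j) s)⁻¹).re := by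
    intro s i h
    obtain ⟨j, hj⟩ := c.2 i
    rw [Complex.re_sum]
    exact (h j).trans (Finset.single_le_sum (f := fun j => ((valueAt (g j) s)⁻¹).re)
      (fun m _ => (one_div_pos.2 hγ).le.trans (h m)) (by simp [hj]))
  have hne : ∀ i, aggregate g c i ≠ 0 := by
    intro i h0
    obtain ⟨s, hs, h1, h2⟩ :=
      (frequently_cofinite_re_nonneg.and_eventually (hpass.and hsum)).exists
    have h3 := hre s i (h1 hs).1
    rw [← h2 i, inv_eq_zero.1 h0, valueAt_zero, Complex.zero_re] at h3
    exact absurd h3 (not_le.2 (one_div_pos.2 hγ))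
  have hval : ∀ᶠ s in cofinite, ∀ i, (valueAt (aggregate g c i) s)⁻¹ =
      ∑ j ∈ Finset.univ.filter (fun j => c.1 j = i), (valueAt (g j) s)⁻¹ := by
    have h1 : ∀ᶠ s in cofinite, ∀ i, valueAt (aggregate g c i) s =
        (valueAt (∑ j ∈ Finset.univ.filter (fun j => c.1 j = i), (g j)⁻¹) s)⁻¹ :=
      Filter.eventually_all.2 fun i => eventually_valueAt_inv _
    filter_upwards [h1, hsum] with s h1 h2 i
    rw [h1, inv_inv, h2]
  refine ⟨hne, hval, ?_⟩
  filter_upwards [hpass, hval] with s h1 h2 hs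
  exact ⟨fun i => by rw [h2]; exact hre s i (h1 hs).1, (h1 hs).2⟩

lemma IsSpectralEmbedding.posSemidef_diagonal [NeZero k] {L : Matrix (Fin n) (Fin n) ℝ}
    (hL : L.PosSemidef) {V : Matrix (Fin n) (Fin k) ℝ} {lam : Fin k → ℝ}
    (hV : IsSpectralEmbedding L V lam) : (Matrix.diagonal lam).PosSemidef := by
  have h := hL.conjTranspose_mul_mul_same V
  rw [Matrix.conjTranspose_eq_transpose_of_trivial, Matrix.mul_assoc, hV.eigen,
    ← Matrix.mul_assoc, hV.orthonormal, Matrix.one_mul] at h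
  exact h

lemma IsFeasible.orthonormal [NeZero k] {c : Labeling n k} {S : Matrix (Fin k) (Fin k) ℝ}
    (hS : IsFeasible c S) : (indicatorMatrix ℝ c * S)ᵀ * (indicatorMatrix ℝ c * S) = 1 := by
  rw [← hS.2, ← transpose_indicatorMatrix_mul_self, Matrix.transpose_mul]
  simp only [Matrix.mul_assoc]

lemma IsFeasible.inv_mul [NeZero k] {c : Labeling n k} {S : Matrix (Fin k) (Fin k) ℝ}
    (hS : IsFeasible c S) : S⁻¹ * S = 1 := by
  refine Matrix.nonsing_inv_mul _ ((Matrix.isUnit_iff_isUnit_det _).1 ?_)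
  exact IsUnit.of_mul_eq_one _ (mul_eq_one_comm.1 hS.2)

/-- At a point, the reduced model is `U A`, where `A` inverts the compression of the return matrix to
the orthonormal columns of `U = P S`. -/
lemma reducedModel_eq_compression [NeZero k] {c : Labeling n k} {S : Matrix (Fin k) (Fin k) ℝ}
    (hS : IsFeasible c S) (lam : Fin k → ℝ) (h : Fin n → ℂ) (φ : ℂ) {Y : Matrix (Fin k) (Fin k) ℂ}
    (hY : returnMatrix (fun i => ∑ j ∈ Finset.univ.filter (fun j => c.1 j = i), h j) φ
      (reducedLaplacian S lam) * Y = 1) :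
    ∃ A : Matrix (Fin k) (Fin n) ℂ,
      toComplex (indicatorMatrix ℝ c) * Y * (toComplex (indicatorMatrix ℝ c))ᵀ =
        toComplex (indicatorMatrix ℝ c * S) * A ∧
      ((toComplex (indicatorMatrix ℝ c * S))ᴴ * Matrix.diagonal h *
        toComplex (indicatorMatrix ℝ c * S) + φ • toComplex (Matrix.diagonal lam)) * A =
        (toComplex (indicatorMatrix ℝ c * S))ᴴ := by
  set p := toComplex (indicatorMatrix ℝ c) with hp
  have hinv := hS.inv_mul
  have hinv' : S * S⁻¹ = 1 := mul_eq_one_comm.1 hinv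
  have hSS : toComplex S * toComplex S⁻¹ = 1 := by rw [← toComplex_mul, hinv', toComplex_one]
  have hpt : (toComplex (indicatorMatrix ℝ c * S))ᴴ = (toComplex S)ᵀ * pᵀ := by
    rw [conjTranspose_toComplex, Matrix.transpose_mul, toComplex_mul]; rfl
  refine ⟨toComplex S⁻¹ * (Y * pᵀ), ?_, ?_⟩
  · rw [toComplex_mul, Matrix.mul_assoc p (toComplex S), ← Matrix.mul_assoc (toComplex S), hSS,
      Matrix.one_mul, Matrix.mul_assoc]
  · have h1 : pᵀ * Matrix.diagonal h * p =
        Matrix.diagonal fun i => ∑ j ∈ Finset.univ.filter (fun j => c.1 j = i), h j := by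
      ext i l
      rw [Matrix.mul_apply]
      simp only [Matrix.mul_diagonal, Matrix.transpose_apply, hp, toComplex_apply,
        indicatorMatrix, Matrix.of_apply, Matrix.diagonal_apply]
      split_ifs with hil
      · subst hil
        rw [Finset.sum_filter]
        exact Finset.sum_congr rfl fun j _ => by split_ifs <;> simp
      · refine Finset.sum_eq_zero fun j _ => ?_
        by_cases h2 : c.1 j = i
        · simp [show c.1 j ≠ l from fun h3 => hil (h2.symm.trans h3)]
        · simp [h2]
    have h2 : toComplex (Matrix.diagonal lam) =
        (toComplex S)ᵀ * toComplex (reducedLaplacian S lam) * toComplex S := by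
      rw [transpose_toComplex, ← toComplex_mul, ← toComplex_mul]
      congr 1
      have h3 : Sᵀ * (S⁻¹)ᵀ = 1 := by rw [← Matrix.transpose_mul, hinv, Matrix.transpose_one]
      calc Matrix.diagonal lam = (Sᵀ * (S⁻¹)ᵀ) * Matrix.diagonal lam * (S⁻¹ * S) := by
            rw [h3, hinv, Matrix.one_mul, Matrix.mul_one]
        _ = _ := by simp only [reducedLaplacian, Matrix.mul_assoc]
    have h4 : (toComplex S)ᵀ * pᵀ * Matrix.diagonal h * toComplex (indicatorMatrix ℝ c * S) +
        φ • toComplex (Matrix.diagonal lam) = (toComplex S)ᵀ *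
        returnMatrix (fun i => ∑ j ∈ Finset.univ.filter (fun j => c.1 j = i), h j) φ
          (reducedLaplacian S lam) * toComplex S := by
      rw [returnMatrix, ← h1, h2, toComplex_mul, Matrix.mul_add, Matrix.add_mul, Matrix.mul_smul,
        Matrix.smul_mul]
      simp only [Matrix.mul_assoc, hp]
    rw [hpt, h4]
    calc _ = (toComplex S)ᵀ * (returnMatrix
          (fun i => ∑ j ∈ Finset.univ.filter (fun j => c.1 j = i), h j) φ (reducedLaplacian S lam) *
          ((toComplex S * toComplex S⁻¹) * Y)) * pᵀ := by simp only [Matrix.mul_assoc]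
      _ = _ := by rw [hSS, Matrix.one_mul, hY, Matrix.mul_one]

/-- The values of the full and of the reduced closed loop at almost all points of the closed right
half plane. -/
lemma eventually_closedLoop_values [NeZero k] {γ : ℝ} (hγ : 0 < γ) {g : Fin n → RatFunc ℂ}
    {f : RatFunc ℂ}
    (hpass : ∀ᶠ s in cofinite, 0 ≤ s.re →
      (∀ i, 1 / γ ≤ ((valueAt (g i) s)⁻¹).re) ∧ 0 ≤ (valueAt f s).re)
    {c : Labeling n k} {S : Matrix (Fin k) (Fin k) ℝ} (hS : IsFeasible c S) {lam : Fin k → ℝ}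
    (hlam : (Matrix.diagonal lam).PosSemidef) :
    ∀ᶠ s in cofinite, ∃ A : Matrix (Fin k) (Fin n) ℂ,
      evalMatrix (indicatorMatrix (RatFunc ℂ) c *
        closedLoop (aggregate g c) (reducedLaplacian S lam) f *
        (indicatorMatrix (RatFunc ℂ) c)ᵀ) s = toComplex (indicatorMatrix ℝ c * S) * A ∧
      ((toComplex (indicatorMatrix ℝ c * S))ᴴ * Matrix.diagonal (fun i => (valueAt (g i) s)⁻¹) *
        toComplex (indicatorMatrix ℝ c * S) + valueAt f s • toComplex (Matrix.diagonal lam)) * A =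
        (toComplex (indicatorMatrix ℝ c * S))ᴴ := by
  obtain ⟨hne, hval, hagg⟩ := eventually_aggregate hγ hpass c
  have hLk : (reducedLaplacian S lam).PosSemidef := by
    have := hlam.conjTranspose_mul_mul_same S⁻¹
    rwa [Matrix.conjTranspose_eq_transpose_of_trivial] at this
  set T₀ := closedLoop (aggregate g c) (reducedLaplacian S lam) f
  filter_upwards [hval, eventually_returnMatrix_mul_closedLoop_of_accretive hγ hne hagg hLk,
    eventually_evalMatrix_mul (indicatorMatrix (RatFunc ℂ) c * T₀) (indicatorMatrix (RatFunc ℂ) c)ᵀ,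
    eventually_evalMatrix_mul (indicatorMatrix (RatFunc ℂ) c) T₀] with s h1 h2 h3 h4
  rw [h3, h4, evalMatrix_transpose, evalMatrix_indicatorMatrix]
  simp only [h1] at h2
  exact reducedModel_eq_compression hS lam _ _ h2

lemma toComplex_orthonormal {U : Matrix (Fin n) (Fin k) ℝ} (hU : Uᵀ * U = 1) :
    (toComplex U)ᴴ * toComplex U = 1 := by
  rw [conjTranspose_toComplex, ← toComplex_mul, hU, toComplex_one]

lemma supNormOn_le_of_eventually {D : Set ℂ} (hD : Convex ℝ D) (hnt : D.Nontrivial)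
    {T : TransferMatrix n} {C : ℝ} (h : ∀ᶠ z in cofinite, z ∈ D → ‖evalMatrix T z‖ ≤ C) :
    supNormOn D T ≤ ENNReal.ofReal C :=
  iSup₂_le fun _ hs =>
    have := nhdsWithin_sdiff_singleton_neBot hD hnt hs
    normAt_le_of_eventually h

lemma hInfNorm_le_of_eventually {T : TransferMatrix n} {C : ℝ}
    (h : ∀ᶠ z in cofinite, 0 ≤ z.re → ‖evalMatrix T z‖ ≤ C) : hInfNorm T ≤ ENNReal.ofReal C :=
  supNormOn_le_of_eventually (convex_halfSpace_re_gt 0)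
    ⟨1, by simp, 2, by simp, by norm_num⟩ (h.mono fun _ hz h0 => hz (le_of_lt h0))

lemma hInfNorm_closedLoop_le {γ : ℝ} (hγ : 0 < γ) {g : Fin n → RatFunc ℂ} {f : RatFunc ℂ}
    (hg0 : ∀ i, g i ≠ 0) (hpass : ∀ᶠ s in cofinite, 0 ≤ s.re →
      (∀ i, 1 / γ ≤ ((valueAt (g i) s)⁻¹).re) ∧ 0 ≤ (valueAt f s).re)
    {L : Matrix (Fin n) (Fin n) ℝ} (hL : L.PosSemidef) :
    hInfNorm (closedLoop g L f) ≤ ENNReal.ofReal γ := by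
  refine hInfNorm_le_of_eventually ?_
  filter_upwards [hpass,
    eventually_returnMatrix_mul_closedLoop_of_accretive hγ hg0 hpass hL] with s h1 h2 hs
  refine ((isAccretive_returnMatrix (h1 hs).1 (h1 hs).2 hL).norm_le (one_div_pos.2 hγ) h2).trans ?_
  rw [div_div_eq_mul_div, div_one]
  exact mul_le_of_le_one_left hγ.le l2_opNorm_one_le

lemma hInfNorm_reducedModel_le [NeZero k] {γ : ℝ} (hγ : 0 < γ) {g : Fin n → RatFunc ℂ}
    {f : RatFunc ℂ} (hpass : ∀ᶠ s in cofinite, 0 ≤ s.re →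
      (∀ i, 1 / γ ≤ ((valueAt (g i) s)⁻¹).re) ∧ 0 ≤ (valueAt f s).re)
    {L : Matrix (Fin n) (Fin n) ℝ} (hL : L.PosSemidef) {c : Labeling n k} {T : TransferMatrix n}
    (hT : IsReducedModel g L f c T) : hInfNorm T ≤ ENNReal.ofReal γ := by
  obtain ⟨V, lam, S, hV, hS, rfl⟩ := hT
  have hlam := hV.posSemidef_diagonal hL
  refine hInfNorm_le_of_eventually ?_
  filter_upwards [hpass, eventually_closedLoop_values hγ hpass hS.1 hlam] with s h1 h2 hs
  obtain ⟨A, hTA, hA⟩ := h2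
  set U := toComplex (indicatorMatrix ℝ c * S)
  have hU : Uᴴ * U = 1 := toComplex_orthonormal hS.1.orthonormal
  have hU1 := l2_opNorm_le_one_of_orthonormal hU
  have hacc := ((isAccretive_diagonal (h1 hs).1).compress hU).add_smul_toComplex (h1 hs).2 hlam
  have hAn := hacc.norm_le (one_div_pos.2 hγ) hA
  rw [div_div_eq_mul_div, div_one, Matrix.l2_opNorm_conjTranspose] at hAn
  rw [hTA]
  refine (Matrix.l2_opNorm_mul U A).trans ?_
  have : ‖A‖ ≤ γ := hAn.trans (mul_le_of_le_one_left hγ.le hU1)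
  nlinarith [norm_nonneg A, norm_nonneg U]

end Passivity

/-! ### The error on a segment of the imaginary axis -/

section MainBound

open Filter Topology
open scoped Matrix.Norms.L2Operator

variable {n k : ℕ} {Q W : Matrix (Fin k) (Fin k) ℝ} {γ ρ : ℝ} {b : Labeling n k}
  {g : Fin n → RatFunc ℂ} {f : RatFunc ℂ} {M : ℝ → ℝ}

lemma zero_mem_imagSegment {η : ℝ} (hη : 0 < η) : (0 : ℂ) ∈ imagSegment η :=
  ⟨by simp, by simpa using hη, by simpa using hη⟩

/-- A zero node dynamics would have an infinite inverse on the imaginary axis. -/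
lemma NetworkAssumption.ne_zero (h : NetworkAssumption Q W γ ρ b g f M) (i : Fin n) : g i ≠ 0 := by
  intro h0
  have h1 := (le_iSup₂ (f := fun s (_ : s ∈ imagSegment 1) => (magnitudeAt (g i) s)⁻¹) 0
    (zero_mem_imagSegment one_pos)).trans (h.inverse_le 1 one_pos i)
  rw [h0, magnitudeAt, if_neg (by simp [IsPole]), valueAt_zero, enorm_zero, ENNReal.inv_zero] at h1
  exact absurd h1 (by simp)

lemma NetworkAssumption.eventually_passive (h : NetworkAssumption Q W γ ρ b g f M) :
    ∀ᶠ s in cofinite, 0 ≤ s.re →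
      (∀ i, 1 / γ ≤ ((valueAt (g i) s)⁻¹).re) ∧ 0 ≤ (valueAt f s).re :=
  _root_.eventually_passive h.ne_zero h.passive h.positiveReal

lemma NetworkAssumption.eventually_norm_inv_le (h : NetworkAssumption Q W γ ρ b g f M) {η : ℝ}
    (hη : 0 < η) :
    ∀ᶠ s in cofinite, s ∈ imagSegment η → ∀ i, ‖(valueAt (g i) s)⁻¹‖ ≤ max (M η) 0 := by
  have h1 : ∀ᶠ s in cofinite, ∀ i, ¬ IsPole (g i) s :=
    Filter.eventually_all.2 fun i => eventually_not_isPole _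
  have h2 : ∀ᶠ s in cofinite, ∀ i, valueAt (g i) s ≠ 0 :=
    Filter.eventually_all.2 fun i => eventually_valueAt_ne_zero (h.ne_zero i)
  filter_upwards [h1, h2] with s h1 h2 hs i
  have h3 := (le_iSup₂ (f := fun s (_ : s ∈ imagSegment η) => (magnitudeAt (g i) s)⁻¹) s hs).trans
    (h.inverse_le η hη i)
  rw [magnitudeAt, if_neg (h1 i), ← enorm_inv (h2 i), ← ofReal_norm,
    ENNReal.ofReal_le_ofReal_iff'] at h3
  exact le_max_iff.2 h3

lemma eventually_couplingInf_le (f : RatFunc ℂ) (η : ℝ) :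
    ∀ᶠ s in cofinite, s ∈ imagSegment η → (min (couplingInf f η) 1).toReal ≤ ‖valueAt f s‖ := by
  filter_upwards [eventually_not_isPole f] with s h1 hs
  have h2 : couplingInf f η ≤ magnitudeAt f s := iInf₂_le s hs
  rw [magnitudeAt, if_neg h1] at h2
  rw [← toReal_enorm]
  exact ENNReal.toReal_mono (by simp) ((min_le_left _ _).trans h2)

/-- If the Laplacian `L` is close to a matrix `B` with a block gap, then the reduced model built with
the right partition approximates the closed loop on a segment of the imaginary axis. -/
lemma supNormOn_sub_le [NeZero k] (h : NetworkAssumption Q W γ ρ b g f M) {η : ℝ} (hη : 0 < η)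
    {c : Labeling n k} {L B : Matrix (Fin n) (Fin n) ℝ} {μ a τ ξ : ℝ} (hL : L.PosSemidef)
    (hB : HasBlockGap c B μ a) (ha : 0 < a) (hτ : 0 ≤ τ) (hτa : 4 * τ ≤ a)
    (hE : OpNormLe (L - B) τ) (hξ0 : 0 ≤ ξ) (hξ : 4 * k * (τ / a) ^ 2 ≤ ξ ^ 2)
    (hhalf : 4 * k * (τ / a) ^ 2 ≤ 1 / 2) {T : TransferMatrix n}
    (hT : IsReducedModel g L f c T) :
    supNormOn (imagSegment η) (closedLoop g L f - T) ≤ ENNReal.ofReal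
      ((1 + max (M η) 0 * γ) * (2 * (1 + max (M η) 0 * γ) /
        ((min (couplingInf f η) 1).toReal * (a / 4)) + 2 * γ * ξ)) := by
  obtain ⟨V, lam, S, hV, hS, rfl⟩ := hT
  have hγ := h.gain_pos
  have hpass := h.eventually_passive
  have hlam := hV.posSemidef_diagonal hL
  have hlam0 : ∀ i, 0 ≤ lam i := fun i => by simpa using hlam.diag_nonneg (i := i)
  have hVS := hB.frobeniusSq_le ha hτ hτa hE hV hS (by linarith)
  have hpsd := hB.posSemidef ha hτ hτa hE hV hlam0 hS.1 (hVS.trans hhalf)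
  have hF : 0 < (min (couplingInf f η) 1).toReal :=
    ENNReal.toReal_pos (lt_min (h.coupling_pos η hη) one_pos).ne' (by simp)
  have hLt : Lᵀ = L := by
    have := hL.isHermitian.eq
    rwa [Matrix.conjTranspose_eq_transpose_of_trivial] at this
  refine supNormOn_le_of_eventually (convex_imagSegment η) (imagSegment_nontrivial hη) ?_
  filter_upwards [hpass, h.eventually_norm_inv_le hη, eventually_couplingInf_le f η,
    eventually_returnMatrix_mul_closedLoop_of_accretive hγ h.ne_zero hpass hL,
    eventually_closedLoop_values hγ hpass hS.1 hlam, eventually_evalMatrix_sub (closedLoop g L f) _]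
    with s h1 h2 h3 h4 h5 h6 hs
  obtain ⟨A, hTA, hA⟩ := h5
  obtain ⟨hre, hfre⟩ := h1 hs.1.ge
  rw [h6, hTA]
  set U := toComplex (indicatorMatrix ℝ c * S) with hU
  set v := toComplex V with hv
  have hUU : Uᴴ * U = 1 := toComplex_orthonormal hS.1.orthonormal
  have hvv : vᴴ * v = 1 := toComplex_orthonormal hV.orthonormal
  have hLv : toComplex L * v = v * toComplex (Matrix.diagonal lam) := by
    rw [hv, ← toComplex_mul, hV.eigen, toComplex_mul]
  have hvL : vᴴ * toComplex L = toComplex (Matrix.diagonal lam) * vᴴ := by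
    have := congrArg Matrix.conjTranspose hLv
    rwa [Matrix.conjTranspose_mul, Matrix.conjTranspose_mul, conjTranspose_toComplex L, hLt,
      conjTranspose_toComplex (Matrix.diagonal lam), Matrix.diagonal_transpose] at this
  have hLc : IsAccretive (a / 4) (toComplex L + ((a / 4 : ℝ) : ℂ) • (v * vᴴ)) := by
    have h7 := (isAccretive_diagonal (n := n) (c := a / 4) (h := fun _ => ((a / 4 : ℝ) : ℂ))
      fun _ => by simp).add_smul_toComplex (φ := 1) (by simp) hpsd
    convert h7 using 1
    rw [hv, conjTranspose_toComplex, ← toComplex_mul]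
    ext i j
    simp only [Matrix.add_apply, Matrix.smul_apply, toComplex_apply, Matrix.sub_apply,
      Matrix.diagonal_apply, Matrix.one_apply, smul_eq_mul]
    split_ifs <;> push_cast <;> ring
  have hvU : ‖v - U‖ ≤ ξ := by
    refine abs_le_of_sq_le_sq' ?_ hξ0 |>.2
    rw [hv, hU, ← toComplex_sub]
    exact (l2_opNorm_toComplex_sq_le _).trans (hVS.trans hξ)
  have hH : ‖(Matrix.diagonal fun i => (valueAt (g i) s)⁻¹ : Matrix (Fin n) (Fin n) ℂ)‖ ≤
      max (M η) 0 := by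
    rw [Matrix.l2_opNorm_diagonal]
    exact (pi_norm_le_iff_of_nonneg (le_max_right _ _)).2 (h2 hs)
  refine (norm_sub_closedLoop_le hγ (le_max_right _ _) hF (by positivity : 0 < a / 4) hH (h3 hs)
    hvv hUU hLv hvL hLc (isAccretive_returnMatrix hre hfre hL)
    (((isAccretive_diagonal hre).compress hUU).add_smul_toComplex hfre hlam) hvU h4 hA).trans
    (le_of_eq ?_)
  ring

end MainBound

/-! ### The threshold for the number of nodes -/

/-- A number of nodes that suffices for error `ε` with probability `1 - δ`. Here `β n` is the gap of
the expected Laplacian, `w` bounds the weights, `m` is the threshold of the clustering at `δ / 2`, and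
`M` and `F` are the bounds on the inverse dynamics and on the coupling. The first rounded term makes
the modes outside the embedding negligible. The second one makes the sampled Laplacian
`β u n`-close to the expected one with probability `1 - δ / 2`, where `u` is the minimum: its two
entries make the refined embedding accurate to `ξ = ε / (4 γ (1 + M γ))`. -/
noncomputable def nodeThreshold (k : ℕ) (γ β w δ ε : ℝ) (m : ℕ) (M : ℝ) (F : ℝ≥0∞) : ℕ :=
  m + 1 + ⌈16 * (1 + max M 0 * γ) ^ 2 / ((min F 1).toReal * β * ε)⌉₊ +
    ⌈608 * w ^ 4 / ((β * min (1 / (4 * (k : ℝ)))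
      (ε / (4 * γ * (1 + max M 0 * γ)) / (2 * k))) ^ 4 * δ)⌉₊

theorem theorem3 {k : ℕ} [NeZero k] (Q W : Matrix (Fin k) (Fin k) ℝ)
    (hQW : IsBlockParameters Q W) (γ ρ : ℝ) :
    -- the threshold, as a function of `δ`, `ε`, `Nt (δ / 2)`, `M η` and `F_l η`
    ∃ N : ℝ → ℝ → ℕ → ℝ → ℝ≥0∞ → ℕ,
      ∀ (n : ℕ) (b : Labeling n k) (g : Fin n → RatFunc ℂ) (f : RatFunc ℂ) (M : ℝ → ℝ)
        (Ω : Type*) [MeasurableSpace Ω] (P : Measure Ω) [IsProbabilityMeasure P]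
        (X : Ω → Sym2 (Fin n) → Bool) (c : Ω → Labeling n k) (Nt : ℝ → ℕ),
        NetworkAssumption Q W γ ρ b g f M →
        IsEdgeSample P Q b X →
        Measurable c →
        ConsistentClustering P b c Nt →
        (∀ ω,
          hInfNorm (closedLoop g (sampledLaplacian W b (X ω)) f) ≤ ENNReal.ofReal γ ∧
          (∃ T, IsReducedModel g (sampledLaplacian W b (X ω)) f (c ω) T) ∧
          ∀ T, IsReducedModel g (sampledLaplacian W b (X ω)) f (c ω) T →
            hInfNorm T ≤ ENNReal.ofReal γ) ∧
        ∀ η δ ε : ℝ, 0 < η → 0 < δ → δ < 1 → 0 < ε →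
          N δ ε (Nt (δ / 2)) (M η) (couplingInf f η) ≤ n →
          ENNReal.ofReal (1 - δ) ≤
            P {ω | ∀ T, IsReducedModel g (sampledLaplacian W b (X ω)) f (c ω) T →
              supNormOn (imagSegment η)
                (closedLoop g (sampledLaplacian W b (X ω)) f - T) ≤ ENNReal.ofReal ε} := by
  -- the dominance margin `Δ` is a property of `Q`, `W` and `ρ` alone, so `N` may depend on it
  obtain ⟨Δ, hΔ⟩ : ∃ Δ : ℝ, (∃ Δ : ℝ, 0 < Δ ∧ ∀ i l,
      Δ ≤ (Q ⊙ W) i i - 2 * ρ * ∑ j ∈ Finset.univ.erase l, (Q ⊙ W) l j) → 0 < Δ ∧ ∀ i l,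
      Δ ≤ (Q ⊙ W) i i - 2 * ρ * ∑ j ∈ Finset.univ.erase l, (Q ⊙ W) l j := by
    by_cases h : ∃ Δ : ℝ, 0 < Δ ∧ ∀ i l,
      Δ ≤ (Q ⊙ W) i i - 2 * ρ * ∑ j ∈ Finset.univ.erase l, (Q ⊙ W) l j
    · exact ⟨h.choose, fun _ => h.choose_spec⟩
    · exact ⟨0, fun h' => absurd h' h⟩
  obtain ⟨w, hw0, hw⟩ : ∃ w : ℝ, 0 < w ∧ ∀ i j, |W i j| ≤ w := by
    refine ⟨1 + ∑ i, ∑ j, |W i j|, by positivity, fun i j => ?_⟩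
    have h1 := Finset.single_le_sum (f := fun j => |W i j|) (fun j _ => abs_nonneg _)
      (Finset.mem_univ j)
    have h2 := Finset.single_le_sum (f := fun i => ∑ j, |W i j|)
      (fun i _ => Finset.sum_nonneg fun j _ => abs_nonneg _) (Finset.mem_univ i)
    linarith
  have hk0 : (0 : ℝ) < k := by exact_mod_cast Nat.pos_of_ne_zero (NeZero.ne k)
  have hk1 : (1 : ℝ) ≤ k := by exact_mod_cast Nat.pos_of_ne_zero (NeZero.ne k)
  refine ⟨nodeThreshold k γ (Δ / (k * ρ)) w, ?_⟩
  intro n b g f M Ω _ P _ X c Nt hA hX hc hcons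
  have hγ := hA.gain_pos
  have hpass := hA.eventually_passive
  have hL : ∀ ω, (sampledLaplacian W b (X ω)).PosSemidef := fun ω =>
    sampledLaplacian_posSemidef hQW.weight_symm hQW.weight_nonneg b (X ω)
  refine ⟨fun ω => ⟨hInfNorm_closedLoop_le hγ hA.ne_zero hpass (hL ω), ?_,
    fun T hT => hInfNorm_reducedModel_le hγ hpass (hL ω) hT⟩, ?_⟩
  · obtain ⟨V, lam, hV⟩ := exists_isSpectralEmbedding (le_of_labeling (c ω)) (hL ω)
      (graphLaplacian_mulVec_const _)
    obtain ⟨S, hS⟩ := exists_isRefinement V (c ω)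
    exact ⟨_, V, lam, S, hV, hS, rfl⟩
  intro η δ ε hη hδ hδ1 hε hN
  obtain ⟨hΔ0, hdom⟩ := hΔ hA.dominant
  have hρ0 : 0 < ρ := by linarith [hA.one_le_ratio]
  set β := Δ / (k * ρ) with hβ
  have hβ0 : 0 < β := by positivity
  set M' := max (M η) 0 with hM'
  have hM0 : 0 ≤ M' := le_max_right _ _
  set F := (min (couplingInf f η) 1).toReal with hF
  have hF0 : 0 < F :=
    ENNReal.toReal_pos (lt_min (hA.coupling_pos η hη) one_pos).ne' (by simp)
  set ξ := ε / (4 * γ * (1 + M' * γ)) with hξ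
  have hξ0 : 0 < ξ := by positivity
  set u := min (1 / (4 * (k : ℝ))) (ξ / (2 * k)) with hu
  have hu0 : 0 < u := lt_min (by positivity) (by positivity)
  -- the three requirements on the number of nodes
  have hNt : Nt (δ / 2) < n := by simp only [nodeThreshold] at hN; omega
  have hn : 0 < n := (Nat.zero_le _).trans_lt hNt
  have hn' : (0 : ℝ) < n := by exact_mod_cast hn
  have hn1 : 16 * (1 + M' * γ) ^ 2 / (F * β * ε) ≤ n :=
    Nat.ceil_le.1 (by simp only [nodeThreshold, ← hM', ← hF] at hN; omega)
  have hn2 : 608 * w ^ 4 / ((β * u) ^ 4 * δ) ≤ n :=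
    Nat.ceil_le.1 (by simp only [nodeThreshold, ← hM', ← hξ, ← hu] at hN; omega)
  -- the two bad events
  set B := graphLaplacian (blockMatrix b (Q ⊙ W)) with hB
  set G₁ : Set Ω := {ω | SamePartition b (c ω)} with hG₁
  set G₂ : Set Ω := {ω | OpNormLe (sampledLaplacian W b (X ω) - B) (β * u * n)} with hG₂
  have hG₁m : MeasurableSet G₁ := hc (MeasurableSpace.measurableSet_top (s := {x | SamePartition b x}))
  have hG₁p : P G₁ᶜ ≤ ENNReal.ofReal (δ / 2) := by
    rw [prob_compl_eq_one_sub hG₁m, tsub_le_iff_right]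
    refine le_trans (le_of_eq ?_) (add_le_add_right (hcons (δ / 2) (half_pos hδ) hNt) _)
    rw [← ENNReal.ofReal_add (by linarith) (by linarith)]
    simp
  have hG₂p : P G₂ᶜ ≤ ENNReal.ofReal (δ / 2) := by
    have h1 := measure_not_opNormLe_sampledLaplacian_le hQW hw0 hw hX (t := β * u) (by positivity) hn
    have h2 : P.real G₂ᶜ ≤ δ / 2 := by
      refine h1.trans ?_
      rw [div_le_iff₀ (by positivity)] at hn2 ⊢
      linarith
    rw [← ofReal_measureReal]
    exact ENNReal.ofReal_le_ofReal h2
  have hgood : G₁ ∩ G₂ ⊆ {ω | ∀ T, IsReducedModel g (sampledLaplacian W b (X ω)) f (c ω) T →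
      supNormOn (imagSegment η)
        (closedLoop g (sampledLaplacian W b (X ω)) f - T) ≤ ENNReal.ofReal ε} := by
    rintro ω ⟨h1, h2⟩ T hT
    have hQWsymm : (Q ⊙ W).IsSymm := by
      ext i j
      simp [hQW.prob_symm.apply i j, hQW.weight_symm.apply i j]
    obtain ⟨μ, hgap⟩ := exists_hasBlockGap h1 hQWsymm
      (fun i j => mul_nonneg (hQW.prob_mem i j).1 (hQW.weight_nonneg i j)) hA.one_le_ratio
      hA.balanced hΔ0 hdom
    have hratio : β * u * n / (β * n) = u := by field_simp
    have hu1 : 4 * k * u ≤ 1 := by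
      have h3 : u ≤ 1 / (4 * (k : ℝ)) := min_le_left _ _
      rw [le_div_iff₀ (by positivity)] at h3
      linarith
    have hu2 : 2 * k * u ≤ ξ := by
      have h3 : u ≤ ξ / (2 * k) := min_le_right _ _
      rw [le_div_iff₀ (by positivity)] at h3
      linarith
    have hu4 : 4 * u ≤ 1 := by nlinarith
    have h4 : 4 * (β * u * n) ≤ β * n := by
      have : 0 < β * n := by positivity
      nlinarith
    have h5 : 4 * k * (β * u * n / (β * n)) ^ 2 ≤ ξ ^ 2 := by
      rw [hratio]
      have h6 : (2 * k * u) ^ 2 ≤ ξ ^ 2 := pow_le_pow_left₀ (by positivity) hu2 2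
      have h7 : 0 ≤ u ^ 2 * k * (k - 1) := mul_nonneg (by positivity) (by linarith)
      nlinarith
    have h6 : 4 * k * (β * u * n / (β * n)) ^ 2 ≤ 1 / 2 := by
      rw [hratio]
      nlinarith
    refine (supNormOn_sub_le hA hη (hL ω) hgap (by positivity) (by positivity) h4 h2 hξ0.le h5 h6
      hT).trans (ENNReal.ofReal_le_ofReal ?_)
    rw [← hM', ← hF, mul_add]
    have h7 : (1 + M' * γ) * (2 * γ * ξ) = ε / 2 := by
      rw [hξ]; field_simp; norm_num
    have h8 : (1 + M' * γ) * (2 * (1 + M' * γ) / (F * (β * n / 4))) ≤ ε / 2 := by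
      rw [div_le_iff₀ (by positivity)] at hn1
      rw [← mul_div_assoc, div_le_iff₀ (by positivity)]
      nlinarith
    rw [h7]
    linarith
  refine le_trans ?_ (measure_mono hgood)
  have hcompl : P (G₁ ∩ G₂)ᶜ ≤ ENNReal.ofReal δ := by
    rw [Set.compl_inter]
    refine (measure_union_le _ _).trans ((add_le_add hG₁p hG₂p).trans (le_of_eq ?_))
    rw [← ENNReal.ofReal_add (by linarith) (by linarith), add_halves]
  have huniv : 1 ≤ P (G₁ ∩ G₂) + P (G₁ ∩ G₂)ᶜ := by
    rw [← measure_univ (μ := P), ← Set.union_compl_self (G₁ ∩ G₂)]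
    exact measure_union_le _ _
  rw [ENNReal.ofReal_sub 1 hδ.le, ENNReal.ofReal_one, tsub_le_iff_right]
  exact huniv.trans (add_le_add_right hcompl _)
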